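/- Let $d\ge 0$ and let $(x,p)\in\mathbb R^d\times\mathbb R^d$ be phase space with the Weyl–Moyal product $f*g=f\exp\!\big(\tfrac{i\hbar}{2}\overset{\leftrightarrow}{\nabla}\big)g$, $\overset{\leftrightarrow}{\nabla}=\overleftarrow{\partial}_{x^n}\overrightarrow{\partial}_{p_n}-\overleftarrow{\partial}_{p_n}\overrightarrow{\partial}_{x^n}$, understood as a formal power series in $\hbar$. For a formal series $H$ (in $\hbar$ and possibly further formal parameters) with real smooth leading term $h(x,p)$ put $$\theta(H*)(z)=\sum_{n\ge0}\theta^{(n)}(h(z))\,\frac1{n!}\big((H-h(z))*\big)^n(z),\qquad \operatorname{Tr}\theta(H*)=(2\pi\hbar)^{-d}\int d^dx\,d^dp\;\theta(H*),$$ where $\theta$ is the step function; at each order in the formal parameters the sum over $n$ is finite. The integrals $\int\theta^{(n)}(h)f$ mean $\frac{d^n}{ds^n}\big|_{s=0}\int\theta(h+s)f$, localized (for $n\ge1$) at the surface $h=0$ by any sufficiently large cutoff in $p$. A gauge parameter $\omega$ is a smooth complex function given by a convergent power series in momenta $\omega(x,p)=\sum_s\omega^{m_1\dots m_s}(x)p_{m_1}\cdots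 p_{m_s}$ whose coefficients are smooth and supported in a common compact subset of $x$-space; the gauge transformation is $\delta H=\omega^\dagger*H+H*\omega$, with $\omega^\dagger=\bar\omega$. "$\operatorname{Tr}\theta(H*)$ is invariant" means that its first variation under $\delta H$ is well defined and vanishes at every order in $\hbar$ (the prefactor $(2\pi\hbar)^{-d}$ being ignored in counting orders). (1) Let $H$ be a smooth real function such that: for each $x$ the surface $\{p:H(x,p)=0\}$ is the boundary of $\{p:H(x,p)>0\}$; for every compact $K\subset\mathbb R^d$ the set $\{(x,p):x\in K,\ H(x,p)\ge0\}$ is compact; and $dH\ne0$ wherever $H=0$. Then $\operatorname{Tr}\theta(H*)$ is invariant for every gauge parameter $\omega$. (2) Let $H_2=D(x)-g^{mn}(x)(p_m-A_m(x))(p_n-A_n(x))$ with smooth $D,g,A$, positive definite $g$ and $D\ge0$, and let $\Delta H=\sum_{s\ge3}H^{m_1\dots m_s}(x)p_{m_1}\cdots p_{m_s}$ be a smooth real convergent power series in momenta with smooth coefficients. (a) If $H=H_2+\Delta H$ is such that for every compact $K$ the set $\{(x,p):x\in K,\ H(x,p)=0\}$ is compact, and $dH\neq0$ wherever $H=0$,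 then $\operatorname{Tr}\theta(H*)$ is invariant for every gauge parameter $\omega$. (b) For $H=H_2+w\Delta H$ with $w$ a formal parameter (no condition on $\Delta H$), the first variation of $\operatorname{Tr}\theta(H*)$ under every gauge parameter $\omega$ is well defined and vanishes at every order in $\hbar$ and $w$, if $D>0$ everywhere. If $d$ is even, the same holds for all $D\ge0$, with $\int\theta^{(n)}(H_2)f$ read as the limit $s\to0^+$ of $\frac{d^n}{ds^n}\int\theta(H_2+s)f$. -/

import Mathlib

open MeasureTheory Filter Topology


noncomputable section

namespace QuantizedVolume

/-! ## Phase space, power series in momenta -/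

/-- The phase space `ℝ^d × ℝ^d`; a point is `z = (x, p)`. -/
abbrev Phase (d : ℕ) : Type := (Fin d → ℝ) × (Fin d → ℝ)

/-- `f(x,p) = ∑_s c^{m_1 … m_s}(x) p_{m_1} … p_{m_s}` is a (convergent) power series in momenta
with smooth coefficients `c`, and is smooth on phase space. -/
structure IsMomentumSeries {d : ℕ} {𝕜 : Type} [RCLike 𝕜]
    (c : (s : ℕ) → (Fin s → Fin d) → (Fin d → ℝ) → 𝕜) (f : Phase d → 𝕜) : Prop where
  smooth_coeff : ∀ s m, ContDiff ℝ (⊤ : ℕ∞) (c s m)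
  smooth : ContDiff ℝ (⊤ : ℕ∞) f
  hasSum : ∀ x p : Fin d → ℝ,
    HasSum (fun s : ℕ => ∑ m : Fin s → Fin d, c s m x * ∏ i, ((p (m i) : ℝ) : 𝕜)) (f (x, p))

/-- Gauge parameters: complex power series in momenta whose coefficients are smooth and
supported in a compact region of `x`-space. -/
def IsGaugeParameter {d : ℕ} (ω : Phase d → ℂ) : Prop :=
  ∃ c : (s : ℕ) → (Fin s → Fin d) → (Fin d → ℝ) → ℂ, IsMomentumSeries c ω ∧
    ∃ K : Set (Fin d → ℝ), IsCompact K ∧ ∀ s m, ∀ x ∉ K, c s m x = 0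

/-! ## The Weyl–Moyal star product of formal symbols -/

/-- `∂f/∂x^i`. -/
def dX {d : ℕ} (i : Fin d) (f : Phase d → ℂ) : Phase d → ℂ :=
  fun z => fderiv ℝ f z (Pi.single i 1, 0)

/-- `∂f/∂p_i`. -/
def dP {d : ℕ} (i : Fin d) (f : Phase d → ℂ) : Phase d → ℂ :=
  fun z => fderiv ℝ f z (0, Pi.single i 1)

/-- `f (∇↔)^k g`, where `∇↔ = ∂←/∂x^n ∂→/∂p_n - ∂←/∂p_n ∂→/∂x^n`. -/
def nablaPow {d : ℕ} : ℕ → (Phase d → ℂ) → (Phase d → ℂ) → (Phase d → ℂ)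
  | 0, f, g => f * g
  | k + 1, f, g => ∑ i : Fin d, (nablaPow k (dX i f) (dP i g) - nablaPow k (dP i f) (dX i g))

/-- Formal power series with coefficients in functions on phase space, in three formal parameters:
`F a b c` is the coefficient of `ħ^a w^b t^c`. Here `ħ` is the deformation parameter of the star
product, `w` the expansion parameter of the higher-rank perturbation, and `t` the parameter of an
infinitesimal transformation. -/
abbrev FormalSymbol (d : ℕ) : Type := ℕ → ℕ → ℕ → Phase d → ℂ

namespace FormalSymbol

variable {d : ℕ}

/-- The term `f · ħ^a w^b t^c`. -/
def monomial (a b c : ℕ) (f : Phase d → ℂ) : FormalSymbol d :=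
  fun a' b' c' => if a' = a ∧ b' = b ∧ c' = c then f else 0

/-- The star product `F * G = F exp((iħ/2) ∇↔) G`, bilinear over the formal parameters. -/
def star (F G : FormalSymbol d) : FormalSymbol d := fun a b c =>
  ∑ k ∈ Finset.range (a + 1), ∑ u ∈ Finset.HasAntidiagonal.antidiagonal (a - k),
    ∑ v ∈ Finset.HasAntidiagonal.antidiagonal b, ∑ r ∈ Finset.HasAntidiagonal.antidiagonal c,
      ((Complex.I / 2) ^ k / (k.factorial : ℂ)) •
        nablaPow k (F u.1 v.1 r.1) (G u.2 v.2 r.2)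

/-- The star power `(F*)^n = F * ⋯ * F`. -/
def starPow (F : FormalSymbol d) : ℕ → FormalSymbol d
  | 0 => monomial 0 0 0 1
  | n + 1 => star F (starPow F n)

/-- The gauge variation `δH = ω† * H + H * ω`; in the Weyl symbol `†` is complex conjugation. -/
def gaugeVariation (ω : Phase d → ℂ) (H : FormalSymbol d) : FormalSymbol d :=
  star (monomial 0 0 0 (fun z => (starRingEnd ℂ) (ω z))) H + star H (monomial 0 0 0 ω)

/-- `H + t δ`. -/
def addInfinitesimal (H δ : FormalSymbol d) : FormalSymbol d := fun a b c =>
  H a b c + (match c with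
    | 0 => 0
    | c' + 1 => δ a b c')

/-- The density multiplying `F^{(n)}(h)` in the semiclassical expansion of a `*`-function:
with `h = H 0 0 0` the leading symbol,
`exp_*(λ H)(z) = e^{λ h(z)} ∑_n λ^n (1/n!) ((H - h(z))*)^n (z)`, and therefore
`F(H*)(z) = ∑_n F^{(n)}(h(z)) · (1/n!) ((H - h(z))*)^n (z)`. -/
def density (H : FormalSymbol d) (n : ℕ) : FormalSymbol d := fun a b c z =>
  (1 / (n.factorial : ℂ)) *
    starPow (H - monomial 0 0 0 (fun _ => H 0 0 0 z)) n a b c z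

end FormalSymbol

/-! ## Integrals of derivatives of the step function, and the action -/

/-- `∫ θ(h + s) f`, restricted to momenta of size `< R`. -/
def levelVolume {d : ℕ} (h : Phase d → ℝ) (f : Phase d → ℂ) (R s : ℝ) : ℂ :=
  ∫ z in {z : Phase d | ‖z.2‖ < R ∧ 0 < h z + s}, f z

/-- `v = ∫ d^dx d^dp θ^{(n)}(h) f`, read as the value at `s = 0` of
`(d/ds)^n ∫ d^dx d^dp θ(h + s) f`. For `l = 𝓝 0` the inner integral is smooth for `s` near `0` and
its derivative is continuous there, which is the usual meaning of `δ^{(n-1)}(h)`; for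
`l = 𝓝[>] 0` it is the boundary value from `s > 0`. The momentum cutoff `R` is only there to
discard what happens away from the constraint surface: the value has to be the same
for all large `R`. -/
def HasThetaIntegral {d : ℕ} (l : Filter ℝ) (h : Phase d → ℝ) (n : ℕ) (f : Phase d → ℂ)
    (v : ℂ) : Prop :=
  ∀ᶠ R : ℝ in atTop, (∀ᶠ s in l, ContDiffAt ℝ (⊤ : ℕ∞) (levelVolume h f R) s) ∧
    Tendsto (iteratedDeriv n (levelVolume h f R)) l (𝓝 v)

/-- `v` is the coefficient of `ħ^a w^b t^c` in
`(2πħ)^d Tr θ(H*) = ∫ d^dx d^dp θ(H*) = ∑_n ∫ d^dx d^dp θ^{(n)}(h) · density H n`, where `h` is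
the leading symbol of `H`. (At this order the densities with `n > 2a + b + c` vanish: in a
nonvanishing term of `((H - h(z))*)^n (z)` each factor either carries a formal parameter or is
differentiated, and `ħ^k` comes with `2k` derivatives.) -/
def HasTraceTheta {d : ℕ} (l : Filter ℝ) (h : Phase d → ℝ) (H : FormalSymbol d) (a b c : ℕ)
    (v : ℂ) : Prop :=
  ∃ I : ℕ → ℂ,
    (∀ n ∈ Finset.range (2 * a + b + c + 1),
      HasThetaIntegral l h n (H.density n a b c) (I n)) ∧
    v = ∑ n ∈ Finset.range (2 * a + b + c + 1), I n

/-- `h + w Δ` as a formal symbol. -/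
def symbolOf {d : ℕ} (h Δ : Phase d → ℝ) : FormalSymbol d :=
  FormalSymbol.monomial 0 0 0 (fun z => (h z : ℂ)) +
    FormalSymbol.monomial 0 1 0 (fun z => (Δ z : ℂ))

/-- The first variation (the coefficient of `t`) of `Tr θ(H*)` under `H ↦ H + t (ω† * H + H * ω)`
at `H = h + w Δ` exists and vanishes in the order `ħ^a w^b`. -/
def InvariantAtOrder {d : ℕ} (l : Filter ℝ) (h Δ : Phase d → ℝ) (ω : Phase d → ℂ)
    (a b : ℕ) : Prop :=
  HasTraceTheta l h
    ((symbolOf h Δ).addInfinitesimal (FormalSymbol.gaugeVariation ω (symbolOf h Δ))) a b 1 0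

/-! ## Classes of Hamiltonians -/

/-- The constraint surface `h = 0` is a regular hypersurface of phase space. -/
def IsRegularSurface {d : ℕ} (h : Phase d → ℝ) : Prop :=
  ∀ z, h z = 0 → fderiv ℝ h z ≠ 0

/-- The class `C_p`: for each `x` the surface `H(x,·) = 0` is the boundary of the inside domain
`H(x,·) > 0`, which is compact, locally uniformly in `x`. -/
structure ClassCp {d : ℕ} (H : Phase d → ℝ) : Prop where
  smooth : ContDiff ℝ (⊤ : ℕ∞) H
  boundary : ∀ x, frontier {p : Fin d → ℝ | 0 < H (x, p)} = {p | H (x, p) = 0}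
  compact_inside : ∀ K : Set (Fin d → ℝ), IsCompact K →
    IsCompact {z : Phase d | z.1 ∈ K ∧ 0 ≤ H z}
  regular : IsRegularSurface H

/-- `H_2 = D(x) - g^{mn}(x) (p_m - A_m(x)) (p_n - A_n(x))`. -/
def quadraticHamiltonian {d : ℕ} (D : (Fin d → ℝ) → ℝ)
    (g : (Fin d → ℝ) → Matrix (Fin d) (Fin d) ℝ) (A : (Fin d → ℝ) → Fin d → ℝ) :
    Phase d → ℝ :=
  fun z => D z.1 - ∑ m, ∑ n, g z.1 m n * (z.2 m - A z.1 m) * (z.2 n - A z.1 n)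

/-- Smooth background fields with a Euclidean (positive definite) metric and `D ≥ 0`. -/
structure IsEuclideanBackground {d : ℕ} (D : (Fin d → ℝ) → ℝ)
    (g : (Fin d → ℝ) → Matrix (Fin d) (Fin d) ℝ) (A : (Fin d → ℝ) → Fin d → ℝ) : Prop where
  smooth_D : ContDiff ℝ (⊤ : ℕ∞) D
  smooth_g : ∀ m n, ContDiff ℝ (⊤ : ℕ∞) (fun x => g x m n)
  smooth_A : ∀ m, ContDiff ℝ (⊤ : ℕ∞) (fun x => A x m)
  posDef : ∀ x, (g x).PosDef
  nonneg : ∀ x, 0 ≤ D x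

/-- `ΔH = ∑_{s ≥ 3} H^{m_1 … m_s}(x) p_{m_1} … p_{m_s}`, a real power series in momenta. -/
def IsHigherRank {d : ℕ} (Δ : Phase d → ℝ) : Prop :=
  ∃ c : (s : ℕ) → (Fin s → Fin d) → (Fin d → ℝ) → ℝ, IsMomentumSeries c Δ ∧
    ∀ s < 3, ∀ m x, c s m x = 0

end QuantizedVolume

end

open MeasureTheory Filter Topology

noncomputable section

namespace QuantizedVolume

/-! Cyclicity of the trace drives the proof. If `ω` has compact support and `Φ` is a polynomial,
then `δ Tr Φ(H*) = Tr(Φ'(H) * δH) = Tr((ω† + ω) * H Φ'(H))`, because under the phase space integral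
all corrections to the pointwise product in `f * g` are total divergences. To use this freely,
formal symbols are realised in an honest ring (`SymbolRing`), where associativity of the Moyal
product comes from the exponential of commuting slot operators (`bidiff_assoc`). Expanding both
sides around the leading symbol `h` (`toSymbol_aeval`) gives, at each order, a finite linear
relation between integrals `∫ Φ^(n)(h) f` with test functions `f` (`integral_polynomial_variation`,
`polynomial_variation`).

Such a relation passes from polynomials to smooth `Φ` by approximation together with finitely many
derivatives, and from smooth `Φ` to `Φ(u) = θ(u + s)` whenever the level `h = -s` is regular on the
support: integration by parts along a field `X` with `X·∇h = 1` near the level moves derivatives of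
`Φ` onto the test function (`exists_transport`). The same device shows that `V_f(s) = ∫ θ(h + s) f`
is smooth in `s`. Since `u δ(u + s) = -s δ(u + s)`, the right side becomes `-s ∑ V_{g_n}^(n+1)(s)`
with `g_n = (ω† + ω) · density n` (`variation_identity`), which is zero at `s = 0`.

Gauge parameters are not compactly supported in momenta. Over the compact `x`-support of `ω` the
surface `h = 0` is bounded, so `ω` may be replaced by a cut-off copy that agrees with it near the
surface. This changes `V_f` only by a constant near `s = 0`, and the one term that would notice a
constant, `n = 0`, has zero density (`hasThetaIntegral_of_cutoff`). The result is
`invariantAtOrder_of_regular`, which covers the class `C_p`, the case `H₂ + ΔH`, and the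
perturbative case with `D > 0`.

If `D` may vanish, the level `0` of `H₂` can be singular, but the levels `-s` with `s > 0` are
regular and the variation there is still `-s` times a sum of derivatives. It remains to show that
these derivatives have limits as `s → 0⁺`. Integration by parts in the momenta expresses the
`s`-derivative of the moments `∫ (D + s)^(-j) (h + s)₊^(k+2) f` through moments of the same kind.
The moment is bounded for `j ≤ k + 2 + d/2`, and the term that would leave this range has
coefficient `k + 2 + d/2 - j`, which is zero exactly at its edge when `d` is even. So all
derivatives are bounded, and `V_f` is half the second derivative of one such moment. -/

/-! ## Bidifferential operators on a commutative algebra -/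

section Bidifferential

variable {A κ : Type*} [CommRing A] [Algebra ℂ A] [Fintype κ]
  (D D' : κ → Derivation ℂ A A) (ε : κ → ℂ)

/-- The `k`-th power of the bidifferential operator `∑ₐ εₐ Dₐ ⊗ D'ₐ`. -/
def bidiff : ℕ → A → A → A
  | 0, f, g => f * g
  | k + 1, f, g => ∑ a, ε a • bidiff k (D a f) (D' a g)

theorem bidiff_add_left (k : ℕ) (f f' g : A) :
    bidiff D D' ε k (f + f') g = bidiff D D' ε k f g + bidiff D D' ε k f' g := by
  induction k generalizing f f' g with
  | zero => simp [bidiff, add_mul]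
  | succ k ih => simp [bidiff, ih, Finset.sum_add_distrib]

theorem bidiff_add_right (k : ℕ) (f g g' : A) :
    bidiff D D' ε k f (g + g') = bidiff D D' ε k f g + bidiff D D' ε k f g' := by
  induction k generalizing f g g' with
  | zero => simp [bidiff, mul_add]
  | succ k ih => simp [bidiff, ih, Finset.sum_add_distrib]

theorem bidiff_smul_left (k : ℕ) (c : ℂ) (f g : A) :
    bidiff D D' ε k (c • f) g = c • bidiff D D' ε k f g := by
  induction k generalizing f g with
  | zero => simp [bidiff]
  | succ k ih => simp [bidiff, ih, Finset.smul_sum, smul_comm c]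

theorem bidiff_smul_right (k : ℕ) (c : ℂ) (f g : A) :
    bidiff D D' ε k f (c • g) = c • bidiff D D' ε k f g := by
  induction k generalizing f g with
  | zero => simp [bidiff]
  | succ k ih => simp [bidiff, ih, Finset.smul_sum, smul_comm c]

/-- `bidiff` as a bilinear map. -/
def bidiffₗ (k : ℕ) : A →ₗ[ℂ] A →ₗ[ℂ] A :=
  LinearMap.mk₂ ℂ (bidiff D D' ε k) (bidiff_add_left D D' ε k) (bidiff_smul_left D D' ε k)
    (bidiff_add_right D D' ε k) (bidiff_smul_right D D' ε k)

theorem bidiff_sum_left {ι : Type*} (s : Finset ι) (k : ℕ) (f : ι → A) (g : A) :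
    bidiff D D' ε k (∑ i ∈ s, f i) g = ∑ i ∈ s, bidiff D D' ε k (f i) g := by
  exact LinearMap.map_sum₂ (bidiffₗ D D' ε k) s f g

theorem bidiff_sum_right {ι : Type*} (s : Finset ι) (k : ℕ) (f : A) (g : ι → A) :
    bidiff D D' ε k f (∑ i ∈ s, g i) = ∑ i ∈ s, bidiff D D' ε k f (g i) := by
  exact map_sum (bidiffₗ D D' ε k f) g s

theorem bidiff_succ_one_left (k : ℕ) (g : A) : bidiff D D' ε (k + 1) 1 g = 0 := by
  have h0 : ∀ k (g : A), bidiff D D' ε k 0 g = 0 := fun k g => by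
    simpa using bidiff_smul_left D D' ε k 0 0 g
  simp [bidiff, h0]

theorem bidiff_succ_one_right (k : ℕ) (f : A) : bidiff D D' ε (k + 1) f 1 = 0 := by
  have h0 : ∀ k (g : A), bidiff D D' ε k g 0 = 0 := fun k g => by
    simpa using bidiff_smul_right D D' ε k 0 g 0
  simp [bidiff, h0]

/-- Trivariate maps, on which bidifferential operators act by precomposition. -/
abbrev TriMap (A : Type*) : Type _ := A → A → A → A

/-- The bidifferential operator on the first and second slots. -/
def slot12 : Module.End ℂ (TriMap A) where
  toFun T f g h := ∑ a, ε a • T (D a f) (D' a g) h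
  map_add' T T' := by ext; simp [Finset.sum_add_distrib]
  map_smul' c T := by ext; simp [Finset.smul_sum, smul_comm c]

/-- The bidifferential operator on the first and third slots. -/
def slot13 : Module.End ℂ (TriMap A) where
  toFun T f g h := ∑ a, ε a • T (D a f) g (D' a h)
  map_add' T T' := by ext; simp [Finset.sum_add_distrib]
  map_smul' c T := by ext; simp [Finset.smul_sum, smul_comm c]

/-- The bidifferential operator on the second and third slots. -/
def slot23 : Module.End ℂ (TriMap A) where
  toFun T f g h := ∑ a, ε a • T f (D a g) (D' a h)
  map_add' T T' := by ext; simp [Finset.sum_add_distrib]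
  map_smul' c T := by ext; simp [Finset.smul_sum, smul_comm c]

theorem slot12_apply (T : TriMap A) (f g h : A) :
    slot12 D D' ε T f g h = ∑ a, ε a • T (D a f) (D' a g) h := rfl

theorem slot13_apply (T : TriMap A) (f g h : A) :
    slot13 D D' ε T f g h = ∑ a, ε a • T (D a f) g (D' a h) := rfl

theorem slot23_apply (T : TriMap A) (f g h : A) :
    slot23 D D' ε T f g h = ∑ a, ε a • T f (D a g) (D' a h) := rfl

/-- By Leibniz each derivation of the product lands on one factor or the other, so one application
of the operator is `slot12 + slot13` on the triple product. Nested products thus become polynomials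
in three slot operators. -/
theorem bidiff_mul_right (k : ℕ) (f g h : A) : bidiff D D' ε k f (g * h) =
    ((slot12 D D' ε + slot13 D D' ε) ^ k) (fun f g h => f * g * h) f g h := by
  induction k generalizing f g h with
  | zero => simp [bidiff, mul_assoc]
  | succ k ih =>
    rw [pow_succ', Module.End.mul_apply, LinearMap.add_apply]
    simp only [bidiff, Derivation.leibniz, smul_eq_mul, bidiff_add_right, mul_comm h, ih,
      Pi.add_apply, slot12_apply, slot13_apply, smul_add, Finset.sum_add_distrib]
    rw [add_comm]

theorem bidiff_mul_left (k : ℕ) (f g h : A) : bidiff D D' ε k (f * g) h =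
    ((slot13 D D' ε + slot23 D D' ε) ^ k) (fun f g h => f * g * h) f g h := by
  induction k generalizing f g h with
  | zero => simp [bidiff]
  | succ k ih =>
    rw [pow_succ', Module.End.mul_apply, LinearMap.add_apply]
    simp only [bidiff, Derivation.leibniz, smul_eq_mul, bidiff_add_left, mul_comm g, ih,
      Pi.add_apply, slot13_apply, slot23_apply, smul_add, Finset.sum_add_distrib]
    rw [add_comm]

/-- Slot operators act by precomposition, so the leftmost factor reaches the arguments first: the
inner operator stands on the left. -/
theorem bidiff_bidiff_right (k l : ℕ) (f g h : A) :
    bidiff D D' ε k f (bidiff D D' ε l g h) = ((slot23 D D' ε) ^ l *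
      (slot12 D D' ε + slot13 D D' ε) ^ k) (fun f g h => f * g * h) f g h := by
  induction l generalizing f g h with
  | zero => simpa [bidiff] using bidiff_mul_right D D' ε k f g h
  | succ l ih =>
    rw [pow_succ', mul_assoc, Module.End.mul_apply, slot23_apply]
    simp only [bidiff, bidiff_sum_right, bidiff_smul_right, ih]

theorem bidiff_bidiff_left (k l : ℕ) (f g h : A) :
    bidiff D D' ε k (bidiff D D' ε l f g) h = ((slot12 D D' ε) ^ l *
      (slot13 D D' ε + slot23 D D' ε) ^ k) (fun f g h => f * g * h) f g h := by
  induction l generalizing f g h with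
  | zero => simpa [bidiff] using bidiff_mul_left D D' ε k f g h
  | succ l ih =>
    rw [pow_succ', mul_assoc, Module.End.mul_apply, slot12_apply]
    simp only [bidiff, bidiff_sum_left, bidiff_smul_left, ih]

variable {D D'}

/-- The two operators meet only in the first slot, where each puts a `D`. Every other pair also
shares exactly one slot, which accounts for the three commutation hypotheses of `bidiff_assoc`. -/
theorem slot12_commute_slot13 (h1 : ∀ a b f, D a (D b f) = D b (D a f)) :
    Commute (slot12 D D' ε) (slot13 D D' ε) := by
  ext T f g h
  simp only [Module.End.mul_apply, slot12_apply, slot13_apply, Finset.smul_sum]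
  rw [Finset.sum_comm]
  refine Finset.sum_congr rfl fun a _ => Finset.sum_congr rfl fun b _ => ?_
  rw [smul_comm, h1]

theorem slot12_commute_slot23 (h2 : ∀ a b f, D a (D' b f) = D' b (D a f)) :
    Commute (slot12 D D' ε) (slot23 D D' ε) := by
  ext T f g h
  simp only [Module.End.mul_apply, slot12_apply, slot23_apply, Finset.smul_sum]
  rw [Finset.sum_comm]
  refine Finset.sum_congr rfl fun a _ => Finset.sum_congr rfl fun b _ => ?_
  rw [smul_comm, h2]

theorem slot13_commute_slot23 (h3 : ∀ a b f, D' a (D' b f) = D' b (D' a f)) :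
    Commute (slot13 D D' ε) (slot23 D D' ε) := by
  ext T f g h
  simp only [Module.End.mul_apply, slot13_apply, slot23_apply, Finset.smul_sum]
  rw [Finset.sum_comm]
  refine Finset.sum_congr rfl fun a _ => Finset.sum_congr rfl fun b _ => ?_
  rw [smul_comm, h3]

/-- The binomial theorem in the normalisation of the exponential series: the degree `n` part of `exp
(x + y) = exp x · exp y`. -/
theorem commute_divided_pow {B : Type*} [Ring B] [Algebra ℂ B] {x y : B} (h : Commute x y)
    (n : ℕ) : ((n.factorial : ℂ))⁻¹ • (x + y) ^ n = ∑ m ∈ Finset.HasAntidiagonal.antidiagonal n,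
      (((m.1.factorial : ℂ))⁻¹ * ((m.2.factorial : ℂ))⁻¹) • (x ^ m.1 * y ^ m.2) := by
  rw [h.add_pow', Finset.smul_sum]
  refine Finset.sum_congr rfl fun m hm => ?_
  rw [← Nat.cast_smul_eq_nsmul ℂ, smul_smul]
  congr 1
  obtain rfl := (Finset.HasAntidiagonal.mem_antidiagonal.1 hm).symm
  have := Nat.add_choose_mul_factorial_mul_factorial m.1 m.2
  rw [← Nat.choose_symm_add] at this
  have h0 : ((m.1 + m.2).factorial : ℂ) ≠ 0 := by exact_mod_cast Nat.factorial_ne_zero _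
  have h1 : (m.1.factorial : ℂ) ≠ 0 := by exact_mod_cast Nat.factorial_ne_zero _
  have h2 : (m.2.factorial : ℂ) ≠ 0 := by exact_mod_cast Nat.factorial_ne_zero _
  rw [← Nat.cast_inj (R := ℂ)] at this
  push_cast at this
  field_simp
  linear_combination this

/-- Associativity of `exp (∑ₐ εₐ Dₐ ⊗ D'ₐ)` for commuting derivations, in each order. -/
theorem bidiff_assoc (h1 : ∀ a b f, D a (D b f) = D b (D a f))
    (h2 : ∀ a b f, D a (D' b f) = D' b (D a f)) (h3 : ∀ a b f, D' a (D' b f) = D' b (D' a f))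
    (n : ℕ) (f g h : A) :
    ∑ m ∈ Finset.HasAntidiagonal.antidiagonal n, (((m.1.factorial : ℂ))⁻¹ * ((m.2.factorial : ℂ))⁻¹) •
      bidiff D D' ε m.1 (bidiff D D' ε m.2 f g) h =
    ∑ m ∈ Finset.HasAntidiagonal.antidiagonal n, (((m.1.factorial : ℂ))⁻¹ * ((m.2.factorial : ℂ))⁻¹) •
      bidiff D D' ε m.1 f (bidiff D D' ε m.2 g h) := by
  have c12_13 := slot12_commute_slot13 (D' := D') ε h1
  have c12_23 := slot12_commute_slot23 ε h2
  have c13_23 := slot13_commute_slot23 (D := D) ε h3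
  -- Both bracketings are the degree `n` part of the exponential of `slot12 + slot13 + slot23`,
  -- grouped in two ways.
  have hL := commute_divided_pow ((c12_13.add_right c12_23).symm) n
  have hR := commute_divided_pow ((c12_23.add_left c13_23)) n
  have key : (slot13 D D' ε + slot23 D D' ε) + slot12 D D' ε =
      (slot12 D D' ε + slot13 D D' ε) + slot23 D D' ε := by abel
  rw [key, hR] at hL
  have := congrFun (congrFun (congrFun (congrArg (fun L : Module.End ℂ (TriMap A) =>
    L (fun f g h => f * g * h)) hL) f) g) h
  simp only [LinearMap.sum_apply, LinearMap.smul_apply, Finset.sum_apply, Pi.smul_apply] at this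
  simp only [bidiff_bidiff_left, bidiff_bidiff_right]
  simp only [((c12_13.add_right c12_23).pow_pow _ _).eq,
    ((c12_23.add_left c13_23).symm.pow_pow _ _).eq]
  exact this.symm

end Bidifferential

/-! ## The Moyal ring -/

/-- Smooth complex functions on phase space. -/
def smoothFunctions (d : ℕ) : Subalgebra ℂ (Phase d → ℂ) where
  carrier := {f | ContDiff ℝ (⊤ : ℕ∞) f}
  mul_mem' {f g} (hf : ContDiff ℝ (⊤ : ℕ∞) f) (hg : ContDiff ℝ (⊤ : ℕ∞) g) :=
    show ContDiff ℝ (⊤ : ℕ∞) (fun z => f z * g z) from hf.mul hg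
  add_mem' {f g} (hf : ContDiff ℝ (⊤ : ℕ∞) f) (hg : ContDiff ℝ (⊤ : ℕ∞) g) :=
    show ContDiff ℝ (⊤ : ℕ∞) (fun z => f z + g z) from hf.add hg
  algebraMap_mem' c := show ContDiff ℝ (⊤ : ℕ∞) (fun _ : Phase d => c) from contDiff_const

variable {d : ℕ}

theorem contDiff_coe (f : smoothFunctions d) :
    ContDiff ℝ (⊤ : ℕ∞) (f : Phase d → ℂ) := f.2

theorem contDiff_fderiv_apply {E F : Type*} [NormedAddCommGroup E] [NormedSpace ℝ E]
    [NormedAddCommGroup F] [NormedSpace ℝ F] {f : E → F} (hf : ContDiff ℝ (⊤ : ℕ∞) f) (v : E) :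
    ContDiff ℝ (⊤ : ℕ∞) (fun z => fderiv ℝ f z v) :=
  (hf.fderiv_right (m := (⊤ : ℕ∞)) (by simp)).clm_apply contDiff_const

/-- The derivative in a fixed direction, as a derivation of the algebra of smooth functions. -/
def dirDeriv (v : Phase d) : Derivation ℂ (smoothFunctions d) (smoothFunctions d) where
  toFun f := ⟨fun z => fderiv ℝ (f : Phase d → ℂ) z v, contDiff_fderiv_apply (contDiff_coe f) v⟩
  map_add' f g := by
    ext z
    have hf := ((contDiff_coe f).differentiable (by simp)) z
    have hg := ((contDiff_coe g).differentiable (by simp)) z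
    change fderiv ℝ ((f : Phase d → ℂ) + (g : Phase d → ℂ)) z v = _
    rw [fderiv_add hf hg]; rfl
  map_smul' c f := by
    ext z
    have hf := ((contDiff_coe f).differentiable (by simp)) z
    change fderiv ℝ (c • (f : Phase d → ℂ)) z v = _
    rw [fderiv_const_smul hf]; rfl
  map_one_eq_zero' := by
    ext z
    change fderiv ℝ (fun _ => (1 : ℂ)) z v = 0
    simp
  leibniz' f g := by
    ext z
    have hf := ((contDiff_coe f).differentiable (by simp)) z
    have hg := ((contDiff_coe g).differentiable (by simp)) z
    change fderiv ℝ ((f : Phase d → ℂ) * (g : Phase d → ℂ)) z v = _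
    rw [fderiv_mul hf hg]; rfl

theorem dirDeriv_comm (v w : Phase d) (f : smoothFunctions d) :
    dirDeriv v (dirDeriv w f) = dirDeriv w (dirDeriv v f) := by
  ext z
  have hs : IsSymmSndFDerivAt ℝ (f : Phase d → ℂ) z :=
    (contDiff_coe f).contDiffAt.isSymmSndFDerivAt
      (by simp only [minSmoothness_of_isRCLikeNormedField]; exact WithTop.coe_le_coe.2 (le_top : (2 : ℕ∞) ≤ ⊤))
  have hd : DifferentiableAt ℝ (fderiv ℝ (f : Phase d → ℂ)) z :=
    ((contDiff_coe f).fderiv_right (m := (⊤ : ℕ∞)) (by simp)).differentiable (by simp) z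
  have e : ∀ v w : Phase d, fderiv ℝ (fun z => fderiv ℝ (f : Phase d → ℂ) z w) z v =
      fderiv ℝ (fderiv ℝ (f : Phase d → ℂ)) z v w := fun v w => by
    rw [fderiv_clm_apply hd (by fun_prop)]; simp
  change fderiv ℝ (fun z => fderiv ℝ (f : Phase d → ℂ) z w) z v =
    fderiv ℝ (fun z => fderiv ℝ (f : Phase d → ℂ) z v) z w
  rw [e, e, hs]

/-- Coordinate directions in phase space. -/
def dirX (i : Fin d) : Phase d := (Pi.single i 1, 0)

/-- Momentum directions in phase space. -/
def dirP (i : Fin d) : Phase d := (0, Pi.single i 1)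

/-- The left factors of the Poisson bidifferential operator. -/
def poissonLeft : Fin d ⊕ Fin d → Derivation ℂ (smoothFunctions d) (smoothFunctions d) :=
  Sum.elim (fun i => dirDeriv (dirX i)) (fun i => dirDeriv (dirP i))

/-- The right factors of the Poisson bidifferential operator. -/
def poissonRight : Fin d ⊕ Fin d → Derivation ℂ (smoothFunctions d) (smoothFunctions d) :=
  Sum.elim (fun i => dirDeriv (dirP i)) (fun i => dirDeriv (dirX i))

/-- The coefficients `(i/2) · (±1)` of the bidifferential operator `(i/2) ∇↔`. -/
def poissonCoeff : Fin d ⊕ Fin d → ℂ :=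
  Sum.elim (fun _ => Complex.I / 2) (fun _ => -(Complex.I / 2))

/-- The powers of `(i/2) ∇↔` on smooth functions. -/
abbrev moyalBidiff (k : ℕ) (f g : smoothFunctions d) : smoothFunctions d :=
  bidiff poissonLeft poissonRight poissonCoeff k f g

/-- The factor `i/2` is built into the coefficients of `bidiff`, hence the power; the two halves of
the index type are the two terms of `∇↔`. -/
theorem coe_moyalBidiff (k : ℕ) (f g : smoothFunctions d) :
    (moyalBidiff k f g : Phase d → ℂ) = (Complex.I / 2) ^ k • nablaPow k (f : Phase d → ℂ) g := by
  induction k generalizing f g with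
  | zero => simp [bidiff, nablaPow]
  | succ k ih =>
    have hX : ∀ (i : Fin d) (f : smoothFunctions d),
      ((dirDeriv (dirX i) f : smoothFunctions d) : Phase d → ℂ) = dX i f := fun i f => rfl
    have hP : ∀ (i : Fin d) (f : smoothFunctions d),
      ((dirDeriv (dirP i) f : smoothFunctions d) : Phase d → ℂ) = dP i f := fun i f => rfl
    simp only [moyalBidiff] at ih
    simp only [moyalBidiff, bidiff, nablaPow, Fintype.sum_sum_type, poissonLeft, poissonRight,
      poissonCoeff, Sum.elim_inl, Sum.elim_inr, AddMemClass.coe_add, AddSubmonoidClass.coe_finsetSum,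
      SetLike.val_smul]
    simp only [poissonLeft, poissonRight, poissonCoeff] at ih
    simp only [ih, hX, hP, Finset.smul_sum, smul_sub, ← Finset.sum_add_distrib, smul_smul]
    refine Finset.sum_congr rfl fun i _ => ?_
    rw [sub_eq_add_neg, ← neg_smul, pow_succ']
    ring_nf

theorem moyalBidiff_assoc (n : ℕ) (f g h : smoothFunctions d) :
    ∑ m ∈ Finset.HasAntidiagonal.antidiagonal n,
      (((m.1.factorial : ℂ))⁻¹ * ((m.2.factorial : ℂ))⁻¹) •
        moyalBidiff m.1 (moyalBidiff m.2 f g) h =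
    ∑ m ∈ Finset.HasAntidiagonal.antidiagonal n,
      (((m.1.factorial : ℂ))⁻¹ * ((m.2.factorial : ℂ))⁻¹) •
        moyalBidiff m.1 f (moyalBidiff m.2 g h) := by
  apply bidiff_assoc
  all_goals
    rintro (a | a) (b | b) f <;> exact dirDeriv_comm _ _ _

/-- Formal power series in `ħ` with smooth coefficients, carrying the Moyal product. -/
def Moyal (d : ℕ) : Type := ℕ → smoothFunctions d

namespace Moyal

instance : AddCommGroup (Moyal d) := inferInstanceAs (AddCommGroup (ℕ → smoothFunctions d))

instance : Module ℂ (Moyal d) := inferInstanceAs (Module ℂ (ℕ → smoothFunctions d))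

@[ext]
theorem ext {F G : Moyal d} (h : ∀ a, F a = G a) : F = G := funext h

@[simp] theorem add_apply (F G : Moyal d) (a : ℕ) : (F + G) a = F a + G a := rfl
@[simp] theorem sub_apply (F G : Moyal d) (a : ℕ) : (F - G) a = F a - G a := rfl
@[simp] theorem zero_apply (a : ℕ) : (0 : Moyal d) a = 0 := rfl
@[simp] theorem smul_apply (c : ℂ) (F : Moyal d) (a : ℕ) : (c • F) a = c • F a := rfl

/-- The order-`k` bilinear term of the Moyal product. -/
def term (k : ℕ) (f g : smoothFunctions d) : smoothFunctions d :=
  ((k.factorial : ℂ))⁻¹ • moyalBidiff k f g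

/-- `term` as a bilinear map. -/
def termₗ (k : ℕ) : smoothFunctions d →ₗ[ℂ] smoothFunctions d →ₗ[ℂ] smoothFunctions d :=
  LinearMap.mk₂ ℂ (term k)
    (fun f f' g => by simp only [term, moyalBidiff, bidiff_add_left, smul_add])
    (fun c f g => by simp only [term, moyalBidiff, bidiff_smul_left, smul_comm c])
    (fun f g g' => by simp only [term, moyalBidiff, bidiff_add_right, smul_add])
    (fun c f g => by simp only [term, moyalBidiff, bidiff_smul_right, smul_comm c])

theorem termₗ_apply (k : ℕ) (f g : smoothFunctions d) : termₗ k f g = term k f g := rfl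

theorem term_zero_eq_mul (f g : smoothFunctions d) : term 0 f g = f * g := by
  simp [term, bidiff]

theorem term_sum_left {ι : Type*} (s : Finset ι) (k : ℕ) (f : ι → smoothFunctions d)
    (g : smoothFunctions d) : term k (∑ i ∈ s, f i) g = ∑ i ∈ s, term k (f i) g :=
  LinearMap.map_sum₂ (termₗ k) s f g

theorem term_sum_right {ι : Type*} (s : Finset ι) (k : ℕ) (f : smoothFunctions d)
    (g : ι → smoothFunctions d) : term k f (∑ i ∈ s, g i) = ∑ i ∈ s, term k f (g i) :=
  map_sum (termₗ k f) g s

theorem term_assoc (n : ℕ) (f g h : smoothFunctions d) :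
    ∑ m ∈ Finset.HasAntidiagonal.antidiagonal n, term m.1 (term m.2 f g) h =
    ∑ m ∈ Finset.HasAntidiagonal.antidiagonal n, term m.1 f (term m.2 g h) := by
  simpa only [term, moyalBidiff, bidiff_smul_left, bidiff_smul_right, smul_smul] using
    moyalBidiff_assoc n f g h

instance : Mul (Moyal d) where
  mul F G := fun a => ∑ m ∈ Finset.HasAntidiagonal.antidiagonal a,
    ∑ u ∈ Finset.HasAntidiagonal.antidiagonal m.2, term m.1 (F u.1) (G u.2)

theorem mul_apply (F G : Moyal d) (a : ℕ) :
    (F * G) a = ∑ m ∈ Finset.HasAntidiagonal.antidiagonal a,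
      ∑ u ∈ Finset.HasAntidiagonal.antidiagonal m.2, term m.1 (F u.1) (G u.2) := rfl

/-- A smooth function, regarded as a series of order zero in `ħ`. -/
def of (f : smoothFunctions d) : Moyal d := fun a => if a = 0 then f else 0

theorem of_succ_apply (f : smoothFunctions d) (a : ℕ) : of f (a + 1) = 0 := rfl

instance : One (Moyal d) := ⟨of 1⟩

theorem one_def : (1 : Moyal d) = of 1 := rfl

/-- Both sides run over all triples with sum `n`. -/
theorem sum_antidiagonal_assoc {M : Type*} [AddCommMonoid M] (n : ℕ) (X : ℕ → ℕ → ℕ → M) :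
    ∑ m ∈ Finset.HasAntidiagonal.antidiagonal n, ∑ u ∈ Finset.HasAntidiagonal.antidiagonal m.1,
      X u.1 u.2 m.2 =
    ∑ m ∈ Finset.HasAntidiagonal.antidiagonal n, ∑ u ∈ Finset.HasAntidiagonal.antidiagonal m.2,
      X m.1 u.1 u.2 := by
  simp only [Finset.sum_sigma']
  apply Finset.sum_nbij' (fun ⟨⟨_i, j⟩, ⟨k, l⟩⟩ ↦ ⟨(k, l + j), (l, j)⟩)
    (fun ⟨⟨i, _j⟩, ⟨k, l⟩⟩ ↦ ⟨(i + k, l), (i, k)⟩)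
  all_goals
    rintro ⟨⟨i, j⟩, ⟨k, l⟩⟩ h
    simp only [Finset.mem_sigma, Finset.HasAntidiagonal.mem_antidiagonal] at h
    obtain ⟨h1, h2⟩ := h
    subst h2
    first
      | rfl
      | simp only [Finset.mem_sigma, Finset.HasAntidiagonal.mem_antidiagonal, and_true]; omega

/-- A normal form for associativity: the `ħ`-degrees of the three factors are summed outside, and
innermost is left the sum over how the order `m.1` is shared by the two products, which is the sum
in `term_assoc`. `mul_mul_apply_right` arrives at the same outer sums. -/
theorem mul_mul_apply_left (F G K : Moyal d) (a : ℕ) : (F * G * K) a =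
    ∑ m ∈ Finset.HasAntidiagonal.antidiagonal a,
      ∑ u ∈ Finset.HasAntidiagonal.antidiagonal m.2,
        ∑ v ∈ Finset.HasAntidiagonal.antidiagonal u.2,
          ∑ l ∈ Finset.HasAntidiagonal.antidiagonal m.1,
            term l.1 (term l.2 (F u.1) (G v.1)) (K v.2) := by
  have h1 : (F * G * K) a = ∑ m ∈ Finset.HasAntidiagonal.antidiagonal a,
      ∑ u ∈ Finset.HasAntidiagonal.antidiagonal m.2,
        ∑ l ∈ Finset.HasAntidiagonal.antidiagonal u.1,
          ∑ v ∈ Finset.HasAntidiagonal.antidiagonal l.2,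
            term m.1 (term l.1 (F v.1) (G v.2)) (K u.2) := by
    simp only [mul_apply, term_sum_left]
  rw [h1]
  have h2 : ∀ m : ℕ × ℕ, ∑ u ∈ Finset.HasAntidiagonal.antidiagonal m.2,
        ∑ l ∈ Finset.HasAntidiagonal.antidiagonal u.1,
          ∑ v ∈ Finset.HasAntidiagonal.antidiagonal l.2,
            term m.1 (term l.1 (F v.1) (G v.2)) (K u.2) =
      ∑ u ∈ Finset.HasAntidiagonal.antidiagonal m.2,
        ∑ v ∈ Finset.HasAntidiagonal.antidiagonal u.2,
          ∑ w ∈ Finset.HasAntidiagonal.antidiagonal v.2,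
            term m.1 (term u.1 (F v.1) (G w.1)) (K w.2) := fun m => by
    rw [sum_antidiagonal_assoc m.2 (fun l s q => ∑ v ∈ Finset.HasAntidiagonal.antidiagonal s,
            term m.1 (term l (F v.1) (G v.2)) (K q))]
    refine Finset.sum_congr rfl fun u _ => ?_
    rw [sum_antidiagonal_assoc u.2 (fun x y q => term m.1 (term u.1 (F x) (G y)) (K q))]
  simp only [h2]
  rw [← sum_antidiagonal_assoc a (fun k l s => ∑ v ∈ Finset.HasAntidiagonal.antidiagonal s,
          ∑ w ∈ Finset.HasAntidiagonal.antidiagonal v.2,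
            term k (term l (F v.1) (G w.1)) (K w.2))]
  refine Finset.sum_congr rfl fun m _ => ?_
  rw [Finset.sum_comm]
  refine Finset.sum_congr rfl fun u _ => ?_
  rw [Finset.sum_comm]

theorem mul_mul_apply_right (F G K : Moyal d) (a : ℕ) : (F * (G * K)) a =
    ∑ m ∈ Finset.HasAntidiagonal.antidiagonal a,
      ∑ u ∈ Finset.HasAntidiagonal.antidiagonal m.2,
        ∑ v ∈ Finset.HasAntidiagonal.antidiagonal u.2,
          ∑ l ∈ Finset.HasAntidiagonal.antidiagonal m.1,
            term l.1 (F u.1) (term l.2 (G v.1) (K v.2)) := by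
  have h1 : (F * (G * K)) a = ∑ m ∈ Finset.HasAntidiagonal.antidiagonal a,
      ∑ u ∈ Finset.HasAntidiagonal.antidiagonal m.2,
        ∑ l ∈ Finset.HasAntidiagonal.antidiagonal u.2,
          ∑ v ∈ Finset.HasAntidiagonal.antidiagonal l.2,
            term m.1 (F u.1) (term l.1 (G v.1) (K v.2)) := by
    simp only [mul_apply, term_sum_right]
  rw [h1]
  have h2 : ∀ m : ℕ × ℕ, ∑ u ∈ Finset.HasAntidiagonal.antidiagonal m.2,
        ∑ l ∈ Finset.HasAntidiagonal.antidiagonal u.2,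
          ∑ v ∈ Finset.HasAntidiagonal.antidiagonal l.2,
            term m.1 (F u.1) (term l.1 (G v.1) (K v.2)) =
      ∑ u ∈ Finset.HasAntidiagonal.antidiagonal m.2,
        ∑ v ∈ Finset.HasAntidiagonal.antidiagonal u.2,
          ∑ w ∈ Finset.HasAntidiagonal.antidiagonal v.2,
            term m.1 (F v.1) (term u.1 (G w.1) (K w.2)) := fun m => by
    rw [← sum_antidiagonal_assoc m.2 (fun x l s => ∑ v ∈ Finset.HasAntidiagonal.antidiagonal s,
            term m.1 (F x) (term l (G v.1) (K v.2))),
      ← sum_antidiagonal_assoc m.2 (fun l x s => ∑ v ∈ Finset.HasAntidiagonal.antidiagonal s,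
            term m.1 (F x) (term l (G v.1) (K v.2)))]
    refine Finset.sum_congr rfl fun u _ => ?_
    exact (Finset.Nat.sum_antidiagonal_swap (f := fun y : ℕ × ℕ =>
      ∑ v ∈ Finset.HasAntidiagonal.antidiagonal u.2,
        term m.1 (F y.2) (term y.1 (G v.1) (K v.2))))
  simp only [h2]
  rw [← sum_antidiagonal_assoc a (fun k l s => ∑ v ∈ Finset.HasAntidiagonal.antidiagonal s,
          ∑ w ∈ Finset.HasAntidiagonal.antidiagonal v.2,
            term k (F v.1) (term l (G w.1) (K w.2)))]
  refine Finset.sum_congr rfl fun m _ => ?_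
  rw [Finset.sum_comm]
  refine Finset.sum_congr rfl fun u _ => ?_
  rw [Finset.sum_comm]

protected theorem mul_assoc (F G K : Moyal d) : F * G * K = F * (G * K) := by
  ext1 a
  simp only [mul_mul_apply_left, mul_mul_apply_right, term_assoc]

theorem of_mul_apply_eq (f : smoothFunctions d) (G : Moyal d) (a : ℕ) :
    (of f * G) a = ∑ m ∈ Finset.HasAntidiagonal.antidiagonal a, term m.1 f (G m.2) := by
  rw [mul_apply]
  refine Finset.sum_congr rfl fun m _ => ?_
  rw [Finset.sum_eq_single (0, m.2)]
  · rfl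
  · rintro ⟨x, y⟩ hxy hne
    cases x with
    | zero => simp_all
    | succ x => simp [of_succ_apply, ← termₗ_apply]
  · simp

theorem mul_of_apply_eq (F : Moyal d) (g : smoothFunctions d) (a : ℕ) :
    (F * of g) a = ∑ m ∈ Finset.HasAntidiagonal.antidiagonal a, term m.1 (F m.2) g := by
  rw [mul_apply]
  refine Finset.sum_congr rfl fun m _ => ?_
  rw [Finset.sum_eq_single (m.2, 0)]
  · rfl
  · rintro ⟨x, y⟩ hxy hne
    cases y with
    | zero => simp_all
    | succ x => simp [of_succ_apply, ← termₗ_apply]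
  · simp

protected theorem one_mul (F : Moyal d) : 1 * F = F := by
  ext1 a
  rw [one_def, of_mul_apply_eq, Finset.sum_eq_single (0, a)]
  · simp [term_zero_eq_mul]
  · rintro ⟨x, y⟩ hxy hne
    cases x with
    | zero => simp_all
    | succ x => simp [term, bidiff_succ_one_left]
  · simp

protected theorem mul_one (F : Moyal d) : F * 1 = F := by
  ext1 a
  rw [one_def, mul_of_apply_eq, Finset.sum_eq_single (0, a)]
  · simp [term_zero_eq_mul]
  · rintro ⟨x, y⟩ hxy hne
    cases x with
    | zero => simp_all
    | succ x => simp [term, bidiff_succ_one_right]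
  · simp

instance : Ring (Moyal d) where
  __ := (inferInstance : AddCommGroup (Moyal d))
  mul_assoc := Moyal.mul_assoc
  one_mul := Moyal.one_mul
  mul_one := Moyal.mul_one
  zero_mul F := by ext1 a; simp [mul_apply, ← termₗ_apply]
  mul_zero F := by ext1 a; simp [mul_apply, ← termₗ_apply]
  left_distrib F G K := by
    ext1 a; simp [mul_apply, ← termₗ_apply, Finset.sum_add_distrib]
  right_distrib F G K := by
    ext1 a; simp [mul_apply, ← termₗ_apply, Finset.sum_add_distrib]

instance : Algebra ℂ (Moyal d) := Algebra.ofModule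
  (fun c F G => by ext1 a; simp [mul_apply, ← termₗ_apply, Finset.smul_sum])
  (fun c F G => by ext1 a; simp [mul_apply, ← termₗ_apply, Finset.smul_sum])

end Moyal

/-! ## Formal symbols as a ring -/

/-- Power series in `w` over the Moyal ring. -/
abbrev MoyalSeries (d : ℕ) : Type := PowerSeries (Moyal d)

/-- Power series in `t` over power series in `w` over the Moyal ring. -/
abbrev SymbolRing (d : ℕ) : Type := PowerSeries (MoyalSeries d)

/-- The formal symbol of an element of the ring of smooth formal symbols. -/
def toSymbol (F : SymbolRing d) : FormalSymbol d :=
  fun a b c => ((PowerSeries.coeff b (PowerSeries.coeff c F)) a : smoothFunctions d)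

theorem contDiff_toSymbol (F : SymbolRing d) (a b c : ℕ) :
    ContDiff ℝ (⊤ : ℕ∞) (toSymbol F a b c) := contDiff_coe _

theorem coe_term (k : ℕ) (f g : smoothFunctions d) : (Moyal.term k f g : Phase d → ℂ) =
    ((Complex.I / 2) ^ k / (k.factorial : ℂ)) • nablaPow k (f : Phase d → ℂ) g := by
  rw [Moyal.term, SetLike.val_smul, coe_moyalBidiff, smul_smul, div_eq_inv_mul ((Complex.I / 2) ^ k)]

theorem Moyal.coe_sum {ι : Type*} (s : Finset ι) (f : ι → Moyal d) (a : ℕ) :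
    (∑ i ∈ s, f i) a = ∑ i ∈ s, f i a :=
  map_sum (Pi.evalAddMonoidHom (fun _ : ℕ => smoothFunctions d) a) f s

theorem toSymbol_add (F G : SymbolRing d) : toSymbol (F + G) = toSymbol F + toSymbol G := by
  ext a b c z; simp [toSymbol]

theorem toSymbol_sub (F G : SymbolRing d) : toSymbol (F - G) = toSymbol F - toSymbol G := by
  ext a b c z; simp [toSymbol]

theorem toSymbol_smul_apply (k : ℂ) (F : SymbolRing d) (a b c : ℕ) (z : Phase d) :
    toSymbol (k • F) a b c z = k * toSymbol F a b c z := by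
  simp [toSymbol]

theorem toSymbol_sum_apply {ι : Type*} (s : Finset ι) (F : ι → SymbolRing d) (a b c : ℕ)
    (z : Phase d) : toSymbol (∑ i ∈ s, F i) a b c z = ∑ i ∈ s, toSymbol (F i) a b c z := by
  simp [toSymbol, Moyal.coe_sum]

/-- The bridge between the ring and the star product of the statement; the sums agree up to their
order. -/
theorem toSymbol_mul (F G : SymbolRing d) :
    toSymbol (F * G) = FormalSymbol.star (toSymbol F) (toSymbol G) := by
  funext a b c
  have h : toSymbol (F * G) a b c = ∑ r ∈ Finset.HasAntidiagonal.antidiagonal c,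
      ∑ v ∈ Finset.HasAntidiagonal.antidiagonal b, ∑ m ∈ Finset.HasAntidiagonal.antidiagonal a,
        ∑ u ∈ Finset.HasAntidiagonal.antidiagonal m.2,
          ((Complex.I / 2) ^ m.1 / (m.1.factorial : ℂ)) •
            nablaPow m.1 (toSymbol F u.1 v.1 r.1) (toSymbol G u.2 v.2 r.2) := by
    simp only [toSymbol, PowerSeries.coeff_mul, map_sum, Moyal.coe_sum, Moyal.mul_apply,
      AddSubmonoidClass.coe_finsetSum, coe_term]
  rw [h, FormalSymbol.star, ← Finset.Nat.sum_antidiagonal_eq_sum_range_succ (fun k l =>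
    ∑ u ∈ Finset.HasAntidiagonal.antidiagonal l,
      ∑ v ∈ Finset.HasAntidiagonal.antidiagonal b, ∑ r ∈ Finset.HasAntidiagonal.antidiagonal c,
      ((Complex.I / 2) ^ k / (k.factorial : ℂ)) •
        nablaPow k (toSymbol F u.1 v.1 r.1) (toSymbol G u.2 v.2 r.2)) a]
  rw [Finset.sum_comm]
  simp only [Finset.sum_comm (s := Finset.HasAntidiagonal.antidiagonal c)]
  rw [Finset.sum_comm]
  refine Finset.sum_congr rfl fun m _ => ?_
  rw [Finset.sum_comm]

/-- A smooth function as a power series in `w` of order zero. -/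
def ofSmooth (f : smoothFunctions d) : MoyalSeries d := PowerSeries.C (Moyal.of f)

theorem toSymbol_C_ofSmooth (f : smoothFunctions d) :
    toSymbol (PowerSeries.C (ofSmooth f)) = FormalSymbol.monomial 0 0 0 (f : Phase d → ℂ) := by
  funext a b c
  rcases c with _ | c
  · rcases b with _ | b
    · rcases a with _ | a
      · simp [toSymbol, ofSmooth, FormalSymbol.monomial, Moyal.of]
      · simp [toSymbol, ofSmooth, FormalSymbol.monomial, Moyal.of]
    · simp [toSymbol, ofSmooth, FormalSymbol.monomial, PowerSeries.coeff_C]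
  · simp [toSymbol, FormalSymbol.monomial]

theorem ofSmooth_one : ofSmooth (1 : smoothFunctions d) = 1 := by
  rw [ofSmooth, ← Moyal.one_def, map_one]

theorem toSymbol_pow (F : SymbolRing d) (n : ℕ) :
    toSymbol (F ^ n) = (toSymbol F).starPow n := by
  induction n with
  | zero =>
    rw [pow_zero, FormalSymbol.starPow, ← map_one PowerSeries.C, ← ofSmooth_one,
      toSymbol_C_ofSmooth]
    rfl
  | succ n ih => rw [pow_succ', toSymbol_mul, ih, FormalSymbol.starPow]

theorem toSymbol_algebraMap (k : ℂ) : toSymbol (algebraMap ℂ (SymbolRing d) k) =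
    FormalSymbol.monomial 0 0 0 (fun _ => k) := by
  have : algebraMap ℂ (SymbolRing d) k =
      PowerSeries.C (ofSmooth (algebraMap ℂ (smoothFunctions d) k)) := by
    rw [Algebra.algebraMap_eq_smul_one, Algebra.algebraMap_eq_smul_one]
    ext c : 1
    rcases c with _ | c
    · ext b : 1
      rcases b with _ | b
      · ext a : 1
        rcases a with _ | a
        · simp [ofSmooth, Moyal.of, Moyal.one_def]
        · simp [ofSmooth, Moyal.of, Moyal.one_def]
      · simp [ofSmooth, PowerSeries.coeff_C, PowerSeries.coeff_one]
    · simp [PowerSeries.coeff_one]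
  rw [this, toSymbol_C_ofSmooth]
  rfl

theorem density_toSymbol (F : SymbolRing d) (n a b c : ℕ) (z : Phase d) :
    (toSymbol F).density n a b c z = (1 / (n.factorial : ℂ)) *
      toSymbol ((F - algebraMap ℂ (SymbolRing d) (toSymbol F 0 0 0 z)) ^ n) a b c z := by
  rw [FormalSymbol.density, toSymbol_pow, toSymbol_sub, toSymbol_algebraMap]

/-- The subtracted leading value is a scalar with `z` frozen, hence central, and the binomial
theorem applies. It separates the two ways in which `z` enters, through the frozen scalar and
through evaluation of star powers, so smoothness in `z` can be read off. -/
theorem density_toSymbol_eq_sum (F : SymbolRing d) (n a b c : ℕ) (z : Phase d) :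
    (toSymbol F).density n a b c z = (1 / (n.factorial : ℂ)) * ∑ j ∈ Finset.range (n + 1),
      ((-toSymbol F 0 0 0 z) ^ (n - j) * (n.choose j : ℂ)) * toSymbol (F ^ j) a b c z := by
  have hc : Commute F (algebraMap ℂ (SymbolRing d) (-toSymbol F 0 0 0 z)) :=
    (Algebra.commutes _ F).symm
  rw [density_toSymbol, sub_eq_add_neg, ← map_neg, hc.add_pow, toSymbol_sum_apply]
  congr 1
  refine Finset.sum_congr rfl fun j _ => ?_
  rw [← toSymbol_smul_apply, Algebra.smul_def, map_mul, map_pow, map_natCast,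
    (hc.pow_pow j (n - j)).eq, mul_assoc, mul_assoc, Nat.cast_comm]

/-! ## Order of vanishing -/

/-- The ideal of smooth functions vanishing at a point. -/
def vanishingIdeal (z : Phase d) : Ideal (smoothFunctions d) where
  carrier := {f | (f : Phase d → ℂ) z = 0}
  add_mem' {f g} (hf : (f : Phase d → ℂ) z = 0) (hg : (g : Phase d → ℂ) z = 0) := by
    simp [hf, hg]
  zero_mem' := rfl
  smul_mem' c f (hf : (f : Phase d → ℂ) z = 0) := by simp [hf]

theorem derivation_mem_pow {A : Type*} [CommRing A] [Algebra ℂ A] (D : Derivation ℂ A A)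
    (I : Ideal A) (m : ℕ) {f : A} (hf : f ∈ I ^ m) : D f ∈ I ^ (m - 1) := by
  induction m generalizing f with
  | zero => simp
  | succ m ih =>
    rw [pow_succ'] at hf
    simp only [Nat.add_sub_cancel]
    refine Submodule.mul_induction_on hf (fun x hx y hy => ?_) fun x y hx hy => ?_
    · rw [D.leibniz]
      refine add_mem ?_ (Ideal.mul_mem_right _ _ hy)
      rcases m with _ | m
      · simp
      · rw [smul_eq_mul, pow_succ']
        exact Ideal.mul_mem_mul hx (ih hy)
    · rw [map_add]; exact add_mem hx hy

/-- Each application costs one derivative on each factor, and a derivation lowers the order of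
vanishing by at most one. -/
theorem bidiff_mem_pow {A κ : Type*} [CommRing A] [Algebra ℂ A] [Fintype κ]
    (D D' : κ → Derivation ℂ A A) (ε : κ → ℂ) (I : Ideal A) (k p q : ℕ) {f g : A}
    (hf : f ∈ I ^ p) (hg : g ∈ I ^ q) : bidiff D D' ε k f g ∈ I ^ (p + q - 2 * k) := by
  induction k generalizing p q f g with
  | zero => rw [bidiff, Nat.mul_zero, Nat.sub_zero, pow_add]; exact Ideal.mul_mem_mul hf hg
  | succ k ih =>
    refine Ideal.sum_mem _ fun a _ => ?_
    rw [← algebraMap_smul A (ε a)]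
    refine Ideal.mul_mem_left _ _ (Ideal.pow_le_pow_right ?_
      (ih (p - 1) (q - 1) (derivation_mem_pow _ I p hf) (derivation_mem_pow _ I q hg)))
    omega

/-- The symbols whose coefficient of `ħ^a w^b t^c` vanishes at `z` to order `m - (2a + b + c)`. -/
def HasOrder (z : Phase d) (m : ℕ) (F : SymbolRing d) : Prop :=
  ∀ a b c, (PowerSeries.coeff b (PowerSeries.coeff c F)) a ∈
    vanishingIdeal z ^ (m - (2 * a + b + c))

/-- The weight `2` of `ħ` pays for the `k` derivatives on each factor that come with `ħ^k`, so
orders add. -/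
theorem HasOrder.mul {z : Phase d} {m n : ℕ} {F G : SymbolRing d} (hF : HasOrder z m F)
    (hG : HasOrder z n G) : HasOrder z (m + n) (F * G) := by
  intro a b c
  simp only [PowerSeries.coeff_mul, map_sum, Moyal.coe_sum, Moyal.mul_apply]
  refine Ideal.sum_mem _ fun r hr => Ideal.sum_mem _ fun v hv => Ideal.sum_mem _ fun k hk =>
    Ideal.sum_mem _ fun u hu => ?_
  simp only [Finset.HasAntidiagonal.mem_antidiagonal] at hr hv hk hu
  rw [Moyal.term, ← algebraMap_smul (smoothFunctions d)]
  refine Ideal.mul_mem_left _ _ (Ideal.pow_le_pow_right ?_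
    (bidiff_mem_pow _ _ _ _ _ _ _ (hF u.1 v.1 r.1) (hG u.2 v.2 r.2)))
  omega

theorem HasOrder.pow {z : Phase d} {F : SymbolRing d} (hF : HasOrder z 1 F) (n : ℕ) :
    HasOrder z n (F ^ n) := by
  induction n with
  | zero => intro a b c; simp
  | succ n ih => rw [pow_succ]; exact ih.mul hF

theorem toSymbol_pow_apply_eq_zero {z : Phase d} {F : SymbolRing d} (hF : toSymbol F 0 0 0 z = 0)
    {n a b c : ℕ} (hn : 2 * a + b + c < n) : toSymbol (F ^ n) a b c z = 0 := by
  have h1 : HasOrder z 1 F := by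
    intro a b c
    rcases Nat.eq_zero_or_pos (2 * a + b + c) with h | h
    · obtain ⟨rfl, rfl, rfl⟩ : a = 0 ∧ b = 0 ∧ c = 0 := by omega
      rw [Nat.sub_zero, pow_one]
      exact hF
    · rw [Nat.sub_eq_zero_of_le h]; simp
  exact Ideal.pow_le_self (by omega) (h1.pow n a b c)

theorem density_toSymbol_eq_zero (F : SymbolRing d) {n a b c : ℕ} (hn : 2 * a + b + c < n)
    (z : Phase d) : (toSymbol F).density n a b c z = 0 := by
  rw [density_toSymbol, toSymbol_pow_apply_eq_zero _ hn, mul_zero]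
  rw [toSymbol_sub, toSymbol_algebraMap]
  simp [FormalSymbol.monomial]

/-- The expansion of a polynomial of a symbol in derivatives at the leading symbol. -/
theorem toSymbol_aeval (F : SymbolRing d) (Φ : Polynomial ℂ) (a b c : ℕ) (z : Phase d) :
    toSymbol (Polynomial.aeval F Φ) a b c z = ∑ n ∈ Finset.range (2 * a + b + c + 1),
      (Polynomial.derivative^[n] Φ).eval (toSymbol F 0 0 0 z) * (toSymbol F).density n a b c z := by
  set k := toSymbol F 0 0 0 z with hk
  -- Taylor expansion of `Φ` at the frozen leading value; the scalar commutes with `F`, so no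
  -- ordering questions arise.
  have h1 : Polynomial.aeval F Φ = ∑ n ∈ Finset.range (Φ.natDegree + 1),
      (Polynomial.taylor k Φ).coeff n • (F - algebraMap ℂ (SymbolRing d) k) ^ n := by
    conv_lhs => rw [← Polynomial.sum_taylor_eq Φ k]
    rw [Polynomial.sum_over_range _ (by simp), Polynomial.natDegree_taylor, map_sum]
    refine Finset.sum_congr rfl fun n _ => ?_
    simp [Algebra.smul_def]
  have h2 : ∀ n, (Polynomial.derivative^[n] Φ).eval k * (toSymbol F).density n a b c z =
      toSymbol ((Polynomial.taylor k Φ).coeff n • (F - algebraMap ℂ (SymbolRing d) k) ^ n) a b c z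
      := fun n => by
    rw [toSymbol_smul_apply, density_toSymbol, ← hk, Polynomial.taylor_coeff,
      ← Polynomial.factorial_smul_hasseDeriv]
    have h0 : (n.factorial : ℂ) ≠ 0 := by exact_mod_cast Nat.factorial_ne_zero _
    rw [LinearMap.smul_apply, Polynomial.eval_smul, nsmul_eq_mul]
    field_simp
  rw [h1, toSymbol_sum_apply]
  simp only [h2]
  -- The two ranges differ only by zero terms: Taylor coefficients vanish beyond the degree,
  -- densities beyond `2a + b + c`.
  rcases le_total (Φ.natDegree + 1) (2 * a + b + c + 1) with h | h
  · refine Finset.sum_subset (Finset.range_mono h) fun n _ hn => ?_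
    rw [Polynomial.coeff_eq_zero_of_natDegree_lt, toSymbol_smul_apply, zero_mul]
    rw [Polynomial.natDegree_taylor]
    simpa using hn
  · refine (Finset.sum_subset (Finset.range_mono h) fun n _ hn => ?_).symm
    rw [← h2, density_toSymbol_eq_zero F (by simpa using hn), mul_zero]

/-! ## The trace -/

/-- The ideal of compactly supported smooth functions. -/
def compactIdeal (d : ℕ) : Ideal (smoothFunctions d) where
  carrier := {f | HasCompactSupport (f : Phase d → ℂ)}
  add_mem' {f g} (hf : HasCompactSupport (f : Phase d → ℂ))
    (hg : HasCompactSupport (g : Phase d → ℂ)) := hf.add hg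
  zero_mem' := HasCompactSupport.zero
  smul_mem' c f (hf : HasCompactSupport (f : Phase d → ℂ)) :=
    show HasCompactSupport ((c : Phase d → ℂ) * (f : Phase d → ℂ)) from hf.mul_left

theorem dirDeriv_mem_compactIdeal (v : Phase d) {f : smoothFunctions d} (hf : f ∈ compactIdeal d) :
    dirDeriv v f ∈ compactIdeal d :=
  HasCompactSupport.fderiv_apply (𝕜 := ℝ) hf v

theorem integrable_of_mem {f : smoothFunctions d} (hf : f ∈ compactIdeal d) :
    Integrable (f : Phase d → ℂ) :=
  (contDiff_coe f).continuous.integrable_of_hasCompactSupport hf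

/-- The phase space integral. -/
def phaseIntegral (f : smoothFunctions d) : ℂ := ∫ z, (f : Phase d → ℂ) z

theorem phaseIntegral_sum {ι : Type*} (s : Finset ι) {f : ι → smoothFunctions d}
    (hf : ∀ i ∈ s, f i ∈ compactIdeal d) :
    phaseIntegral (∑ i ∈ s, f i) = ∑ i ∈ s, phaseIntegral (f i) := by
  simp only [phaseIntegral, AddSubmonoidClass.coe_finsetSum, Finset.sum_apply]
  exact integral_finsetSum s fun i hi => integrable_of_mem (hf i hi)

theorem phaseIntegral_add {f g : smoothFunctions d} (hf : f ∈ compactIdeal d)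
    (hg : g ∈ compactIdeal d) : phaseIntegral (f + g) = phaseIntegral f + phaseIntegral g :=
  integral_add (integrable_of_mem hf) (integrable_of_mem hg)

theorem phaseIntegral_smul (c : ℂ) (f : smoothFunctions d) :
    phaseIntegral (c • f) = c * phaseIntegral f :=
  integral_const_mul c _

instance : (volume : Measure (Phase d)).IsAddHaarMeasure :=
  Measure.prod.instIsAddHaarMeasure (volume : Measure (Fin d → ℝ)) (volume : Measure (Fin d → ℝ))

theorem phaseIntegral_dirDeriv (v : Phase d) {f : smoothFunctions d} (hf : f ∈ compactIdeal d) :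
    phaseIntegral (dirDeriv v f) = 0 := by
  have h := integral_mul_fderiv_eq_neg_fderiv_mul_of_integrable (μ := volume)
    (f := fun _ : Phase d => (1 : ℂ)) (g := (f : Phase d → ℂ)) (v := v)
    (by simp) (by simp only [one_mul]; exact integrable_of_mem (dirDeriv_mem_compactIdeal v hf))
    (by simpa using integrable_of_mem hf) (fun _ _ => by fun_prop)
    (fun z _ => (contDiff_coe f).differentiable (by simp) z)
  simp only [one_mul, fderiv_fun_const, Pi.zero_apply, zero_apply, zero_mul,
    integral_zero, neg_zero] at h
  exact h

theorem poissonLeft_eq (a : Fin d ⊕ Fin d) : ∃ v : Phase d, poissonLeft a = dirDeriv v := by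
  rcases a with a | a <;> exact ⟨_, rfl⟩

theorem poissonRight_eq (a : Fin d ⊕ Fin d) : ∃ v : Phase d, poissonRight a = dirDeriv v := by
  rcases a with a | a <;> exact ⟨_, rfl⟩

theorem moyalBidiff_mem_left (k : ℕ) {f : smoothFunctions d} (hf : f ∈ compactIdeal d)
    (g : smoothFunctions d) : moyalBidiff k f g ∈ compactIdeal d := by
  induction k generalizing f g with
  | zero => exact Ideal.mul_mem_right _ _ hf
  | succ k ih =>
    refine Ideal.sum_mem _ fun a _ => ?_
    rw [← algebraMap_smul (smoothFunctions d)]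
    obtain ⟨v, hv⟩ := poissonLeft_eq a
    exact Ideal.mul_mem_left _ _ (ih (by rw [hv]; exact dirDeriv_mem_compactIdeal v hf) _)

theorem moyalBidiff_mem_right (k : ℕ) (f : smoothFunctions d) {g : smoothFunctions d}
    (hg : g ∈ compactIdeal d) : moyalBidiff k f g ∈ compactIdeal d := by
  induction k generalizing f g with
  | zero => exact Ideal.mul_mem_left _ _ hg
  | succ k ih =>
    refine Ideal.sum_mem _ fun a _ => ?_
    rw [← algebraMap_smul (smoothFunctions d)]
    obtain ⟨v, hv⟩ := poissonRight_eq a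
    exact Ideal.mul_mem_left _ _ (ih _ (by rw [hv]; exact dirDeriv_mem_compactIdeal v hg))

theorem bidiff_leibniz {A κ : Type*} [CommRing A] [Algebra ℂ A] [Fintype κ]
    (D D' : κ → Derivation ℂ A A) (ε : κ → ℂ) (E : Derivation ℂ A A)
    (h : ∀ a f, E (D a f) = D a (E f)) (h' : ∀ a f, E (D' a f) = D' a (E f)) (k : ℕ) (f g : A) :
    E (bidiff D D' ε k f g) = bidiff D D' ε k (E f) g + bidiff D D' ε k f (E g) := by
  induction k generalizing f g with
  | zero => simp [bidiff, E.leibniz, mul_comm]; rw [add_comm]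
  | succ k ih => simp [bidiff, ih, h, h', Finset.sum_add_distrib]

theorem moyalBidiff_leibniz (v : Phase d) (k : ℕ) (f g : smoothFunctions d) :
    dirDeriv v (moyalBidiff k f g) =
      moyalBidiff k (dirDeriv v f) g + moyalBidiff k f (dirDeriv v g) := by
  apply bidiff_leibniz
  · rintro (a | a) f <;> exact dirDeriv_comm _ _ _
  · rintro (a | a) f <;> exact dirDeriv_comm _ _ _

/-- The operator is antisymmetric with constant coefficients, so the sum of `εₐ Leftₐ Rightₐ g` is
zero. The left derivative may therefore act on the whole product, which exhibits every term beyond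
the pointwise one as a total divergence. -/
theorem moyalBidiff_succ (k : ℕ) (f g : smoothFunctions d) : moyalBidiff (k + 1) f g =
    ∑ a, poissonCoeff a • poissonLeft a (moyalBidiff k f (poissonRight a g)) := by
  have h0 : ∑ a, poissonCoeff a • poissonLeft a (poissonRight a g) = 0 := by
    simp only [Fintype.sum_sum_type, poissonCoeff, poissonLeft, poissonRight, Sum.elim_inl,
      Sum.elim_inr, ← Finset.sum_add_distrib]
    exact Finset.sum_eq_zero fun i _ => by rw [dirDeriv_comm, neg_smul, add_neg_cancel]
  have h1 : ∀ a, poissonCoeff a • poissonLeft a (moyalBidiff k f (poissonRight a g)) =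
      poissonCoeff a • moyalBidiff k (poissonLeft a f) (poissonRight a g) +
        moyalBidiff k f (poissonCoeff a • poissonLeft a (poissonRight a g)) := fun a => by
    obtain ⟨v, hv⟩ := poissonLeft_eq a
    rw [hv, moyalBidiff_leibniz, smul_add]
    simp only [moyalBidiff, bidiff_smul_right]
  simp only [h1, Finset.sum_add_distrib]
  simp only [moyalBidiff] at *
  rw [← bidiff_sum_right, h0, bidiff]
  simpa using bidiff_smul_right poissonLeft poissonRight poissonCoeff k 0 f 0

theorem phaseIntegral_moyalBidiff_succ (k : ℕ) {f g : smoothFunctions d}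
    (h : f ∈ compactIdeal d ∨ g ∈ compactIdeal d) :
    phaseIntegral (moyalBidiff (k + 1) f g) = 0 := by
  have hm : ∀ a, moyalBidiff k f (poissonRight a g) ∈ compactIdeal d := fun a => by
    rcases h with h | h
    · exact moyalBidiff_mem_left k h _
    · obtain ⟨v, hv⟩ := poissonRight_eq a
      rw [hv]
      exact moyalBidiff_mem_right k f (dirDeriv_mem_compactIdeal v h)
  rw [moyalBidiff_succ, phaseIntegral_sum]
  · refine Finset.sum_eq_zero fun a _ => ?_
    obtain ⟨v, hv⟩ := poissonLeft_eq a
    rw [hv, phaseIntegral_smul, phaseIntegral_dirDeriv v (hm a), mul_zero]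
  · intro a _
    obtain ⟨v, hv⟩ := poissonLeft_eq a
    rw [hv, ← algebraMap_smul (smoothFunctions d)]
    exact Ideal.mul_mem_left _ _ (dirDeriv_mem_compactIdeal v (hm a))

theorem term_mem {k : ℕ} {f g : smoothFunctions d}
    (h : f ∈ compactIdeal d ∨ g ∈ compactIdeal d) : Moyal.term k f g ∈ compactIdeal d := by
  rw [Moyal.term, ← algebraMap_smul (smoothFunctions d)]
  refine Ideal.mul_mem_left _ _ ?_
  rcases h with h | h
  · exact moyalBidiff_mem_left k h _
  · exact moyalBidiff_mem_right k _ h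

theorem phaseIntegral_term (k : ℕ) {f g : smoothFunctions d}
    (h : f ∈ compactIdeal d ∨ g ∈ compactIdeal d) :
    phaseIntegral (Moyal.term k f g) = if k = 0 then phaseIntegral (f * g) else 0 := by
  cases k with
  | zero => rw [Moyal.term_zero_eq_mul]; rfl
  | succ k => rw [Moyal.term, phaseIntegral_smul, phaseIntegral_moyalBidiff_succ k h]; simp

/-- The two-sided ideal of series with compactly supported coefficients. -/
def IsCompactSeries (X : MoyalSeries d) : Prop :=
  ∀ b a, (PowerSeries.coeff b X) a ∈ compactIdeal d

theorem coeff_mul_apply (X Y : MoyalSeries d) (b a : ℕ) : (PowerSeries.coeff b (X * Y)) a =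
    ∑ v ∈ Finset.HasAntidiagonal.antidiagonal b, ∑ m ∈ Finset.HasAntidiagonal.antidiagonal a,
      ∑ u ∈ Finset.HasAntidiagonal.antidiagonal m.2, Moyal.term m.1
        ((PowerSeries.coeff v.1 X) u.1) ((PowerSeries.coeff v.2 Y) u.2) := by
  simp only [PowerSeries.coeff_mul, Moyal.coe_sum, Moyal.mul_apply]

namespace IsCompactSeries

variable {X Y : MoyalSeries d}

theorem zero : IsCompactSeries (0 : MoyalSeries d) := fun b a => by
  rw [map_zero]; exact zero_mem _

theorem add (hX : IsCompactSeries X) (hY : IsCompactSeries Y) : IsCompactSeries (X + Y) :=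
  fun b a => by rw [map_add]; exact add_mem (hX b a) (hY b a)

theorem smul (c : ℂ) (hX : IsCompactSeries X) : IsCompactSeries (c • X) := fun b a => by
  have : (PowerSeries.coeff b (c • X)) a = c • (PowerSeries.coeff b X) a := by simp
  rw [this, ← algebraMap_smul (smoothFunctions d)]
  exact Ideal.mul_mem_left _ _ (hX b a)

theorem mul_right (hX : IsCompactSeries X) (Y : MoyalSeries d) : IsCompactSeries (X * Y) :=
  fun b a => by
    rw [coeff_mul_apply]
    exact Ideal.sum_mem _ fun v _ => Ideal.sum_mem _ fun m _ => Ideal.sum_mem _ fun u _ =>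
      term_mem (Or.inl (hX _ _))

theorem mul_left (X : MoyalSeries d) (hY : IsCompactSeries Y) : IsCompactSeries (X * Y) :=
  fun b a => by
    rw [coeff_mul_apply]
    exact Ideal.sum_mem _ fun v _ => Ideal.sum_mem _ fun m _ => Ideal.sum_mem _ fun u _ =>
      term_mem (Or.inr (hY _ _))

theorem ofSmooth {f : smoothFunctions d} (hf : f ∈ compactIdeal d) :
    IsCompactSeries (ofSmooth f) := fun b a => by
  rcases b with _ | b
  · rcases a with _ | a
    · simpa [QuantizedVolume.ofSmooth, Moyal.of] using hf
    · simp [QuantizedVolume.ofSmooth, Moyal.of]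
  · simp [QuantizedVolume.ofSmooth]

end IsCompactSeries

/-- The coefficient of `ħ^a w^b` in the phase space trace. -/
def seriesTrace (b a : ℕ) (X : MoyalSeries d) : ℂ := phaseIntegral ((PowerSeries.coeff b X) a)

theorem seriesTrace_add {b a : ℕ} {X Y : MoyalSeries d} (hX : IsCompactSeries X)
    (hY : IsCompactSeries Y) :
    seriesTrace b a (X + Y) = seriesTrace b a X + seriesTrace b a Y := by
  rw [seriesTrace, map_add]
  exact phaseIntegral_add (hX b a) (hY b a)

theorem seriesTrace_smul (b a : ℕ) (c : ℂ) (X : MoyalSeries d) :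
    seriesTrace b a (c • X) = c * seriesTrace b a X := by
  have : (PowerSeries.coeff b (c • X)) a = c • (PowerSeries.coeff b X) a := by simp
  rw [seriesTrace, this, phaseIntegral_smul, seriesTrace]

/-- Under the integral only the term `m = (0, a)` survives, so the trace sees pointwise products;
cyclicity follows from their commutativity. -/
theorem seriesTrace_mul (b a : ℕ) {X Y : MoyalSeries d}
    (h : IsCompactSeries X ∨ IsCompactSeries Y) : seriesTrace b a (X * Y) =
    ∑ v ∈ Finset.HasAntidiagonal.antidiagonal b, ∑ u ∈ Finset.HasAntidiagonal.antidiagonal a,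
      phaseIntegral ((PowerSeries.coeff v.1 X) u.1 * (PowerSeries.coeff v.2 Y) u.2) := by
  have hc : ∀ v u w x, (PowerSeries.coeff v X) u ∈ compactIdeal d ∨
      (PowerSeries.coeff w Y) x ∈ compactIdeal d := fun v u w x =>
    h.imp (fun h => h v u) (fun h => h w x)
  rw [seriesTrace, coeff_mul_apply, phaseIntegral_sum]
  · refine Finset.sum_congr rfl fun v _ => ?_
    rw [phaseIntegral_sum]
    · rw [Finset.sum_eq_single (0, a)]
      · rw [phaseIntegral_sum]
        · exact Finset.sum_congr rfl fun u _ => by simpa using phaseIntegral_term 0 (hc _ _ _ _)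
        · exact fun u _ => term_mem (hc _ _ _ _)
      · rintro ⟨x, y⟩ hxy hne
        rw [phaseIntegral_sum _ fun u _ => term_mem (hc _ _ _ _)]
        refine Finset.sum_eq_zero fun u _ => ?_
        rw [phaseIntegral_term _ (hc _ _ _ _), if_neg]
        rintro rfl
        simp_all
      · simp
    · exact fun m _ => Ideal.sum_mem _ fun u _ => term_mem (hc _ _ _ _)
  · exact fun v _ => Ideal.sum_mem _ fun m _ => Ideal.sum_mem _ fun u _ => term_mem (hc _ _ _ _)

theorem seriesTrace_mul_comm (b a : ℕ) {X Y : MoyalSeries d}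
    (h : IsCompactSeries X ∨ IsCompactSeries Y) :
    seriesTrace b a (X * Y) = seriesTrace b a (Y * X) := by
  rw [seriesTrace_mul b a h, seriesTrace_mul b a h.symm]
  rw [← Finset.Nat.sum_antidiagonal_swap]
  refine Finset.sum_congr rfl fun v _ => ?_
  rw [← Finset.Nat.sum_antidiagonal_swap]
  exact Finset.sum_congr rfl fun u _ => by rw [mul_comm]; rfl

theorem seriesTrace_ofSmooth_mul (b a : ℕ) {f : smoothFunctions d} (hf : f ∈ compactIdeal d)
    (Y : MoyalSeries d) :
    seriesTrace b a (ofSmooth f * Y) = phaseIntegral (f * (PowerSeries.coeff b Y) a) := by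
  rw [seriesTrace_mul b a (Or.inl (IsCompactSeries.ofSmooth hf)), Finset.sum_eq_single (0, b),
    Finset.sum_eq_single (0, a)]
  · simp [ofSmooth, Moyal.of]
  · rintro ⟨x, y⟩ hxy hne
    rcases x with _ | x
    · simp_all
    · simp [ofSmooth, Moyal.of, phaseIntegral]
  · simp
  · rintro ⟨x, y⟩ hxy hne
    rcases x with _ | x
    · simp_all
    · simp [ofSmooth, phaseIntegral]
  · simp

/-! ## First variation of polynomials -/

section Variation

variable (H δ : MoyalSeries d)

/-- `H + t δ`. -/
def deformed : SymbolRing d := PowerSeries.C H + PowerSeries.X * PowerSeries.C δ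

theorem coeff_zero_deformed : PowerSeries.coeff 0 (deformed H δ) = H := by
  simp [deformed]

theorem coeff_one_deformed : PowerSeries.coeff 1 (deformed H δ) = δ := by
  have h := PowerSeries.coeff_succ_X_mul 0 (PowerSeries.C δ)
  rw [zero_add] at h
  rw [deformed, map_add, h]
  simp

theorem coeff_zero_deformed_pow (m : ℕ) : PowerSeries.coeff 0 (deformed H δ ^ m) = H ^ m := by
  rw [PowerSeries.coeff_zero_eq_constantCoeff_apply, map_pow,
    ← PowerSeries.coeff_zero_eq_constantCoeff_apply, coeff_zero_deformed]

theorem coeff_one_deformed_pow_succ (m : ℕ) : PowerSeries.coeff 1 (deformed H δ ^ (m + 1)) =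
    H * PowerSeries.coeff 1 (deformed H δ ^ m) + δ * H ^ m := by
  rw [pow_succ', PowerSeries.coeff_mul, Finset.Nat.antidiagonal_succ]
  simp [coeff_one_deformed, coeff_zero_deformed, coeff_zero_deformed_pow]

variable {δ}

theorem isCompactSeries_coeff_one_deformed_pow (hδ : IsCompactSeries δ) (m : ℕ) :
    IsCompactSeries (PowerSeries.coeff 1 (deformed H δ ^ m)) := by
  induction m with
  | zero => simpa [PowerSeries.coeff_one] using IsCompactSeries.zero
  | succ m ih =>
    rw [coeff_one_deformed_pow_succ]
    exact (IsCompactSeries.mul_left _ ih).add (hδ.mul_right _)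

/-- The `t`-derivative of a power is a sum of words `H ⋯ δ ⋯ H`, all equal under the trace by
cyclicity. The factor `H ^ l` in front is there for the induction. For `m = 0` both sides are zero,
so the truncated exponent does no harm. -/
theorem seriesTrace_coeff_one_deformed_pow (hδ : IsCompactSeries δ) (b a m l : ℕ) :
    seriesTrace b a (H ^ l * PowerSeries.coeff 1 (deformed H δ ^ m)) =
      m * seriesTrace b a (δ * H ^ (m + l - 1)) := by
  induction m generalizing l with
  | zero => simp [PowerSeries.coeff_one, seriesTrace, phaseIntegral]
  | succ m ih =>
    rw [coeff_one_deformed_pow_succ, mul_add, ← mul_assoc, ← pow_succ, seriesTrace_add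
      (IsCompactSeries.mul_left _ (isCompactSeries_coeff_one_deformed_pow H hδ m))
      (IsCompactSeries.mul_left _ (hδ.mul_right _)), ih, seriesTrace_mul_comm b a
      (Or.inr (hδ.mul_right _)), mul_assoc, ← pow_add]
    have h1 : m + (l + 1) - 1 = m + l := by omega
    have h2 : m + 1 + l - 1 = m + l := by omega
    rw [h1, h2]
    push_cast
    ring

/-- Cyclicity carries `ω` round to the front, where a function of order zero in `ħ` multiplies
pointwise under the trace. -/
theorem seriesTrace_gauge {ω ω' : smoothFunctions d} (hω : ω ∈ compactIdeal d)
    (hω' : ω' ∈ compactIdeal d) (b a m : ℕ) :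
    seriesTrace b a ((ofSmooth ω' * H + H * ofSmooth ω) * H ^ m) =
      phaseIntegral ((ω' + ω) * (PowerSeries.coeff b (H ^ (m + 1))) a) := by
  have hc := IsCompactSeries.ofSmooth hω
  have hc' := IsCompactSeries.ofSmooth hω'
  rw [add_mul, seriesTrace_add ((hc'.mul_right _).mul_right _)
    ((IsCompactSeries.mul_left _ hc).mul_right _), mul_assoc, ← pow_succ', mul_assoc,
    seriesTrace_mul_comm b a (Or.inr (hc.mul_right _)), mul_assoc, ← pow_succ,
    seriesTrace_ofSmooth_mul b a hω', seriesTrace_ofSmooth_mul b a hω, add_mul,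
    phaseIntegral_add (Ideal.mul_mem_right _ _ hω') (Ideal.mul_mem_right _ _ hω)]

theorem isCompactSeries_coeff_one_aeval (hδ : IsCompactSeries δ) (Φ : Polynomial ℂ) :
    IsCompactSeries (PowerSeries.coeff 1 (Polynomial.aeval (deformed H δ) Φ)) := by
  induction Φ using Polynomial.induction_on' with
  | add p q hp hq => rw [map_add, map_add]; exact hp.add hq
  | monomial n c =>
    rw [Polynomial.aeval_monomial, ← Algebra.smul_def]
    exact (isCompactSeries_coeff_one_deformed_pow H hδ n).smul c

/-- On monomials the variation gives `n Tr((ω' + ω) Hⁿ)`, and `n uⁿ = u (uⁿ)'`: a gauge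
transformation acts on `Φ` as the Euler operator `u d/du`. The factor `u` later makes the variation
vanish on `h = 0`. -/
theorem seriesTrace_coeff_one_aeval {ω ω' : smoothFunctions d} (hω : ω ∈ compactIdeal d)
    (hω' : ω' ∈ compactIdeal d) (b a : ℕ) (Φ : Polynomial ℂ) :
    seriesTrace b a (PowerSeries.coeff 1
      (Polynomial.aeval (deformed H (ofSmooth ω' * H + H * ofSmooth ω)) Φ)) =
    phaseIntegral ((ω' + ω) *
      (PowerSeries.coeff b (Polynomial.aeval H (Polynomial.X * Polynomial.derivative Φ))) a) := by
  have hδ : IsCompactSeries (ofSmooth ω' * H + H * ofSmooth ω) :=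
    ((IsCompactSeries.ofSmooth hω').mul_right _).add
      (IsCompactSeries.mul_left _ (IsCompactSeries.ofSmooth hω))
  induction Φ using Polynomial.induction_on' with
  | add p q hp hq =>
    rw [map_add, map_add, seriesTrace_add (isCompactSeries_coeff_one_aeval H hδ p)
      (isCompactSeries_coeff_one_aeval H hδ q), hp, hq, map_add, mul_add, map_add, map_add,
      Moyal.add_apply, mul_add, phaseIntegral_add]
    all_goals exact Ideal.mul_mem_right _ _ (add_mem hω' hω)
  | monomial n c =>
    have h1 := seriesTrace_coeff_one_deformed_pow H hδ b a n 0
    rw [pow_zero, one_mul] at h1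
    have h2 : PowerSeries.coeff 1 (c • deformed H (ofSmooth ω' * H + H * ofSmooth ω) ^ n) =
      c • PowerSeries.coeff 1 (deformed H (ofSmooth ω' * H + H * ofSmooth ω) ^ n) := by simp
    rw [Polynomial.aeval_monomial, ← Algebra.smul_def, h2, seriesTrace_smul, h1]
    rcases n with _ | n
    · simp [phaseIntegral]
    · have h3 : Polynomial.X * Polynomial.derivative (Polynomial.monomial (n + 1) c) =
          Polynomial.monomial (n + 1) (c * (n + 1)) := by
        rw [Polynomial.derivative_monomial, Polynomial.X_mul_monomial]; simp
      have h4 : (PowerSeries.coeff b (Polynomial.aeval H (Polynomial.monomial (n + 1)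
          (c * (n + 1))))) a = (c * (n + 1)) • (PowerSeries.coeff b (H ^ (n + 1))) a := by
        rw [Polynomial.aeval_monomial, ← Algebra.smul_def]; simp
      rw [h3, h4, mul_smul_comm, phaseIntegral_smul, ← seriesTrace_gauge H hω hω']
      simp only [Nat.add_zero, Nat.add_sub_cancel]
      push_cast
      ring

end Variation

/-! ## Locality of the star product -/

theorem dX_congr {f f' : Phase d → ℂ} {z : Phase d} (h : f =ᶠ[𝓝 z] f') (i : Fin d) :
    dX i f =ᶠ[𝓝 z] dX i f' :=
  (h.fderiv (𝕜 := ℝ)).mono fun y hy => by simp only [dX, hy]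

theorem dP_congr {f f' : Phase d → ℂ} {z : Phase d} (h : f =ᶠ[𝓝 z] f') (i : Fin d) :
    dP i f =ᶠ[𝓝 z] dP i f' :=
  (h.fderiv (𝕜 := ℝ)).mono fun y hy => by simp only [dP, hy]

theorem eventuallyEq_sum {ι : Type*} {s : Finset ι} {F G : ι → Phase d → ℂ} {z : Phase d}
    (h : ∀ i ∈ s, F i =ᶠ[𝓝 z] G i) : (∑ i ∈ s, F i) =ᶠ[𝓝 z] ∑ i ∈ s, G i := by
  filter_upwards [(Filter.eventually_all_finset s).2 h] with y hy
  simp only [Finset.sum_apply]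
  exact Finset.sum_congr rfl hy

theorem nablaPow_congr (k : ℕ) {f f' g g' : Phase d → ℂ} {z : Phase d} (hf : f =ᶠ[𝓝 z] f')
    (hg : g =ᶠ[𝓝 z] g') : nablaPow k f g =ᶠ[𝓝 z] nablaPow k f' g' := by
  induction k generalizing f f' g g' with
  | zero => exact hf.mul hg
  | succ k ih =>
    exact eventuallyEq_sum fun i _ =>
      (ih (dX_congr hf i) (dP_congr hg i)).sub (ih (dP_congr hf i) (dX_congr hg i))

/-- Two formal symbols have equal germs at a point. -/
def GermEq (z : Phase d) (F F' : FormalSymbol d) : Prop := ∀ a b c, F a b c =ᶠ[𝓝 z] F' a b c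

namespace GermEq

variable {z : Phase d} {F F' G G' : FormalSymbol d}

theorem refl (F : FormalSymbol d) : GermEq z F F := fun _ _ _ => EventuallyEq.rfl

theorem add (hF : GermEq z F F') (hG : GermEq z G G') : GermEq z (F + G) (F' + G') :=
  fun a b c => (hF a b c).add (hG a b c)

theorem sub (hF : GermEq z F F') (hG : GermEq z G G') : GermEq z (F - G) (F' - G') :=
  fun a b c => (hF a b c).sub (hG a b c)

theorem star (hF : GermEq z F F') (hG : GermEq z G G') :
    GermEq z (FormalSymbol.star F G) (FormalSymbol.star F' G') := fun _ _ _ =>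
  eventuallyEq_sum fun _ _ => eventuallyEq_sum fun _ _ => eventuallyEq_sum fun _ _ =>
    eventuallyEq_sum fun _ _ => (nablaPow_congr _ (hF _ _ _) (hG _ _ _)).const_smul _

theorem starPow (hF : GermEq z F F') (n : ℕ) :
    GermEq z (FormalSymbol.starPow F n) (FormalSymbol.starPow F' n) := by
  induction n with
  | zero => exact refl _
  | succ n ih => exact hF.star ih

/-- At each order the star product is bidifferential, so only germs matter. This permits replacing
`ω` by a cut-off copy near the constraint surface. -/
theorem density_eq (hF : GermEq z F F') (n a b c : ℕ) :
    F.density n a b c z = F'.density n a b c z := by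
  simp only [FormalSymbol.density]
  rw [(hF 0 0 0).eq_of_nhds, ((hF.sub (refl _)).starPow n a b c).eq_of_nhds]

theorem monomial {f f' : Phase d → ℂ} (h : f =ᶠ[𝓝 z] f') (a b c : ℕ) :
    GermEq z (FormalSymbol.monomial a b c f) (FormalSymbol.monomial a b c f') := by
  intro a' b' c'
  simp only [FormalSymbol.monomial]
  split_ifs
  · exact h
  · exact EventuallyEq.rfl

end GermEq

/-- `h + w Δ + t (ω† * (h + w Δ) + (h + w Δ) * ω)`. -/
def gaugeSymbol (h Δ : Phase d → ℝ) (ω : Phase d → ℂ) : FormalSymbol d :=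
  (symbolOf h Δ).addInfinitesimal (FormalSymbol.gaugeVariation ω (symbolOf h Δ))

theorem gaugeSymbol_germEq (h Δ : Phase d → ℝ) {ω ω' : Phase d → ℂ} {z : Phase d}
    (hω : ω =ᶠ[𝓝 z] ω') : GermEq z (gaugeSymbol h Δ ω) (gaugeSymbol h Δ ω') := by
  have hv : GermEq z (FormalSymbol.gaugeVariation ω (symbolOf h Δ))
      (FormalSymbol.gaugeVariation ω' (symbolOf h Δ)) :=
    ((GermEq.monomial (hω.fun_comp _) 0 0 0).star (GermEq.refl _)).add
      ((GermEq.refl _).star (GermEq.monomial hω 0 0 0))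
  intro a b c
  refine EventuallyEq.add EventuallyEq.rfl ?_
  rcases c with _ | c
  · exact EventuallyEq.rfl
  · exact hv a b c

/-! ## The symbols of the theorem in the ring of formal symbols -/

/-- `h + w Δ`. -/
def perturbedSeries (h Δ : smoothFunctions d) : MoyalSeries d :=
  ofSmooth h + PowerSeries.X * ofSmooth Δ

/-- A real smooth function as a complex smooth function. -/
def ofRealSmooth (h : Phase d → ℝ) (hh : ContDiff ℝ (⊤ : ℕ∞) h) : smoothFunctions d :=
  ⟨fun z => (h z : ℂ), Complex.ofRealCLM.contDiff.comp hh⟩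

theorem toSymbol_C_X_mul (f : smoothFunctions d) :
    toSymbol (PowerSeries.C (PowerSeries.X * ofSmooth f)) =
      FormalSymbol.monomial 0 1 0 (f : Phase d → ℂ) := by
  funext a b c
  rcases c with _ | c
  · rcases b with _ | _ | b
    · simp [toSymbol, ofSmooth, FormalSymbol.monomial]
    · rcases a with _ | a
      · simp [toSymbol, FormalSymbol.monomial, ofSmooth, Moyal.of]
      · simp [toSymbol, FormalSymbol.monomial, ofSmooth, Moyal.of]
    · have h := PowerSeries.coeff_succ_X_mul (b + 1) (ofSmooth f)
      simp only [toSymbol, FormalSymbol.monomial, PowerSeries.coeff_zero_C, h]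
      simp [ofSmooth]
  · simp [toSymbol, FormalSymbol.monomial]

theorem symbolOf_eq {h Δ : Phase d → ℝ} (hh : ContDiff ℝ (⊤ : ℕ∞) h)
    (hΔ : ContDiff ℝ (⊤ : ℕ∞) Δ) : symbolOf h Δ =
      toSymbol (PowerSeries.C (perturbedSeries (ofRealSmooth h hh) (ofRealSmooth Δ hΔ))) := by
  rw [perturbedSeries, map_add, toSymbol_add, toSymbol_C_ofSmooth, toSymbol_C_X_mul]
  rfl

theorem toSymbol_deformed (H δ : MoyalSeries d) : toSymbol (deformed H δ) =
    (toSymbol (PowerSeries.C H)).addInfinitesimal (toSymbol (PowerSeries.C δ)) := by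
  funext a b c
  rw [deformed, toSymbol_add]
  rcases c with _ | c
  · simp [FormalSymbol.addInfinitesimal, toSymbol]
  · have h := PowerSeries.coeff_succ_X_mul c (PowerSeries.C δ)
    simp only [FormalSymbol.addInfinitesimal, Pi.add_apply, toSymbol, h]

/-- The complex conjugate of a smooth function. -/
def conjSmooth (f : smoothFunctions d) : smoothFunctions d :=
  ⟨fun z => (starRingEnd ℂ) ((f : Phase d → ℂ) z),
    Complex.conjCLE.contDiff.comp (contDiff_coe f)⟩

theorem gaugeSymbol_eq {h Δ : Phase d → ℝ} (hh : ContDiff ℝ (⊤ : ℕ∞) h)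
    (hΔ : ContDiff ℝ (⊤ : ℕ∞) Δ) (ω : smoothFunctions d) :
    gaugeSymbol h Δ (ω : Phase d → ℂ) =
      toSymbol (deformed (perturbedSeries (ofRealSmooth h hh) (ofRealSmooth Δ hΔ))
        (ofSmooth (conjSmooth ω) * perturbedSeries (ofRealSmooth h hh) (ofRealSmooth Δ hΔ) +
          perturbedSeries (ofRealSmooth h hh) (ofRealSmooth Δ hΔ) * ofSmooth ω)) := by
  rw [toSymbol_deformed, map_add, toSymbol_add, map_mul, map_mul, toSymbol_mul, toSymbol_mul,
    toSymbol_C_ofSmooth, toSymbol_C_ofSmooth, ← symbolOf_eq hh hΔ]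
  rfl

/-! ### Densities of the varied symbol and the polynomial identity -/

section Densities

variable {h Δ : Phase d → ℝ}

theorem contDiff_density_toSymbol (F : SymbolRing d) (n a b c : ℕ) :
    ContDiff ℝ (⊤ : ℕ∞) ((toSymbol F).density n a b c) := by
  have : (toSymbol F).density n a b c = fun z => (1 / (n.factorial : ℂ)) *
    ∑ j ∈ Finset.range (n + 1), ((-toSymbol F 0 0 0 z) ^ (n - j) * (n.choose j : ℂ)) *
      toSymbol (F ^ j) a b c z := funext fun z => density_toSymbol_eq_sum F n a b c z
  rw [this]
  refine contDiff_const.mul (ContDiff.sum fun j _ => ?_)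
  exact ((((contDiff_toSymbol F 0 0 0).neg).pow _).mul contDiff_const).mul (contDiff_toSymbol _ _ _ _)

theorem contDiff_density_symbolOf (hh : ContDiff ℝ (⊤ : ℕ∞) h) (hΔ : ContDiff ℝ (⊤ : ℕ∞) Δ)
    (n a b c : ℕ) :
    ContDiff ℝ (⊤ : ℕ∞) ((symbolOf h Δ).density n a b c) := by
  rw [symbolOf_eq hh hΔ]; exact contDiff_density_toSymbol _ _ _ _ _

theorem contDiff_density_gaugeSymbol (hh : ContDiff ℝ (⊤ : ℕ∞) h) (hΔ : ContDiff ℝ (⊤ : ℕ∞) Δ)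
    {ω : Phase d → ℂ} (hω : ContDiff ℝ (⊤ : ℕ∞) ω)
    (n a b c : ℕ) : ContDiff ℝ (⊤ : ℕ∞) ((gaugeSymbol h Δ ω).density n a b c) := by
  rw [gaugeSymbol_eq hh hΔ ⟨ω, hω⟩]; exact contDiff_density_toSymbol _ _ _ _ _

theorem density_gaugeSymbol_zero (hh : ContDiff ℝ (⊤ : ℕ∞) h) (hΔ : ContDiff ℝ (⊤ : ℕ∞) Δ)
    (n a b : ℕ) (z : Phase d) :
    (gaugeSymbol h Δ 0).density n a b 1 z = 0 := by
  have h0 : conjSmooth (0 : smoothFunctions d) = 0 := by ext z; simp [conjSmooth]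
  have h1 : ofSmooth (0 : smoothFunctions d) = 0 := by
    have : Moyal.of (0 : smoothFunctions d) = 0 := by ext a : 1; simp [Moyal.of]
    rw [ofSmooth, this, map_zero]
  have e := gaugeSymbol_eq hh hΔ 0
  rw [h0, h1, zero_mul, mul_zero, add_zero] at e
  change gaugeSymbol h Δ 0 = _ at e
  rw [e, density_toSymbol_eq_sum]
  refine mul_eq_zero_of_right _ (Finset.sum_eq_zero fun j _ => mul_eq_zero_of_right _ ?_)
  simp [deformed, ← map_pow, toSymbol]

/-- By locality the density may be computed there with `ω = 0`, when the symbol and its star powers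
are free of `t`. So the `t`-linear densities inherit the support of `ω`. -/
theorem density_gaugeSymbol_eq_zero (hh : ContDiff ℝ (⊤ : ℕ∞) h) (hΔ : ContDiff ℝ (⊤ : ℕ∞) Δ)
    {ω : Phase d → ℂ} {z : Phase d} (hz : z ∉ tsupport ω)
    (n a b : ℕ) : (gaugeSymbol h Δ ω).density n a b 1 z = 0 := by
  rw [(gaugeSymbol_germEq h Δ (notMem_tsupport_iff_eventuallyEq.1 hz)).density_eq]
  exact density_gaugeSymbol_zero hh hΔ n a b z

/-- The zeroth star power is `1`, free of `t`. The only term not localised on the surface therefore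
drops out of the variation. -/
theorem density_gaugeSymbol_order_zero (h Δ : Phase d → ℝ) (ω : Phase d → ℂ) (a b : ℕ) :
    (gaugeSymbol h Δ ω).density 0 a b 1 = 0 := by
  funext z
  simp [FormalSymbol.density, FormalSymbol.starPow, FormalSymbol.monomial]

/-- Gauge invariance of the trace of polynomials. -/
theorem integral_polynomial_variation (hh : ContDiff ℝ (⊤ : ℕ∞) h) (hΔ : ContDiff ℝ (⊤ : ℕ∞) Δ)
    {ω : Phase d → ℂ} (hω : ContDiff ℝ (⊤ : ℕ∞) ω)
    (hc : HasCompactSupport ω) (Φ : Polynomial ℂ) (a b : ℕ) :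
    ∫ z, ∑ n ∈ Finset.range (2 * a + b + 1 + 1), (Polynomial.derivative^[n] Φ).eval (h z : ℂ) *
        (gaugeSymbol h Δ ω).density n a b 1 z =
    ∫ z, ((starRingEnd ℂ) (ω z) + ω z) * ∑ n ∈ Finset.range (2 * a + b + 1),
      (Polynomial.derivative^[n] (Polynomial.X * Polynomial.derivative Φ)).eval (h z : ℂ) *
        (symbolOf h Δ).density n a b 0 z := by
  set H := perturbedSeries (ofRealSmooth h hh) (ofRealSmooth Δ hΔ) with hH
  have hmem : (⟨ω, hω⟩ : smoothFunctions d) ∈ compactIdeal d := hc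
  have hmem' : conjSmooth ⟨ω, hω⟩ ∈ compactIdeal d :=
    hc.comp_left (g := starRingEnd ℂ) (map_zero _)
  have key := seriesTrace_coeff_one_aeval H hmem hmem' b a Φ
  have e0 : ∀ z, symbolOf h Δ 0 0 0 z = h z := fun z => by
    simp [symbolOf, FormalSymbol.monomial]
  have e1 : ∀ z, gaugeSymbol h Δ ω 0 0 0 z = h z := fun z => by
    simp [gaugeSymbol, FormalSymbol.addInfinitesimal, e0]
  have hL : ∀ z, ∑ n ∈ Finset.range (2 * a + b + 1 + 1),
      (Polynomial.derivative^[n] Φ).eval (h z : ℂ) * (gaugeSymbol h Δ ω).density n a b 1 z =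
      toSymbol (Polynomial.aeval (deformed H (ofSmooth (conjSmooth ⟨ω, hω⟩) * H +
        H * ofSmooth ⟨ω, hω⟩)) Φ) a b 1 z := fun z => by
    rw [toSymbol_aeval, ← gaugeSymbol_eq hh hΔ ⟨ω, hω⟩, e1]
  have hR : ∀ z, ∑ n ∈ Finset.range (2 * a + b + 1),
      (Polynomial.derivative^[n] (Polynomial.X * Polynomial.derivative Φ)).eval (h z : ℂ) *
        (symbolOf h Δ).density n a b 0 z =
      toSymbol (PowerSeries.C (Polynomial.aeval H (Polynomial.X * Polynomial.derivative Φ)))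
        a b 0 z := fun z => by
    have := toSymbol_aeval (PowerSeries.C H) (Polynomial.X * Polynomial.derivative Φ) a b 0 z
    rw [← symbolOf_eq hh hΔ, e0] at this
    rw [← this]
    congr 1
    have hC : ∀ Ψ : Polynomial ℂ, Polynomial.aeval (PowerSeries.C H) Ψ =
        PowerSeries.C (Polynomial.aeval H Ψ) := fun Ψ => by
      induction Ψ using Polynomial.induction_on' with
      | add p q hp hq => simp only [map_add, hp, hq]
      | monomial n c =>
        rw [Polynomial.aeval_monomial, Polynomial.aeval_monomial, ← Algebra.smul_def,
          ← Algebra.smul_def, ← map_pow]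
        ext m : 1
        rcases m with _ | m <;> simp [-map_pow, PowerSeries.coeff_C]
    rw [hC]
  simp only [hL, hR]
  have hC0 : ∀ z, toSymbol (PowerSeries.C (Polynomial.aeval H (Polynomial.X *
      Polynomial.derivative Φ))) a b 0 z = ((PowerSeries.coeff b (Polynomial.aeval H
        (Polynomial.X * Polynomial.derivative Φ))) a : smoothFunctions d).1 z := fun z => by
    simp [toSymbol]
  simp only [hC0]
  exact key

end Densities

/-! ## Polynomial approximation of smooth functions together with derivatives -/

theorem exists_polynomial_derivative_eq (p : Polynomial ℝ) :
    ∃ P : Polynomial ℝ, Polynomial.derivative P = p := by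
  induction p using Polynomial.induction_on' with
  | add p q hp hq =>
    obtain ⟨P, rfl⟩ := hp
    obtain ⟨Q, rfl⟩ := hq
    exact ⟨P + Q, by simp⟩
  | monomial n c =>
    refine ⟨Polynomial.monomial (n + 1) (c / (n + 1)), ?_⟩
    rw [Polynomial.derivative_monomial]
    have : (n : ℝ) + 1 ≠ 0 := by positivity
    simp [this]

/-- Weierstrass approximation of the highest derivative, followed by repeated integration with the
constant fixed at `0`. -/
theorem exists_polynomial_near (N : ℕ) {M : ℝ} (hM : 0 ≤ M) {Φ : ℝ → ℝ}
    (hΦ : ContDiff ℝ (⊤ : ℕ∞) Φ) {δ : ℝ} (hδ : 0 < δ) : ∃ p : Polynomial ℝ, ∀ n ≤ N,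
      ∀ u ∈ Set.Icc (-M) M, |iteratedDeriv n Φ u - (Polynomial.derivative^[n] p).eval u| ≤ δ := by
  induction N generalizing Φ δ with
  | zero =>
    obtain ⟨p, hp⟩ := exists_polynomial_near_of_continuousOn (-M) M Φ hΦ.continuous.continuousOn δ hδ
    refine ⟨p, fun n hn u hu => ?_⟩
    obtain rfl : n = 0 := by omega
    simpa [abs_sub_comm] using (hp u hu).le
  | succ N ih =>
    have hd : ContDiff ℝ (⊤ : ℕ∞) (deriv Φ) := (contDiff_infty_iff_deriv.1 hΦ).2
    -- Integrating from `0` over `[-M, M]` multiplies the error by at most `M`.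
    have hδ' : 0 < δ / (M + 1) := by positivity
    obtain ⟨p, hp⟩ := ih hd hδ'
    obtain ⟨P, rfl⟩ := exists_polynomial_derivative_eq p
    refine ⟨P + Polynomial.C (Φ 0 - P.eval 0), fun n hn u hu => ?_⟩
    rcases n with _ | n
    · have h0 : (0 : ℝ) ∈ Set.Icc (-M) M := ⟨by linarith, hM⟩
      have := Convex.norm_image_sub_le_of_norm_deriv_le (𝕜 := ℝ)
        (f := fun u => Φ u - P.eval u) (C := δ / (M + 1)) (s := Set.Icc (-M) M) (x := 0) (y := u)
        (fun x _ => (hΦ.differentiable (by simp) x).sub P.differentiableAt)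
        (fun x hx => by
          rw [deriv_fun_sub (hΦ.differentiable (by simp) x) P.differentiableAt, Polynomial.deriv]
          simpa using hp 0 (by omega) x hx) (convex_Icc _ _) h0 hu
      have hu' : |u| ≤ M := abs_le.2 hu
      simp only [sub_zero, Real.norm_eq_abs] at this
      simp only [iteratedDeriv_zero, Function.iterate_zero, id_eq, Polynomial.eval_add,
        Polynomial.eval_C]
      calc _ = |Φ u - P.eval u - (Φ 0 - P.eval 0)| := by ring_nf
        _ ≤ _ := this
        _ ≤ δ / (M + 1) * (M + 1) := by gcongr; linarith
        _ = δ := by field_simp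
    · rw [iteratedDeriv_succ', Function.iterate_succ_apply, Polynomial.derivative_add,
        Polynomial.derivative_C, add_zero]
      refine (hp n (by omega) u hu).trans ?_
      exact div_le_self hδ.le (by linarith)

/-! ## Smooth approximations of the step function -/

/-- A smooth function vanishing for `u ≤ -s` and equal to one for `1 / (j + 1) ≤ u + s`. -/
def smoothStep (j : ℕ) (s u : ℝ) : ℝ := Real.smoothTransition ((j + 1) * (u + s))

theorem contDiff_smoothStep (j : ℕ) (s : ℝ) : ContDiff ℝ (⊤ : ℕ∞) (smoothStep j s) :=
  Real.smoothTransition.contDiff.comp (by fun_prop)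

theorem abs_smoothStep_le (j : ℕ) (s u : ℝ) : |smoothStep j s u| ≤ 1 := by
  rw [smoothStep, abs_of_nonneg (Real.smoothTransition.nonneg _)]
  exact Real.smoothTransition.le_one _

theorem tendsto_smoothStep (s u : ℝ) : Tendsto (fun j => smoothStep j s u) atTop
    (𝓝 (if 0 < u + s then 1 else 0)) := by
  split_ifs with h
  · refine tendsto_const_nhds.congr' ?_
    obtain ⟨J, hJ⟩ := exists_nat_gt (1 / (u + s))
    filter_upwards [eventually_ge_atTop J] with j hj
    rw [smoothStep, Real.smoothTransition.one_of_one_le]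
    have : (J : ℝ) ≤ j := by exact_mod_cast hj
    rw [div_lt_iff₀ h] at hJ
    nlinarith
  · refine tendsto_const_nhds.congr fun j => ?_
    rw [smoothStep, Real.smoothTransition.zero_of_nonpos]
    exact mul_nonpos_of_nonneg_of_nonpos (by positivity) (not_lt.1 h)

theorem deriv_smoothTransition_eq_zero {u : ℝ} (hu : u ∉ Set.Icc (0 : ℝ) 1) :
    deriv Real.smoothTransition u = 0 := by
  rcases lt_or_ge u 0 with h | h
  · have : Real.smoothTransition =ᶠ[𝓝 u] fun _ => 0 := by
      filter_upwards [gt_mem_nhds h] with x hx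
      exact Real.smoothTransition.zero_of_nonpos hx.le
    rw [this.deriv_eq, deriv_const]
  · have h1 : 1 < u := by
      by_contra h'
      exact hu ⟨h, not_lt.1 h'⟩
    have : Real.smoothTransition =ᶠ[𝓝 u] fun _ => 1 := by
      filter_upwards [lt_mem_nhds h1] with x hx
      exact Real.smoothTransition.one_of_one_le hx.le
    rw [this.deriv_eq, deriv_const]

theorem exists_deriv_smoothTransition_bound :
    ∃ C : ℝ, 0 ≤ C ∧ ∀ u, |deriv Real.smoothTransition u| ≤ C := by
  have hc : Continuous (deriv Real.smoothTransition) :=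
    Real.smoothTransition.contDiff.continuous_deriv (n := 1) le_rfl
  obtain ⟨C, hC⟩ := isCompact_Icc.exists_bound_of_continuousOn (s := Set.Icc (0 : ℝ) 1)
    hc.continuousOn
  refine ⟨|C|, abs_nonneg _, fun u => ?_⟩
  by_cases hu : u ∈ Set.Icc (0 : ℝ) 1
  · exact (hC u hu).trans (le_abs_self C)
  · rw [deriv_smoothTransition_eq_zero hu]; simp

theorem hasDerivAt_smoothStep (j : ℕ) (s u : ℝ) : HasDerivAt (smoothStep j s)
    ((j + 1) * deriv Real.smoothTransition ((j + 1) * (u + s))) u := by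
  have h1 : HasDerivAt Real.smoothTransition
      (deriv Real.smoothTransition ((j + 1) * (u + s))) ((j + 1) * (u + s)) :=
    ((Real.smoothTransition.contDiff (n := 1)).differentiable (by simp) _).hasDerivAt
  have h2 : HasDerivAt (fun u => ((j : ℝ) + 1) * (u + s)) ((j + 1) * 1) u :=
    ((hasDerivAt_id u).add_const s).const_mul _
  have := h1.comp u h2
  rw [mul_one, mul_comm] at this
  exact this

theorem deriv_smoothStep (j : ℕ) (s u : ℝ) : deriv (smoothStep j s) u =
    (j + 1) * deriv Real.smoothTransition ((j + 1) * (u + s)) := (hasDerivAt_smoothStep j s u).deriv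

theorem hasDerivAt_smoothStep_shift (j : ℕ) (s u : ℝ) : HasDerivAt (fun s => smoothStep j s u)
    (deriv (smoothStep j s) u) s := by
  have h := hasDerivAt_smoothStep j u s
  have e : (fun s => smoothStep j s u) = smoothStep j u := by
    funext s; simp only [smoothStep, add_comm]
  rw [e, deriv_smoothStep, add_comm u s]
  exact h

theorem deriv_smoothStep_eq_zero {j : ℕ} {s u : ℝ} (h : 1 / ((j : ℝ) + 1) < |u + s|) :
    deriv (smoothStep j s) u = 0 := by
  rw [deriv_smoothStep, deriv_smoothTransition_eq_zero, mul_zero]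
  rintro ⟨h0, h1⟩
  have hj : (0 : ℝ) < j + 1 := by positivity
  have h2 : 0 ≤ u + s := nonneg_of_mul_nonneg_right h0 hj
  rw [abs_of_nonneg h2, div_lt_iff₀ hj] at h
  linarith

/-- The derivative has size of order `j + 1` but lives on `|u + s| ≤ 1/(j + 1)`. With the pointwise
limit `0` this is the dominated form of `(u + s) δ(u + s) = 0`. -/
theorem exists_mul_deriv_smoothStep_bound :
    ∃ C : ℝ, ∀ (j : ℕ) (s u : ℝ), |deriv (smoothStep j s) u * (u + s)| ≤ C := by
  obtain ⟨C, hC0, hC⟩ := exists_deriv_smoothTransition_bound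
  refine ⟨C, fun j s u => ?_⟩
  by_cases h : 1 / ((j : ℝ) + 1) < |u + s|
  · rw [deriv_smoothStep_eq_zero h]; simpa using hC0
  · rw [deriv_smoothStep, abs_mul, abs_mul]
    have hj : (0 : ℝ) < j + 1 := by positivity
    rw [not_lt, le_div_iff₀ hj] at h
    rw [abs_of_pos hj]
    calc _ = |deriv Real.smoothTransition ((j + 1) * (u + s))| * (|u + s| * (j + 1)) := by ring
      _ ≤ C * 1 := by gcongr; exact hC _
      _ = C := mul_one C

theorem tendsto_mul_deriv_smoothStep (s u : ℝ) :
    Tendsto (fun j => deriv (smoothStep j s) u * (u + s)) atTop (𝓝 0) := by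
  refine tendsto_const_nhds.congr' ?_
  by_cases h : u + s = 0
  · simp [h]
  · have : Tendsto (fun j : ℕ => 1 / ((j : ℝ) + 1)) atTop (𝓝 0) :=
      tendsto_one_div_add_atTop_nhds_zero_nat
    filter_upwards [this.eventually (gt_mem_nhds (abs_pos.2 h))] with j hj
    rw [deriv_smoothStep_eq_zero hj, zero_mul]

/-- Lets one divide by a squared gradient where it is bounded below while staying smooth where it
vanishes. -/
theorem exists_smooth_inv {c : ℝ} (hc : 0 < c) :
    ∃ β : ℝ → ℝ, ContDiff ℝ (⊤ : ℕ∞) β ∧ ∀ t, c ≤ t → β t * t = 1 := by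
  -- The transition is `0` up to `t = c / 2`, hence near the pole of `1 / t`, and `1` from `t = c`
  -- on.
  refine ⟨fun t => Real.smoothTransition (2 * t / c - 1) / t, ?_, fun t ht => ?_⟩
  · rw [contDiff_iff_contDiffAt]
    intro t
    by_cases ht : t = 0
    · have : (fun t => Real.smoothTransition (2 * t / c - 1) / t) =ᶠ[𝓝 t] fun _ => 0 := by
        have h : t < c / 2 := by rw [ht]; positivity
        filter_upwards [gt_mem_nhds h] with x hx
        rw [Real.smoothTransition.zero_of_nonpos, zero_div]
        rw [sub_nonpos, div_le_one hc]
        linarith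
      exact contDiffAt_const.congr_of_eventuallyEq this
    · refine ContDiffAt.div ?_ contDiffAt_id ht
      exact (Real.smoothTransition.contDiff.comp (by fun_prop)).contDiffAt
  · have ht0 : t ≠ 0 := (hc.trans_le ht).ne'
    beta_reduce
    rw [Real.smoothTransition.one_of_one_le, div_mul_cancel₀ _ ht0]
    rw [le_sub_iff_add_le, le_div_iff₀ hc]
    linarith

/-! ## Smooth functions supported in a compact set -/

section Generic

variable {E : Type*} [NormedAddCommGroup E] [NormedSpace ℝ E]

/-- Smooth functions supported in `K`. -/
structure IsTestOn (K : Set E) (f : E → ℂ) : Prop where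
  contDiff : ContDiff ℝ (⊤ : ℕ∞) f
  support : tsupport f ⊆ K

namespace IsTestOn

variable {K : Set E} {f g : E → ℂ}

theorem hasCompactSupport (hf : IsTestOn K f) (hK : IsCompact K) : HasCompactSupport f :=
  hK.of_isClosed_subset (isClosed_tsupport f) hf.support

theorem eq_zero (hf : IsTestOn K f) {z : E} (hz : z ∉ K) : f z = 0 :=
  image_eq_zero_of_notMem_tsupport fun h => hz (hf.support h)

theorem mul_left (hf : IsTestOn K f) (hg : ContDiff ℝ (⊤ : ℕ∞) g) :
    IsTestOn K (fun z => g z * f z) :=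
  ⟨hg.mul hf.contDiff, (tsupport_mul_subset_right (f := g)).trans hf.support⟩

theorem neg (hf : IsTestOn K f) : IsTestOn K (fun z => -f z) := by
  simpa using hf.mul_left (g := fun _ => (-1 : ℂ)) contDiff_const

theorem add (hf : IsTestOn K f) (hg : IsTestOn K g) : IsTestOn K (fun z => f z + g z) :=
  ⟨hf.contDiff.add hg.contDiff,
    (tsupport_add f g).trans (Set.union_subset hf.support hg.support)⟩

theorem zero (K : Set E) : IsTestOn K (fun _ => 0) :=
  ⟨contDiff_const, by simp [tsupport]⟩

theorem sum {ι : Type*} (s : Finset ι) {f : ι → E → ℂ} (hf : ∀ i ∈ s, IsTestOn K (f i)) :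
    IsTestOn K (fun z => ∑ i ∈ s, f i z) := by
  classical
  induction s using Finset.induction_on with
  | empty => simpa using zero K
  | insert i s hi ih =>
    simp only [Finset.sum_insert hi]
    exact (hf i (by simp)).add (ih fun j hj => hf j (by simp [hj]))

theorem fderiv_apply (hf : IsTestOn K f) (v : E) : IsTestOn K (fun z => fderiv ℝ f z v) :=
  ⟨contDiff_fderiv_apply hf.contDiff v, (tsupport_fderiv_apply_subset ℝ v).trans hf.support⟩

theorem iterate {T : (E → ℂ) → (E → ℂ)} (hT : ∀ f, IsTestOn K f → IsTestOn K (T f))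
    (n : ℕ) {f : E → ℂ} (hf : IsTestOn K f) : IsTestOn K (T^[n] f) := by
  induction n generalizing f with
  | zero => exact hf
  | succ n ih => exact ih (hT f hf)

theorem integrable [MeasurableSpace E] [BorelSpace E] (μ : Measure E)
    [IsFiniteMeasureOnCompacts μ] (hf : IsTestOn K f) (hK : IsCompact K) : Integrable f μ :=
  hf.contDiff.continuous.integrable_of_hasCompactSupport (hf.hasCompactSupport hK)

end IsTestOn

variable [FiniteDimensional ℝ E] [MeasurableSpace E] [BorelSpace E] (μ : Measure E)
  [μ.IsAddHaarMeasure]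

/-- Integration by parts against a function of compact support. -/
theorem integral_mul_fderiv_eq_neg {K : Set E} (hK : IsCompact K) {f g : E → ℂ}
    (hf : ContDiff ℝ 1 f) (hg : IsTestOn K g) (v : E) :
    ∫ z, f z * fderiv ℝ g z v ∂μ = -∫ z, fderiv ℝ f z v * g z ∂μ := by
  have hc := hg.hasCompactSupport hK
  have hf' : Continuous (fun z => fderiv ℝ f z v) :=
    (hf.continuous_fderiv one_ne_zero).clm_apply continuous_const
  have hg' := (hg.fderiv_apply v)
  refine integral_mul_fderiv_eq_neg_fderiv_mul_of_integrable ?_ ?_ ?_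
    (fun z _ => hf.differentiable one_ne_zero z)
    (fun z _ => hg.contDiff.differentiable (by simp) z)
  · exact (hf'.mul hg.contDiff.continuous).integrable_of_hasCompactSupport hc.mul_left
  · exact (hf.continuous.mul hg'.contDiff.continuous).integrable_of_hasCompactSupport
      (hg'.hasCompactSupport hK).mul_left
  · exact (hf.continuous.mul hg.contDiff.continuous).integrable_of_hasCompactSupport hc.mul_left

/-- Functions that are constant on each side of `|u + s₀| ≤ ε`. -/
structure IsStepLike (s₀ ε : ℝ) (Φ : ℝ → ℝ) : Prop where
  contDiff : ContDiff ℝ (⊤ : ℕ∞) Φ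
  deriv_eq_zero : ∀ u, ε < |u + s₀| → deriv Φ u = 0

theorem IsStepLike.deriv {s₀ ε : ℝ} {Φ : ℝ → ℝ} (h : IsStepLike s₀ ε Φ) :
    IsStepLike s₀ ε (deriv Φ) := by
  refine ⟨(contDiff_infty_iff_deriv.1 h.contDiff).2, fun u hu => ?_⟩
  have ho : IsOpen {u : ℝ | ε < |u + s₀|} := isOpen_lt continuous_const (by fun_prop)
  have : _root_.deriv Φ =ᶠ[𝓝 u] fun _ => 0 := by
    filter_upwards [ho.mem_nhds hu] with x hx
    exact h.deriv_eq_zero x hx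
  rw [this.deriv_eq, deriv_const]

/-- Near a regular level set in a compact set `K`, a derivative of a function of `h` can be moved
to the test function. -/
theorem exists_transport {h : E → ℝ} (hh : ContDiff ℝ (⊤ : ℕ∞) h) {K : Set E} (hK : IsCompact K)
    {s₀ : ℝ} (hreg : ∀ z ∈ K, h z + s₀ = 0 → fderiv ℝ h z ≠ 0) :
    ∃ ε > 0, ∃ T : (E → ℂ) → (E → ℂ), (∀ f, IsTestOn K f → IsTestOn K (T f)) ∧
      ∀ f, IsTestOn K f → ∀ Φ, IsStepLike s₀ ε Φ →
        ∫ z, ((deriv Φ (h z) : ℝ) : ℂ) * f z ∂μ = ∫ z, (Φ (h z) : ℂ) * T f z ∂μ := by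
  classical
  let b := Module.finBasis ℝ E
  let q : E → ℝ := fun z => ∑ i, (fderiv ℝ h z (b i)) ^ 2
  have hq : ContDiff ℝ (⊤ : ℕ∞) q :=
    ContDiff.sum fun i _ => (contDiff_fderiv_apply hh (b i)).pow 2
  have hq0 : ∀ z, 0 ≤ q z := fun z => Finset.sum_nonneg fun i _ => sq_nonneg _
  -- On `K` either the level or the gradient is nonzero, and compactness makes this uniform:
  -- wherever `|h + s₀| ≤ c / 2`, the squared gradient `q` is at least `c / 2`.
  obtain ⟨c, hc, hcK⟩ : ∃ c, 0 < c ∧ ∀ z ∈ K, c ≤ |h z + s₀| + q z := by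
    refine hK.exists_forall_le' (f := fun z => |h z + s₀| + q z) (a := 0)
      (((hh.continuous.add continuous_const).abs.add hq.continuous).continuousOn) fun z hz => ?_
    by_cases h0 : h z + s₀ = 0
    · rw [h0, abs_zero, zero_add]
      refine (hq0 z).lt_of_ne fun hqz => hreg z hz h0 ?_
      refine ContinuousLinearMap.coe_injective (b.ext fun i => ?_)
      have := (Finset.sum_eq_zero_iff_of_nonneg fun i _ => sq_nonneg _).1 hqz.symm i
        (Finset.mem_univ i)
      simpa using this
    · have := abs_pos.2 h0
      have := hq0 z
      positivity
  obtain ⟨β, hβ, hβ1⟩ := exists_smooth_inv (half_pos hc)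
  -- The normalised gradient field, with `X·∇h = β(q) q = 1` at points of `K` near the level. The
  -- operator `T` is `f ↦ -div (X f)`.
  let X : _ → E → ℂ := fun i z => ((β (q z) * fderiv ℝ h z (b i) : ℝ) : ℂ)
  have hX : ∀ i, ContDiff ℝ (⊤ : ℕ∞) (X i) := fun i =>
    Complex.ofRealCLM.contDiff.comp ((hβ.comp hq).mul (contDiff_fderiv_apply hh (b i)))
  have ht : ∀ f, IsTestOn K f → ∀ i, IsTestOn K (fun z => X i z * f z) :=
    fun f hf i => hf.mul_left (hX i)
  refine ⟨c / 2, half_pos hc,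
    fun f z => -∑ i, fderiv ℝ (fun z => X i z * f z) z (b i), fun f hf => ?_, fun f hf Φ hΦ => ?_⟩
  · exact (IsTestOn.sum _ fun i _ => (ht f hf i).fderiv_apply (b i)).neg
  · have hΦh : ContDiff ℝ (⊤ : ℕ∞) (fun z => (Φ (h z) : ℂ)) :=
      Complex.ofRealCLM.contDiff.comp (hΦ.contDiff.comp hh)
    have hΦd : ∀ z v, fderiv ℝ (fun z => (Φ (h z) : ℂ)) z v =
        ((deriv Φ (h z) : ℝ) : ℂ) * (fderiv ℝ h z v : ℂ) := fun z v => by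
      have h1 : HasFDerivAt h (fderiv ℝ h z) z := (hh.differentiable (by simp) z).hasFDerivAt
      have h2 : HasDerivAt Φ (deriv Φ (h z)) (h z) :=
        (hΦ.contDiff.differentiable (by simp) _).hasDerivAt
      have h3 := Complex.ofRealCLM.hasFDerivAt.comp z (h2.comp_hasFDerivAt z h1)
      have h4 : fderiv ℝ (fun z => (Φ (h z) : ℂ)) z = _ := h3.fderiv
      rw [h4]; simp
    have e1 : ∀ z, (Φ (h z) : ℂ) * -∑ i, fderiv ℝ (fun z => X i z * f z) z (b i) =
        -∑ i, (Φ (h z) : ℂ) * fderiv ℝ (fun z => X i z * f z) z (b i) := fun z => by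
      rw [mul_neg, Finset.mul_sum]
    have e2 : ∀ z, ((deriv Φ (h z) : ℝ) : ℂ) * f z = ∑ i, fderiv ℝ (fun z => (Φ (h z) : ℂ)) z (b i) *
        (X i z * f z) := fun z => by
      have e3 : ∑ i, fderiv ℝ (fun z => (Φ (h z) : ℂ)) z (b i) * (X i z * f z) =
          ((deriv Φ (h z) : ℝ) : ℂ) * ((β (q z) * q z : ℝ) : ℂ) * f z := by
        simp only [hΦd, X, q, Complex.ofReal_mul, Complex.ofReal_sum, Complex.ofReal_pow,
          Finset.mul_sum, Finset.sum_mul]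
        exact Finset.sum_congr rfl fun i _ => by ring
      rw [e3]
      -- Off `K` the test function vanishes; on `K` either `Φ'(h)` vanishes or `β(q) q = 1`.
      by_cases hz : z ∈ K
      · by_cases hu : c / 2 < |h z + s₀|
        · rw [hΦ.deriv_eq_zero _ hu]; simp
        · rw [hβ1 _ (by linarith [hcK z hz]), Complex.ofReal_one, mul_one]
      · rw [hf.eq_zero hz]; simp
    have i1 : ∀ i, Integrable (fun z => (Φ (h z) : ℂ) *
        fderiv ℝ (fun z => X i z * f z) z (b i)) μ := fun i =>
      ((((ht f hf i).fderiv_apply (b i)).mul_left hΦh).integrable μ hK)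
    have i2 : ∀ i, Integrable (fun z => fderiv ℝ (fun z => (Φ (h z) : ℂ)) z (b i) *
        (X i z * f z)) μ := fun i =>
      ((ht f hf i).mul_left (contDiff_fderiv_apply hΦh (b i))).integrable μ hK
    simp only [e1, e2]
    rw [integral_neg, integral_finsetSum _ fun i _ => i1 i, integral_finsetSum _ fun i _ => i2 i,
      ← Finset.sum_neg_distrib]
    refine Finset.sum_congr rfl fun i _ => ?_
    rw [integral_mul_fderiv_eq_neg μ hK (hΦh.of_le (by simp)) (ht f hf i), neg_neg]

end Generic

section Generic

variable {E : Type*} [MeasurableSpace E] (μ : Measure E)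

/-! ## Integrals over superlevel sets -/

/-- `∫ θ(h + s) f`. -/
def superlevelIntegral (h : E → ℝ) (f : E → ℂ) (s : ℝ) : ℂ := ∫ z in {z | 0 < h z + s}, f z ∂μ

variable {h : E → ℝ} {K : Set E} {s₀ ε : ℝ}

theorem norm_superlevelIntegral_le (f : E → ℂ) (hf : Integrable f μ) (s : ℝ) :
    ‖superlevelIntegral μ h f s‖ ≤ ∫ z, ‖f z‖ ∂μ :=
  (norm_integral_le_integral_norm _).trans
    (setIntegral_le_integral hf.norm (Eventually.of_forall fun _ => norm_nonneg _))

variable [NormedAddCommGroup E]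

section Measurable

variable [BorelSpace E]

theorem tendsto_integral_smoothStep (hh : Continuous h) {f : E → ℂ} (hf : Integrable f μ) (s : ℝ) :
    Tendsto (fun j => ∫ z, (smoothStep j s (h z) : ℂ) * f z ∂μ) atTop
      (𝓝 (superlevelIntegral μ h f s)) := by
  have hm : MeasurableSet {z | 0 < h z + s} :=
    (isOpen_lt continuous_const (hh.add continuous_const)).measurableSet
  rw [superlevelIntegral, ← integral_indicator hm]
  refine tendsto_integral_of_dominated_convergence (fun z => ‖f z‖) (fun j => ?_) hf.norm
    (fun j => Eventually.of_forall fun z => ?_) (Eventually.of_forall fun z => ?_)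
  · refine AEStronglyMeasurable.mul ?_ hf.1
    exact (Complex.continuous_ofReal.comp
      ((contDiff_smoothStep j s).continuous.comp hh)).aestronglyMeasurable
  · rw [norm_mul, Complex.norm_real, Real.norm_eq_abs]
    exact mul_le_of_le_one_left (norm_nonneg _) (abs_smoothStep_le _ _ _)
  · have := (Complex.continuous_ofReal.tendsto _).comp (tendsto_smoothStep s (h z))
    have := this.mul_const (f z)
    have e : Set.indicator {z | 0 < h z + s} f z =
        ((if 0 < h z + s then 1 else 0 : ℝ) : ℂ) * f z := by
      by_cases h0 : 0 < h z + s <;> simp [h0]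
    rw [e]
    exact this

theorem hasDerivAt_integral_smoothStep (hh : Continuous h) {f : E → ℂ} (hf : Integrable f μ)
    (j : ℕ) (s : ℝ) : HasDerivAt (fun s => ∫ z, (smoothStep j s (h z) : ℂ) * f z ∂μ)
      (∫ z, ((deriv (smoothStep j s) (h z) : ℝ) : ℂ) * f z ∂μ) s := by
  obtain ⟨C, hC0, hC⟩ := exists_deriv_smoothTransition_bound
  have hm : ∀ s, AEStronglyMeasurable (fun z => (smoothStep j s (h z) : ℂ) * f z) μ := fun s => by
    refine AEStronglyMeasurable.mul ?_ hf.1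
    exact (Complex.continuous_ofReal.comp
      ((contDiff_smoothStep j s).continuous.comp hh)).aestronglyMeasurable
  have hm' : AEStronglyMeasurable
      (fun z => ((deriv (smoothStep j s) (h z) : ℝ) : ℂ) * f z) μ := by
    refine AEStronglyMeasurable.mul ?_ hf.1
    exact (Complex.continuous_ofReal.comp (((contDiff_smoothStep j s).continuous_deriv
      (by simp)).comp hh)).aestronglyMeasurable
  refine (hasDerivAt_integral_of_dominated_loc_of_deriv_le (s := Set.univ)
    (F' := fun s z => ((deriv (smoothStep j s) (h z) : ℝ) : ℂ) * f z)
    (bound := fun z => (j + 1) * C * ‖f z‖) univ_mem (Eventually.of_forall hm) ?_ hm' ?_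
    (hf.norm.const_mul _) ?_).2
  · refine hf.norm.mono' (hm s) (Eventually.of_forall fun z => ?_)
    rw [norm_mul, Complex.norm_real, Real.norm_eq_abs]
    exact mul_le_of_le_one_left (norm_nonneg _) (abs_smoothStep_le _ _ _)
  · refine Eventually.of_forall fun z s _ => ?_
    rw [norm_mul, Complex.norm_real, Real.norm_eq_abs, deriv_smoothStep, abs_mul,
      abs_of_pos (by positivity : (0 : ℝ) < j + 1)]
    gcongr
    exact hC _
  · refine Eventually.of_forall fun z s _ => ?_
    exact (hasDerivAt_smoothStep_shift j s (h z)).ofReal_comp.mul_const (f z)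

end Measurable

variable [NormedSpace ℝ E]

/-- `T` moves derivatives of functions of `h` near the level `-s₀` to the test function. -/
structure IsTransport (h : E → ℝ) (K : Set E) (s₀ ε : ℝ) (T : (E → ℂ) → (E → ℂ)) : Prop where
  test : ∀ f, IsTestOn K f → IsTestOn K (T f)
  integral : ∀ f, IsTestOn K f → ∀ Φ, IsStepLike s₀ ε Φ →
    ∫ z, ((deriv Φ (h z) : ℝ) : ℂ) * f z ∂μ = ∫ z, (Φ (h z) : ℂ) * T f z ∂μ

theorem integral_iteratedDeriv_eq {μ : Measure E} {T : (E → ℂ) → (E → ℂ)}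
    (hT : IsTransport μ h K s₀ ε T) {f : E → ℂ} (hf : IsTestOn K f)
    (n : ℕ) {Φ : ℝ → ℝ} (hΦ : IsStepLike s₀ ε Φ) :
    ∫ z, ((iteratedDeriv n Φ (h z) : ℝ) : ℂ) * f z ∂μ = ∫ z, (Φ (h z) : ℂ) * T^[n] f z ∂μ := by
  induction n generalizing Φ with
  | zero => simp
  | succ n ih =>
    rw [iteratedDeriv_succ', ih hΦ.deriv, hT.integral _ (hf.iterate hT.test n) _ hΦ,
      Function.iterate_succ_apply']

variable [BorelSpace E]

theorem isStepLike_smoothStep {j : ℕ} {s : ℝ} (hj : 1 / ((j : ℝ) + 1) + |s - s₀| ≤ ε) :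
    IsStepLike s₀ ε (smoothStep j s) := by
  refine ⟨contDiff_smoothStep j s, fun u hu => deriv_smoothStep_eq_zero ?_⟩
  have : |u + s₀| ≤ |u + s| + |s - s₀| := by
    have := abs_sub (u + s) (s - s₀)
    calc |u + s₀| = |u + s - (s - s₀)| := by ring_nf
      _ ≤ _ := this
  linarith

theorem eventually_isStepLike {ρ : ℝ} (hρ : ρ < ε) : ∀ᶠ j : ℕ in atTop, ∀ s, |s - s₀| ≤ ρ →
    IsStepLike s₀ ε (smoothStep j s) := by
  have ht : Tendsto (fun j : ℕ => 1 / ((j : ℝ) + 1)) atTop (𝓝 0) :=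
    tendsto_one_div_add_atTop_nhds_zero_nat
  filter_upwards [ht.eventually (gt_mem_nhds (sub_pos.2 hρ))] with j hj s hs
  exact isStepLike_smoothStep (by linarith)

variable {μ} {T : (E → ℂ) → (E → ℂ)}

variable [IsFiniteMeasureOnCompacts μ]

/-- The fundamental theorem of calculus for superlevel integrals. -/
theorem superlevelIntegral_sub (hT : IsTransport μ h K s₀ ε T) (hh : Continuous h)
    (hK : IsCompact K) {f : E → ℂ} (hf : IsTestOn K f) {a b ρ : ℝ} (hρ : ρ < ε)
    (hab : Set.uIcc a b ⊆ Metric.closedBall s₀ ρ) :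
    IntervalIntegrable (superlevelIntegral μ h (T f)) volume a b ∧
    superlevelIntegral μ h f b - superlevelIntegral μ h f a =
      ∫ s in a..b, superlevelIntegral μ h (T f) s := by
  have hfi := hf.integrable μ hK
  have hTi := (hT.test f hf).integrable μ hK
  have hc : ∀ j, Continuous fun s => ∫ z, (smoothStep j s (h z) : ℂ) * T f z ∂μ := fun j =>
    continuous_iff_continuousAt.2 fun s =>
      (hasDerivAt_integral_smoothStep μ hh hTi j s).continuousAt
  have hlim := fun s => tendsto_integral_smoothStep μ hh hTi s
  have hmeas : AEStronglyMeasurable (superlevelIntegral μ h (T f)) volume :=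
    aestronglyMeasurable_of_tendsto_ae atTop (fun j => (hc j).aestronglyMeasurable)
      (Eventually.of_forall hlim)
  have hbound : ∀ j s, ‖∫ z, (smoothStep j s (h z) : ℂ) * T f z ∂μ‖ ≤ ∫ z, ‖T f z‖ ∂μ :=
    fun j s => by
      refine norm_integral_le_of_norm_le hTi.norm (Eventually.of_forall fun z => ?_)
      rw [norm_mul, Complex.norm_real, Real.norm_eq_abs]
      exact mul_le_of_le_one_left (norm_nonneg _) (abs_smoothStep_le _ _ _)
  refine ⟨?_, ?_⟩
  · rw [intervalIntegrable_iff]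
    refine Measure.integrableOn_of_bounded (M := ∫ z, ‖T f z‖ ∂μ) (by simp [Set.uIoc]) hmeas ?_
    exact Eventually.of_forall fun s => norm_superlevelIntegral_le μ _ hTi s
  -- The identity is proved for smoothed steps, whose derivatives in `s` and in `u` coincide so that
  -- `T` applies, and then passed to the limit.
  · have h1 : Tendsto (fun j => ∫ s in a..b, ∫ z, (smoothStep j s (h z) : ℂ) * T f z ∂μ) atTop
        (𝓝 (∫ s in a..b, superlevelIntegral μ h (T f) s)) := by
      refine intervalIntegral.tendsto_integral_filter_of_dominated_convergence
        (fun _ => ∫ z, ‖T f z‖ ∂μ) (Eventually.of_forall fun j => (hc j).aestronglyMeasurable)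
        (Eventually.of_forall fun j => Eventually.of_forall fun s _ => hbound j s)
        (by simp) (Eventually.of_forall fun s _ => hlim s)
    have h2 := (tendsto_integral_smoothStep μ hh hfi b).sub
      (tendsto_integral_smoothStep μ hh hfi a)
    refine tendsto_nhds_unique (h2.congr' ?_) h1
    filter_upwards [eventually_isStepLike hρ] with j hj
    refine (intervalIntegral.integral_eq_sub_of_hasDerivAt
      (f := fun s => ∫ z, (smoothStep j s (h z) : ℂ) * f z ∂μ) (fun s hs => ?_)
      ((hc j).intervalIntegrable a b)).symm
    have := hT.integral f hf _ (hj s (by simpa [Real.dist_eq] using hab hs))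
    rw [← this]
    exact hasDerivAt_integral_smoothStep μ hh hfi j s

/-- Increments are integrals over `s` of a function bounded by `∫ ‖T f‖`, so the function is locally
Lipschitz. Applied to `T f`, this continuity upgrades the integral formula to a derivative. -/
theorem continuousAt_superlevelIntegral (hT : IsTransport μ h K s₀ ε T) (hh : Continuous h)
    (hK : IsCompact K) {f : E → ℂ} (hf : IsTestOn K f) {s : ℝ} (hs : |s - s₀| < ε) :
    ContinuousAt (superlevelIntegral μ h f) s := by
  obtain ⟨ρ, hρ1, hρ⟩ := exists_between hs
  have hTi := (hT.test f hf).integrable μ hK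
  have hb : Metric.closedBall s₀ ρ ∈ 𝓝 s :=
    Filter.mem_of_superset (Metric.isOpen_ball.mem_nhds (by simpa [Real.dist_eq] using hρ1))
      Metric.ball_subset_closedBall
  have hconv : Convex ℝ (Metric.closedBall s₀ ρ) := convex_closedBall _ _
  refine continuousAt_of_locally_lipschitz (r := (ρ - |s - s₀|)) (by linarith)
    (∫ z, ‖T f z‖ ∂μ) fun y hy => ?_
  have hsb : s ∈ Metric.closedBall s₀ ρ := mem_of_mem_nhds hb
  have hyb : y ∈ Metric.closedBall s₀ ρ := by
    rw [Metric.mem_closedBall, Real.dist_eq]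
    rw [Real.dist_eq] at hy
    have := abs_add_le (y - s) (s - s₀)
    rw [sub_add_sub_cancel] at this
    linarith
  have hsub : Set.uIcc s y ⊆ Metric.closedBall s₀ ρ := by
    rw [← segment_eq_uIcc]; exact hconv.segment_subset hsb hyb
  rw [dist_eq_norm, (superlevelIntegral_sub hT hh hK hf hρ hsub).2, Real.dist_eq]
  exact intervalIntegral.norm_integral_le_of_norm_le_const fun t _ =>
    norm_superlevelIntegral_le μ _ hTi t

theorem hasDerivAt_superlevelIntegral (hT : IsTransport μ h K s₀ ε T) (hh : Continuous h)
    (hK : IsCompact K) {f : E → ℂ} (hf : IsTestOn K f) {s : ℝ} (hs : |s - s₀| < ε) :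
    HasDerivAt (superlevelIntegral μ h f) (superlevelIntegral μ h (T f) s) s := by
  obtain ⟨ρ, hρ1, hρ⟩ := exists_between hs
  have hball : Metric.ball s₀ ρ ∈ 𝓝 s :=
    Metric.isOpen_ball.mem_nhds (by simpa [Real.dist_eq] using hρ1)
  have hcont : ∀ t ∈ Metric.ball s₀ ρ, ContinuousAt (superlevelIntegral μ h (T f)) t :=
    fun t ht => continuousAt_superlevelIntegral hT hh hK (hT.test f hf)
      (lt_trans (by simpa [Real.dist_eq] using ht) hρ)
  have hd := intervalIntegral.integral_hasDerivAt_right (a := s) (b := s)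
    (f := superlevelIntegral μ h (T f)) (by simp)
    (ContinuousOn.stronglyMeasurableAtFilter Metric.isOpen_ball
      (fun t ht => (hcont t ht).continuousWithinAt) s (mem_of_mem_nhds hball))
    (hcont s (mem_of_mem_nhds hball))
  have hd' := hd.const_add (superlevelIntegral μ h f s)
  refine hd'.congr_of_eventuallyEq ?_
  filter_upwards [hball] with y hy
  have hsub : Set.uIcc s y ⊆ Metric.closedBall s₀ ρ := by
    rw [← segment_eq_uIcc]
    exact (convex_closedBall _ _).segment_subset
      (Metric.ball_subset_closedBall (mem_of_mem_nhds hball)) (Metric.ball_subset_closedBall hy)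
  rw [← (superlevelIntegral_sub hT hh hK hf hρ hsub).2]
  ring

theorem contDiffOn_superlevelIntegral (hT : IsTransport μ h K s₀ ε T) (hh : Continuous h)
    (hK : IsCompact K) {f : E → ℂ} (hf : IsTestOn K f) :
    ContDiffOn ℝ (⊤ : ℕ∞) (superlevelIntegral μ h f) (Metric.ball s₀ ε) := by
  rw [contDiffOn_infty]
  intro n
  induction n generalizing f with
  | zero =>
    rw [Nat.cast_zero, contDiffOn_zero]
    exact fun s hs => (continuousAt_superlevelIntegral hT hh hK hf
      (by simpa [Real.dist_eq] using hs)).continuousWithinAt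
  | succ n ih =>
    have hd : ∀ s ∈ Metric.ball s₀ ε, HasDerivAt (superlevelIntegral μ h f)
        (superlevelIntegral μ h (T f) s) s := fun s hs =>
      hasDerivAt_superlevelIntegral hT hh hK hf (by simpa [Real.dist_eq] using hs)
    rw [Nat.cast_succ, contDiffOn_succ_iff_deriv_of_isOpen Metric.isOpen_ball]
    refine ⟨fun s hs => (hd s hs).differentiableAt.differentiableWithinAt, by simp, ?_⟩
    exact (ih (hT.test f hf)).congr fun s hs => (hd s hs).deriv

theorem iteratedDeriv_superlevelIntegral (hT : IsTransport μ h K s₀ ε T) (hh : Continuous h)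
    (hK : IsCompact K) {f : E → ℂ} (hf : IsTestOn K f) (n : ℕ) {s : ℝ} (hs : |s - s₀| < ε) :
    iteratedDeriv n (superlevelIntegral μ h f) s = superlevelIntegral μ h (T^[n] f) s := by
  induction n generalizing s with
  | zero => simp
  | succ n ih =>
    have ho : Metric.ball s₀ ε ∈ 𝓝 s := Metric.isOpen_ball.mem_nhds (by simpa [Real.dist_eq] using hs)
    have he : iteratedDeriv n (superlevelIntegral μ h f) =ᶠ[𝓝 s]
        superlevelIntegral μ h (T^[n] f) := by
      filter_upwards [ho] with t ht
      exact ih (by simpa [Real.dist_eq] using ht)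
    rw [iteratedDeriv_succ, he.deriv_eq, Function.iterate_succ_apply']
    exact (hasDerivAt_superlevelIntegral hT hh hK (hf.iterate hT.test n) hs).deriv

/-- `h` acts on `δ(h + s)` as `-s`. -/
theorem superlevelIntegral_transport_mul (hT : IsTransport μ h K s₀ ε T)
    (hh : ContDiff ℝ (⊤ : ℕ∞) h) (hK : IsCompact K) {f : E → ℂ} (hf : IsTestOn K f) {s : ℝ}
    (hs : |s - s₀| < ε) : superlevelIntegral μ h (T (fun z => (h z : ℂ) * f z)) s =
      -s * superlevelIntegral μ h (T f) s := by
  have hhf : IsTestOn K (fun z => (h z : ℂ) * f z) :=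
    hf.mul_left (Complex.ofRealCLM.contDiff.comp hh)
  have h1 := tendsto_integral_smoothStep μ hh.continuous
    ((hT.test _ hhf).integrable μ hK) s
  have h2 := tendsto_integral_smoothStep μ hh.continuous
    ((hT.test _ hf).integrable μ hK) s
  have h3 := h1.add (h2.const_mul (s : ℂ))
  -- The smoothed form of `(h + s) δ(h + s) = 0`; undoing the transport identifies `h3` with this
  -- integral for large `j`.
  have h4 : Tendsto (fun j : ℕ => ∫ z, ((deriv (smoothStep j s) (h z) * (h z + s) : ℝ) : ℂ) * f z ∂μ)
      atTop (𝓝 (∫ _ : E, (0 : ℂ) ∂μ)) := by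
    obtain ⟨C, hC⟩ := exists_mul_deriv_smoothStep_bound
    refine tendsto_integral_of_dominated_convergence (fun z => C * ‖f z‖) (fun j => ?_)
      ((hf.integrable μ hK).norm.const_mul C) (fun j => Eventually.of_forall fun z => ?_)
      (Eventually.of_forall fun z => ?_)
    · refine AEStronglyMeasurable.mul ?_ (hf.integrable μ hK).1
      exact (Complex.continuous_ofReal.comp ((((contDiff_smoothStep j s).continuous_deriv
        (by simp)).comp hh.continuous).mul (hh.continuous.add continuous_const))).aestronglyMeasurable
    · rw [norm_mul, Complex.norm_real, Real.norm_eq_abs]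
      gcongr
      exact hC _ _ _
    · have := ((Complex.continuous_ofReal.tendsto _).comp
        (tendsto_mul_deriv_smoothStep s (h z))).mul_const (f z)
      simpa using this
  rw [integral_zero] at h4
  have h5 := tendsto_nhds_unique (h3.congr' ?_) h4
  · rw [neg_mul]; exact eq_neg_of_add_eq_zero_left h5
  · filter_upwards [eventually_isStepLike hs] with j hj
    have hj := hj s le_rfl
    rw [← hT.integral _ hhf _ hj, ← hT.integral _ hf _ hj, ← integral_const_mul, ← integral_add]
    · refine integral_congr_ae (Eventually.of_forall fun z => ?_)
      push_cast
      ring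
    · have hd : ContDiff ℝ (⊤ : ℕ∞) (fun z => ((deriv (smoothStep j s) (h z) : ℝ) : ℂ)) :=
        Complex.ofRealCLM.contDiff.comp (hj.deriv.contDiff.comp hh)
      exact (hhf.mul_left hd).integrable μ hK
    · have hd : ContDiff ℝ (⊤ : ℕ∞) (fun z => ((deriv (smoothStep j s) (h z) : ℝ) : ℂ)) :=
        Complex.ofRealCLM.contDiff.comp (hj.deriv.contDiff.comp hh)
      exact ((hf.mul_left hd).integrable μ hK).const_mul _

/-- For `n = 0` this is `u δ(u + s) = -s δ(u + s)`. Each further derivative in `s` falls once on the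
factor `-s`, which produces the second term. -/
theorem iteratedDeriv_superlevelIntegral_mul (hT : IsTransport μ h K s₀ ε T)
    (hh : ContDiff ℝ (⊤ : ℕ∞) h) (hK : IsCompact K) {f : E → ℂ} (hf : IsTestOn K f) (n : ℕ) {s : ℝ}
    (hs : |s - s₀| < ε) :
    iteratedDeriv (n + 1) (superlevelIntegral μ h (fun z => (h z : ℂ) * f z)) s =
      -s * iteratedDeriv (n + 1) (superlevelIntegral μ h f) s -
        n * iteratedDeriv n (superlevelIntegral μ h f) s := by
  have hhf : IsTestOn K (fun z => (h z : ℂ) * f z) :=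
    hf.mul_left (Complex.ofRealCLM.contDiff.comp hh)
  induction n generalizing s with
  | zero =>
    rw [iteratedDeriv_superlevelIntegral hT hh.continuous hK hhf _ hs,
      iteratedDeriv_superlevelIntegral hT hh.continuous hK hf _ hs]
    simpa using superlevelIntegral_transport_mul hT hh hK hf hs
  | succ n ih =>
    have ho : Metric.ball s₀ ε ∈ 𝓝 s := Metric.isOpen_ball.mem_nhds (by simpa [Real.dist_eq] using hs)
    have he : iteratedDeriv (n + 1) (superlevelIntegral μ h (fun z => (h z : ℂ) * f z)) =ᶠ[𝓝 s]
        fun s => -s * iteratedDeriv (n + 1) (superlevelIntegral μ h f) s -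
          n * iteratedDeriv n (superlevelIntegral μ h f) s := by
      filter_upwards [ho] with t ht
      exact ih (by simpa [Real.dist_eq] using ht)
    have hd : ∀ m, HasDerivAt (iteratedDeriv m (superlevelIntegral μ h f))
        (iteratedDeriv (m + 1) (superlevelIntegral μ h f) s) s := fun m => by
      have h1 : iteratedDeriv m (superlevelIntegral μ h f) =ᶠ[𝓝 s]
          superlevelIntegral μ h (T^[m] f) := by
        filter_upwards [ho] with t ht
        exact iteratedDeriv_superlevelIntegral hT hh.continuous hK hf m
          (by simpa [Real.dist_eq] using ht)
      rw [iteratedDeriv_superlevelIntegral hT hh.continuous hK hf _ hs,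
        Function.iterate_succ_apply']
      exact (hasDerivAt_superlevelIntegral hT hh.continuous hK
        (hf.iterate hT.test m) hs).congr_of_eventuallyEq h1
    rw [iteratedDeriv_succ, he.deriv_eq]
    have h0 : HasDerivAt (fun t : ℝ => (t : ℂ)) 1 s := by
      simpa using (hasDerivAt_id s).ofReal_comp
    have h1 : HasDerivAt (fun t : ℝ => -(t : ℂ)) (-1) s := h0.neg
    have h2 := (h1.mul (hd (n + 1))).sub ((hd n).const_mul (n : ℂ))
    have h3 := h2.deriv
    simp only [Pi.mul_def, Pi.sub_def] at h3
    rw [h3]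
    push_cast
    ring

/-- A relation between integrals of derivatives that holds for polynomials holds for smooth
functions. -/
theorem sum_integral_iteratedDeriv_eq_zero (hh : Continuous h) (hK : IsCompact K) {ι : Type*}
    (S : Finset ι) (c : ι → ℂ) (r : ι → ℕ) {F : ι → E → ℂ} (hF : ∀ i ∈ S, IsTestOn K (F i))
    (hP : ∀ p : Polynomial ℝ, ∑ i ∈ S,
      c i * ∫ z, (((Polynomial.derivative^[r i] p).eval (h z) : ℝ) : ℂ) * F i z ∂μ = 0)
    {Φ : ℝ → ℝ} (hΦ : ContDiff ℝ (⊤ : ℕ∞) Φ) :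
    ∑ i ∈ S, c i * ∫ z, ((iteratedDeriv (r i) Φ (h z) : ℝ) : ℂ) * F i z ∂μ = 0 := by
  obtain ⟨M, hM⟩ := hK.exists_bound_of_continuousOn hh.continuousOn
  have hM0 : (0 : ℝ) ≤ |M| := abs_nonneg M
  have hMK : ∀ z ∈ K, h z ∈ Set.Icc (-|M|) |M| := fun z hz =>
    abs_le.1 ((hM z hz).trans (le_abs_self M))
  set B : ℝ := ∑ i ∈ S, ‖c i‖ * ∫ z, ‖F i z‖ ∂μ with hB
  have hB0 : 0 ≤ B := Finset.sum_nonneg fun i _ =>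
    mul_nonneg (norm_nonneg _) (integral_nonneg fun z => norm_nonneg _)
  have hbound : ∀ δ : ℝ, 0 < δ →
      ‖∑ i ∈ S, c i * ∫ z, ((iteratedDeriv (r i) Φ (h z) : ℝ) : ℂ) * F i z ∂μ‖ ≤ δ * B := by
    intro δ hδ
    -- Only finitely many derivative orders occur and only values of `h` on `K` matter, so one
    -- polynomial serves all terms with error at most `δ B`.
    obtain ⟨p, hp⟩ := exists_polynomial_near (S.sup r) hM0 hΦ hδ
    rw [← sub_zero (∑ i ∈ S, _), ← hP p, ← Finset.sum_sub_distrib, hB, Finset.mul_sum]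
    refine norm_sum_le_of_le _ fun i hi => ?_
    have c1 : Continuous fun z => ((iteratedDeriv (r i) Φ (h z) : ℝ) : ℂ) * F i z :=
      (Complex.continuous_ofReal.comp ((hΦ.continuous_iteratedDeriv (r i)
        (by exact_mod_cast (le_top : (r i : ℕ∞) ≤ ⊤))).comp hh)).mul (hF i hi).contDiff.continuous
    have c2 : Continuous fun z => (((Polynomial.derivative^[r i] p).eval (h z) : ℝ) : ℂ) * F i z :=
      (Complex.continuous_ofReal.comp ((Polynomial.continuous _).comp hh)).mul
        (hF i hi).contDiff.continuous
    have hs := (hF i hi).hasCompactSupport hK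
    rw [← mul_sub, norm_mul, mul_left_comm]
    refine mul_le_mul_of_nonneg_left ?_ (norm_nonneg _)
    rw [← integral_sub (c1.integrable_of_hasCompactSupport hs.mul_left)
      (c2.integrable_of_hasCompactSupport hs.mul_left), ← integral_const_mul]
    refine norm_integral_le_of_norm_le (((hF i hi).integrable μ hK).norm.const_mul δ)
      (Eventually.of_forall fun z => ?_)
    by_cases hz : z ∈ K
    · rw [← sub_mul, norm_mul, ← Complex.ofReal_sub, Complex.norm_real, Real.norm_eq_abs]
      gcongr
      exact hp (r i) (Finset.le_sup hi) _ (hMK z hz)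
    · simp [(hF i hi).eq_zero hz]
  refine norm_le_zero_iff.1 (le_of_forall_pos_le_add fun η hη => ?_)
  refine (hbound (η / (B + 1)) (by positivity)).trans ?_
  rw [zero_add, div_mul_eq_mul_div, div_le_iff₀ (by positivity)]
  nlinarith

/-- The corresponding relation between derivatives of superlevel integrals. -/
theorem sum_iteratedDeriv_superlevelIntegral_eq_zero (hT : IsTransport μ h K s₀ ε T)
    (hh : Continuous h) (hK : IsCompact K) {ι : Type*} (S : Finset ι) (c : ι → ℂ) (r : ι → ℕ)
    {F : ι → E → ℂ} (hF : ∀ i ∈ S, IsTestOn K (F i))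
    (hP : ∀ p : Polynomial ℝ, ∑ i ∈ S,
      c i * ∫ z, (((Polynomial.derivative^[r i] p).eval (h z) : ℝ) : ℂ) * F i z ∂μ = 0)
    {s : ℝ} (hs : |s - s₀| < ε) :
    ∑ i ∈ S, c i * iteratedDeriv (r i) (superlevelIntegral μ h (F i)) s = 0 := by
  have h1 : Tendsto (fun j => ∑ i ∈ S,
      c i * ∫ z, (smoothStep j s (h z) : ℂ) * T^[r i] (F i) z ∂μ) atTop
      (𝓝 (∑ i ∈ S, c i * superlevelIntegral μ h (T^[r i] (F i)) s)) :=
    tendsto_finsetSum _ fun i hi => (tendsto_integral_smoothStep μ hh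
      (((hF i hi).iterate hT.test (r i)).integrable μ hK) s).const_mul _
  -- For large `j` each member of the sequence is the relation for the smooth function `smoothStep j
  -- s`, with its derivatives moved onto the test functions; hence it is zero.
  have h2 : Tendsto (fun j => ∑ i ∈ S,
      c i * ∫ z, (smoothStep j s (h z) : ℂ) * T^[r i] (F i) z ∂μ) atTop (𝓝 0) := by
    refine tendsto_const_nhds.congr' ?_
    filter_upwards [eventually_isStepLike hs] with j hj
    have hj := hj s le_rfl
    rw [← sum_integral_iteratedDeriv_eq_zero (μ := μ) hh hK S c r hF hP hj.contDiff]
    exact Finset.sum_congr rfl fun i hi => by rw [integral_iteratedDeriv_eq hT (hF i hi) _ hj]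
  rw [← tendsto_nhds_unique h1 h2]
  exact Finset.sum_congr rfl fun i hi => by
    rw [iteratedDeriv_superlevelIntegral hT hh hK (hF i hi) _ hs]

end Generic

/-! ## The variation of the trace of the step function -/

/-- The density `(ω† + ω) · density H n`. -/
def gaugeWeight (h Δ : Phase d → ℝ) (ω : Phase d → ℂ) (a b n : ℕ) (z : Phase d) : ℂ :=
  ((starRingEnd ℂ) (ω z) + ω z) * (symbolOf h Δ).density n a b 0 z

section Variation

variable {h Δ : Phase d → ℝ} (hh : ContDiff ℝ (⊤ : ℕ∞) h) (hΔ : ContDiff ℝ (⊤ : ℕ∞) Δ)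
  {ω : Phase d → ℂ} (hω : ContDiff ℝ (⊤ : ℕ∞) ω) {K : Set (Phase d)} (hωK : tsupport ω ⊆ K)
include hh hΔ hω hωK

theorem isTestOn_density_gaugeSymbol (n a b : ℕ) :
    IsTestOn K ((gaugeSymbol h Δ ω).density n a b 1) :=
  ⟨contDiff_density_gaugeSymbol hh hΔ hω n a b 1, (closure_minimal (fun z hz => by
    by_contra hz'
    exact hz (density_gaugeSymbol_eq_zero hh hΔ hz' n a b)) (isClosed_tsupport ω)).trans hωK⟩

theorem isTestOn_gaugeWeight (n a b : ℕ) : IsTestOn K (gaugeWeight h Δ ω a b n) :=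
  ⟨((Complex.conjCLE.contDiff.comp hω).add hω).mul (contDiff_density_symbolOf hh hΔ n a b 0),
    (closure_minimal (fun z hz => by
      by_contra hz'
      exact hz (by simp [gaugeWeight, image_eq_zero_of_notMem_tsupport hz']))
      (isClosed_tsupport ω)).trans hωK⟩

/-- Uses `(u Φ')^(n) = u Φ^(n+1) + n Φ^(n)`, with the factor `u = h` absorbed into the test function
so that only derivatives of `Φ` remain. -/
theorem polynomial_variation (hK : IsCompact K) (a b : ℕ) (p : Polynomial ℝ) :
    ∑ n ∈ Finset.range (2 * a + b + 1 + 1),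
      ∫ z, (((Polynomial.derivative^[n] p).eval (h z) : ℝ) : ℂ) *
        (gaugeSymbol h Δ ω).density n a b 1 z =
    ∑ n ∈ Finset.range (2 * a + b + 1),
      ((∫ z, (((Polynomial.derivative^[n + 1] p).eval (h z) : ℝ) : ℂ) *
        ((h z : ℂ) * gaugeWeight h Δ ω a b n z)) +
      n * ∫ z, (((Polynomial.derivative^[n] p).eval (h z) : ℝ) : ℂ) *
        gaugeWeight h Δ ω a b n z) := by
  have hev : ∀ (q : Polynomial ℝ) (u : ℝ),
      (q.map Complex.ofRealHom).eval (u : ℂ) = ((q.eval u : ℝ) : ℂ) := fun q u => by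
    have := Polynomial.eval_map_apply (f := Complex.ofRealHom) (p := q) u
    simpa using this
  have hc : HasCompactSupport ω := hK.of_isClosed_subset (isClosed_tsupport ω) hωK
  have key := integral_polynomial_variation hh hΔ hω hc (p.map Complex.ofRealHom) a b
  have hX : Polynomial.X * Polynomial.derivative (p.map Complex.ofRealHom) =
      (Polynomial.X * Polynomial.derivative p).map Complex.ofRealHom := by
    simp [Polynomial.derivative_map]
  simp only [hX, Polynomial.iterate_derivative_map, hev] at key
  have hcd : ∀ q : Polynomial ℝ, ContDiff ℝ (⊤ : ℕ∞) (fun z : Phase d => ((q.eval (h z) : ℝ) : ℂ)) :=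
    fun q => Complex.ofRealCLM.contDiff.comp
      ((by simpa using q.contDiff_aeval (𝕜 := ℝ) _ : ContDiff ℝ (⊤ : ℕ∞) fun u => q.eval u).comp hh)
  have hhc : ContDiff ℝ (⊤ : ℕ∞) (fun z : Phase d => (h z : ℂ)) :=
    Complex.ofRealCLM.contDiff.comp hh
  have hf := isTestOn_density_gaugeSymbol hh hΔ hω hωK
  have hg := isTestOn_gaugeWeight hh hΔ hω hωK
  rw [integral_finsetSum _ fun n _ => ((hf n a b).mul_left (hcd _)).integrable volume hK] at key
  rw [key]
  have e : ∀ n, Polynomial.derivative^[n] (Polynomial.X * Polynomial.derivative p) =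
      Polynomial.X * Polynomial.derivative^[n + 1] p +
        (n : Polynomial ℝ) * Polynomial.derivative^[n] p := fun n => by
    induction n with
    | zero => simp
    | succ n ih =>
      rw [Function.iterate_succ_apply', ih, Polynomial.derivative_add, Polynomial.derivative_mul,
        Polynomial.derivative_X, Polynomial.derivative_mul, Polynomial.derivative_natCast,
        ← Function.iterate_succ_apply' (⇑Polynomial.derivative) (n + 1),
        ← Function.iterate_succ_apply' (⇑Polynomial.derivative) n]
      push_cast
      ring
  have e2 : ∀ z, ((starRingEnd ℂ) (ω z) + ω z) * ∑ n ∈ Finset.range (2 * a + b + 1),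
      (((Polynomial.derivative^[n] (Polynomial.X * Polynomial.derivative p)).eval (h z) : ℝ) : ℂ) *
        (symbolOf h Δ).density n a b 0 z = ∑ n ∈ Finset.range (2 * a + b + 1),
      ((((Polynomial.derivative^[n + 1] p).eval (h z) : ℝ) : ℂ) *
        ((h z : ℂ) * gaugeWeight h Δ ω a b n z) +
      n * ((((Polynomial.derivative^[n] p).eval (h z) : ℝ) : ℂ) *
        gaugeWeight h Δ ω a b n z)) := fun z => by
    rw [Finset.mul_sum]
    refine Finset.sum_congr rfl fun n _ => ?_
    rw [e]
    simp only [Polynomial.eval_add, Polynomial.eval_mul, Polynomial.eval_X, Polynomial.eval_natCast,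
      gaugeWeight]
    push_cast
    ring
  simp only [e2]
  have i1 : ∀ n, Integrable (fun z => (((Polynomial.derivative^[n + 1] p).eval (h z) : ℝ) : ℂ) *
      ((h z : ℂ) * gaugeWeight h Δ ω a b n z)) := fun n =>
    (((hg n a b).mul_left hhc).mul_left (hcd _)).integrable volume hK
  have i2 : ∀ n : ℕ, Integrable (fun z => (n : ℂ) *
      ((((Polynomial.derivative^[n] p).eval (h z) : ℝ) : ℂ) * gaugeWeight h Δ ω a b n z)) := fun n =>
    (((hg n a b).mul_left (hcd _)).integrable volume hK).const_mul _
  have i3 : ∀ n : ℕ, Integrable (fun z => (((Polynomial.derivative^[n + 1] p).eval (h z) : ℝ) : ℂ) *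
      ((h z : ℂ) * gaugeWeight h Δ ω a b n z) + (n : ℂ) *
      ((((Polynomial.derivative^[n] p).eval (h z) : ℝ) : ℂ) * gaugeWeight h Δ ω a b n z)) :=
    fun n => (i1 n).add (i2 n)
  rw [integral_finsetSum _ fun n _ => i3 n]
  refine Finset.sum_congr rfl fun n _ => ?_
  rw [integral_add (i1 n) (i2 n), integral_const_mul]

/-- The first variation at the level `s` is proportional to `s`. -/
theorem variation_identity (hK : IsCompact K) {T : (Phase d → ℂ) → (Phase d → ℂ)} {s₀ ε : ℝ}
    (hT : IsTransport volume h K s₀ ε T) (a b : ℕ) {s : ℝ} (hs : |s - s₀| < ε) :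
    ∑ n ∈ Finset.range (2 * a + b + 1 + 1),
      iteratedDeriv n (superlevelIntegral volume h ((gaugeSymbol h Δ ω).density n a b 1)) s =
    -s * ∑ n ∈ Finset.range (2 * a + b + 1),
      iteratedDeriv (n + 1) (superlevelIntegral volume h (gaugeWeight h Δ ω a b n)) s := by
  have hhc : ContDiff ℝ (⊤ : ℕ∞) (fun z : Phase d => (h z : ℂ)) :=
    Complex.ofRealCLM.contDiff.comp hh
  have hf := isTestOn_density_gaugeSymbol hh hΔ hω hωK
  have hg := isTestOn_gaugeWeight hh hΔ hω hωK
  -- The polynomial identity written as one vanishing sum: three blocks with coefficients `1`, `-1`,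
  -- `-n` and derivative orders `n`, `n + 1`, `n`.
  have key := sum_iteratedDeriv_superlevelIntegral_eq_zero hT hh.continuous hK
    ((Finset.range (2 * a + b + 1 + 1)).disjSum
      ((Finset.range (2 * a + b + 1)).disjSum (Finset.range (2 * a + b + 1))))
    (Sum.elim (fun _ => 1) (Sum.elim (fun _ => -1) (fun n => -(n : ℂ))))
    (Sum.elim id (Sum.elim Nat.succ id))
    (F := Sum.elim (fun n => (gaugeSymbol h Δ ω).density n a b 1)
      (Sum.elim (fun n z => (h z : ℂ) * gaugeWeight h Δ ω a b n z)
        (fun n => gaugeWeight h Δ ω a b n))) ?_ ?_ hs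
  -- Multiplication by `h` yields `-s V^(n+1) - n V^(n)`; its second part cancels the third block,
  -- and only the multiple of `s` is left.
  · simp only [Finset.sum_disjSum, Sum.elim_inl, Sum.elim_inr, id_eq, Nat.succ_eq_add_one,
      iteratedDeriv_superlevelIntegral_mul hT hh hK (hg _ a b) _ hs] at key
    rw [← sub_eq_zero, Finset.mul_sum, ← key, sub_eq_add_neg, ← Finset.sum_neg_distrib,
      ← Finset.sum_add_distrib]
    congr 1
    · simp
    · refine Finset.sum_congr rfl fun n _ => ?_
      ring
  · rintro (n | n | n) _
    · exact hf n a b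
    · exact (hg n a b).mul_left hhc
    · exact hg n a b
  · intro p
    have := polynomial_variation hh hΔ hω hωK hK a b p
    simp only [Finset.sum_disjSum, Sum.elim_inl, Sum.elim_inr, id_eq, Nat.succ_eq_add_one, one_mul]
    rw [this, ← Finset.sum_add_distrib, ← Finset.sum_add_distrib]
    exact Finset.sum_eq_zero fun n _ => by ring

end Variation

/-! ## Momentum cutoffs -/

theorem IsGaugeParameter.contDiff {ω : Phase d → ℂ} (hω : IsGaugeParameter ω) :
    ContDiff ℝ (⊤ : ℕ∞) ω := by
  obtain ⟨c, hc, -⟩ := hω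
  exact hc.smooth

theorem IsGaugeParameter.exists_support {ω : Phase d → ℂ} (hω : IsGaugeParameter ω) :
    ∃ K : Set (Fin d → ℝ), IsCompact K ∧ ∀ z : Phase d, z.1 ∉ K → ω z = 0 := by
  obtain ⟨c, hc, K, hK, hcK⟩ := hω
  refine ⟨K, hK, fun z hz => (hc.hasSum z.1 z.2).unique ?_⟩
  simp [hcK _ _ z.1 hz, hasSum_zero]

/-- Gauge parameters are confined in `x` only. In the applications `R₀` bounds the momenta of the
surface over `K`, and the unit margin makes `ω` and `ω'` agree on a neighbourhood of it. -/
theorem exists_cutoff {ω : Phase d → ℂ} (hω : ContDiff ℝ (⊤ : ℕ∞) ω) {K : Set (Fin d → ℝ)}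
    (hK : IsCompact K) (hωK : ∀ z : Phase d, z.1 ∉ K → ω z = 0) {R₀ : ℝ} (hR₀ : 0 ≤ R₀) :
    ∃ ω' : Phase d → ℂ, ContDiff ℝ (⊤ : ℕ∞) ω' ∧
      tsupport ω' ⊆ K ×ˢ Metric.closedBall 0 (R₀ + 2) ∧
      ∀ z : Phase d, ‖z.2‖ < R₀ + 1 → ω =ᶠ[𝓝 z] ω' := by
  let χ : ContDiffBump (0 : Fin d → ℝ) := ⟨R₀ + 1, R₀ + 2, by linarith, by linarith⟩
  refine ⟨fun z => (χ z.2 : ℂ) * ω z, ?_, closure_minimal (fun z hz => ?_)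
    (hK.prod (isCompact_closedBall _ _)).isClosed, fun z hz => ?_⟩
  · exact (Complex.ofRealCLM.contDiff.comp (χ.contDiff.comp contDiff_snd)).mul hω
  · rw [Function.mem_support] at hz
    refine ⟨by_contra fun h => hz (by simp [hωK z h]), by_contra fun h => hz ?_⟩
    rw [χ.zero_of_le_dist, Complex.ofReal_zero, zero_mul]
    rw [Metric.mem_closedBall, not_le] at h
    exact h.le
  · have ho : IsOpen {z : Phase d | ‖z.2‖ < R₀ + 1} :=
      isOpen_lt continuous_snd.norm continuous_const
    filter_upwards [ho.mem_nhds hz] with y hy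
    rw [χ.one_of_mem_closedBall, Complex.ofReal_one, one_mul]
    rw [mem_closedBall_zero_iff]
    exact le_of_lt hy

/-- Changing the integrand away from the levels in question changes `levelVolume` by a constant. -/
theorem exists_levelVolume_eq_add_const {h : Phase d → ℝ} (hh : Continuous h)
    {K : Set (Fin d → ℝ)} (hK : IsCompact K) {f f' : Phase d → ℂ} (hf : Continuous f)
    (hfK : ∀ z : Phase d, z.1 ∉ K → f z = 0) {R₀ R : ℝ} (hR : R₀ + 2 < R)
    (hf' : IsTestOn (K ×ˢ Metric.closedBall 0 (R₀ + 2)) f')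
    (hff' : ∀ z : Phase d, ‖z.2‖ < R₀ + 1 → f z = f' z) {U : Set ℝ}
    (hU : ∀ z : Phase d, z.1 ∈ K → R₀ + 1 ≤ ‖z.2‖ → ‖z.2‖ < R → ∀ s ∈ U, ∀ t ∈ U,
      0 < h z + s → 0 < h z + t) :
    ∃ C : ℂ, ∀ s ∈ U, levelVolume h f R s = superlevelIntegral volume h f' s + C := by
  rcases U.eq_empty_or_nonempty with rfl | ⟨t, ht⟩
  · exact ⟨0, by simp⟩
  have hmeas : ∀ s, MeasurableSet {z : Phase d | ‖z.2‖ < R ∧ 0 < h z + s} := fun s =>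
    ((isOpen_lt continuous_snd.norm continuous_const).inter
      (isOpen_lt continuous_const (hh.add continuous_const))).measurableSet
  have hmeas' : ∀ s, MeasurableSet {z : Phase d | 0 < h z + s} := fun s =>
    (isOpen_lt continuous_const (hh.add continuous_const)).measurableSet
  have hKR : IsCompact (K ×ˢ Metric.closedBall (0 : Fin d → ℝ) R) :=
    hK.prod (isCompact_closedBall _ _)
  have hK' : IsCompact (K ×ˢ Metric.closedBall (0 : Fin d → ℝ) (R₀ + 2)) :=
    hK.prod (isCompact_closedBall _ _)
  have hf'0 : ∀ z : Phase d, z.1 ∉ K → f' z = 0 := fun z hz => hf'.eq_zero fun h => hz h.1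
  have hf'1 : ∀ z : Phase d, ¬ ‖z.2‖ < R → f' z = 0 := fun z hz => hf'.eq_zero fun h => hz
    (lt_of_le_of_lt (mem_closedBall_zero_iff.1 h.2) hR)
  have hint : ∀ s, IntegrableOn f {z : Phase d | ‖z.2‖ < R ∧ 0 < h z + s} := fun s => by
    rw [← integrable_indicator_iff (hmeas s)]
    have hi : IntegrableOn f (K ×ˢ Metric.closedBall (0 : Fin d → ℝ) R) :=
      hf.continuousOn.integrableOn_compact hKR
    rw [← integrable_indicator_iff hKR.isClosed.measurableSet] at hi
    refine hi.mono ((hf.measurable.indicator (hmeas s)).aestronglyMeasurable)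
      (Eventually.of_forall fun z => ?_)
    by_cases hz : z ∈ {z : Phase d | ‖z.2‖ < R ∧ 0 < h z + s}
    · by_cases hzK : z.1 ∈ K
      · rw [Set.indicator_of_mem hz, Set.indicator_of_mem]
        exact ⟨hzK, mem_closedBall_zero_iff.2 hz.1.le⟩
      · simp [Set.indicator_apply, hfK z hzK]
    · rw [Set.indicator_of_notMem hz, norm_zero]; exact norm_nonneg _
  have hint' : ∀ s, IntegrableOn f' {z : Phase d | ‖z.2‖ < R ∧ 0 < h z + s} := fun s =>
    (hf'.integrable volume hK').integrableOn
  have e1 : ∀ s, levelVolume h f' R s = superlevelIntegral volume h f' s := fun s => by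
    rw [levelVolume, superlevelIntegral, ← integral_indicator (hmeas s),
      ← integral_indicator (hmeas' s)]
    congr 1
    funext z
    by_cases hz : ‖z.2‖ < R
    · simp [Set.indicator_apply, hz]
    · simp [Set.indicator_apply, hf'1 z hz]
  have e2 : ∀ s, levelVolume h f R s - levelVolume h f' R s =
      ∫ z, Set.indicator {z : Phase d | ‖z.2‖ < R ∧ 0 < h z + s} (fun z => f z - f' z) z :=
    fun s => by
      rw [integral_indicator (hmeas s), integral_sub (hint s) (hint' s), levelVolume, levelVolume]
  -- The constant is read off at one reference level `t`: `f - f'` lives where `θ(h + s)` is the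
  -- same for all `s ∈ U`.
  refine ⟨levelVolume h f R t - levelVolume h f' R t, fun s hs => ?_⟩
  rw [← e1, ← sub_eq_iff_eq_add', e2, e2]
  congr 1
  funext z
  by_cases h1 : ‖z.2‖ < R₀ + 1
  · simp [Set.indicator_apply, hff' z h1]
  · by_cases h2 : z.1 ∈ K
    · by_cases h3 : ‖z.2‖ < R
      · have : 0 < h z + s ↔ 0 < h z + t :=
          ⟨hU z h2 (not_lt.1 h1) h3 s hs t ht, hU z h2 (not_lt.1 h1) h3 t ht s hs⟩
        simp [Set.indicator_apply, this]
      · simp [h3]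
    · simp [Set.indicator_apply, hfK z h2, hf'0 z h2]

theorem iteratedDeriv_succ_add_const (V : ℝ → ℂ) (C : ℂ) (n : ℕ) :
    iteratedDeriv (n + 1) (fun s => V s + C) = iteratedDeriv (n + 1) V := by
  rw [iteratedDeriv_succ', iteratedDeriv_succ']
  congr 1
  funext s
  exact deriv_add_const C

/-- The two integrals differ by a constant on `U`, invisible to derivatives with `n ≥ 1`; for `n =
0` both integrands are assumed zero. The set `U` may shrink as `R` grows, since only germs along `l`
are compared. -/
theorem hasThetaIntegral_of_cutoff {l : Filter ℝ} {h : Phase d → ℝ} (hh : Continuous h)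
    {K : Set (Fin d → ℝ)} (hK : IsCompact K) {f f' : Phase d → ℂ} (hf : Continuous f)
    (hfK : ∀ z : Phase d, z.1 ∉ K → f z = 0) {R₀ : ℝ}
    (hf' : IsTestOn (K ×ˢ Metric.closedBall 0 (R₀ + 2)) f')
    (hff' : ∀ z : Phase d, ‖z.2‖ < R₀ + 1 → f z = f' z)
    (hU : ∀ R : ℝ, ∃ U ∈ l, IsOpen U ∧
      (∀ z : Phase d, z.1 ∈ K → R₀ + 1 ≤ ‖z.2‖ → ‖z.2‖ < R → ∀ s ∈ U, ∀ t ∈ U,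
        0 < h z + s → 0 < h z + t) ∧
      ∀ s ∈ U, ContDiffAt ℝ (⊤ : ℕ∞) (superlevelIntegral volume h f') s)
    {n : ℕ} (hn : n = 0 → f = 0 ∧ f' = 0) {v : ℂ}
    (hv : Tendsto (iteratedDeriv n (superlevelIntegral volume h f')) l (𝓝 v)) :
    HasThetaIntegral l h n f v := by
  filter_upwards [eventually_gt_atTop (R₀ + 2)] with R hR
  obtain ⟨U, hUl, hUo, hUs, hUd⟩ := hU R
  obtain ⟨C, hC⟩ := exists_levelVolume_eq_add_const hh hK hf hfK hR hf' hff' hUs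
  have he : ∀ s ∈ U, levelVolume h f R =ᶠ[𝓝 s] fun s => superlevelIntegral volume h f' s + C :=
    fun s hs => by filter_upwards [hUo.mem_nhds hs] with t ht using hC t ht
  refine ⟨?_, ?_⟩
  · filter_upwards [hUl] with s hs
    exact ((hUd s hs).add contDiffAt_const).congr_of_eventuallyEq (he s hs)
  · rcases n with _ | n
    · obtain ⟨rfl, rfl⟩ := hn rfl
      have e1 : levelVolume h (0 : Phase d → ℂ) R = fun _ => 0 := by funext s; simp [levelVolume]
      have e2 : superlevelIntegral volume h (0 : Phase d → ℂ) = fun _ => 0 := by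
        funext s; simp [superlevelIntegral]
      rw [e1]; rwa [e2] at hv
    · refine hv.congr' ?_
      filter_upwards [hUl] with s hs
      rw [(he s hs).iteratedDeriv_eq, iteratedDeriv_succ_add_const]

/-- Invariance for a Hamiltonian with regular, locally compact constraint surface. -/
theorem invariantAtOrder_of_regular {h Δ : Phase d → ℝ} (hh : ContDiff ℝ (⊤ : ℕ∞) h)
    (hΔ : ContDiff ℝ (⊤ : ℕ∞) Δ) (hreg : IsRegularSurface h)
    (hcomp : ∀ K : Set (Fin d → ℝ), IsCompact K → IsCompact {z : Phase d | z.1 ∈ K ∧ h z = 0})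
    {ω : Phase d → ℂ} (hω : IsGaugeParameter ω) (a b : ℕ) : InvariantAtOrder (𝓝 0) h Δ ω a b := by
  obtain ⟨K, hK, hωK⟩ := hω.exists_support
  have hωs := hω.contDiff
  obtain ⟨R₁, hR₁⟩ := (hcomp K hK).isBounded.exists_norm_le
  set R₀ := |R₁| with hR₀
  have hZ : ∀ z : Phase d, z.1 ∈ K → h z = 0 → ‖z.2‖ ≤ R₀ := fun z hz h0 =>
    ((norm_snd_le z).trans (hR₁ z ⟨hz, h0⟩)).trans (le_abs_self _)
  obtain ⟨ω', hω's, hω'K, hωω'⟩ := exists_cutoff hωs hK hωK (abs_nonneg R₁)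
  have hK' : IsCompact (K ×ˢ Metric.closedBall (0 : Fin d → ℝ) (R₀ + 2)) :=
    hK.prod (isCompact_closedBall _ _)
  obtain ⟨ε, hε, T, hT1, hT2⟩ := exists_transport volume hh hK' (s₀ := 0)
    (fun z _ h0 => hreg z (by simpa using h0))
  have hT : IsTransport volume h (K ×ˢ Metric.closedBall (0 : Fin d → ℝ) (R₀ + 2)) 0 ε T :=
    ⟨hT1, hT2⟩
  have hf' := fun n => isTestOn_density_gaugeSymbol hh hΔ hω's hω'K n a b
  have h0 : |(0 : ℝ) - 0| < ε := by simpa using hε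
  refine ⟨fun n => iteratedDeriv n
    (superlevelIntegral volume h ((gaugeSymbol h Δ ω').density n a b 1)) 0, fun n _ => ?_, ?_⟩
  · refine hasThetaIntegral_of_cutoff (f' := (gaugeSymbol h Δ ω').density n a b 1)
      (R₀ := R₀) hh.continuous hK
      (contDiff_density_gaugeSymbol hh hΔ hωs n a b 1).continuous (fun z hz => ?_)
      (hf' n) (fun z hz => ?_) (fun R => ?_) ?_ ?_
    · refine density_gaugeSymbol_eq_zero hh hΔ ?_ n a b
      rw [notMem_tsupport_iff_eventuallyEq]
      have ho : IsOpen {z : Phase d | z.1 ∉ K} := hK.isClosed.isOpen_compl.preimage continuous_fst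
      filter_upwards [ho.mem_nhds hz] with y hy using hωK y hy
    · exact (gaugeSymbol_germEq h Δ (hωω' z hz)).density_eq n a b 1
    -- The shell outside the surface is compact, so `|h| ≥ c > 0` on it and the sign of `h + s` is
    -- fixed for `|s| < c`.
    · have hQ : IsCompact {z : Phase d | z ∈ K ×ˢ Metric.closedBall (0 : Fin d → ℝ) R ∧
          R₀ + 1 ≤ ‖z.2‖} :=
        (hK.prod (isCompact_closedBall _ _)).inter_right
          (isClosed_le continuous_const continuous_snd.norm)
      obtain ⟨c, hc, hcQ⟩ := hQ.exists_forall_le' (f := fun z => |h z|) (a := 0)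
        hh.continuous.abs.continuousOn (fun z hz => abs_pos.2 fun h0 => by
          have := hZ z hz.1.1 h0
          have := hz.2
          linarith)
      refine ⟨Metric.ball 0 (min c ε), Metric.ball_mem_nhds _ (lt_min hc hε), Metric.isOpen_ball,
        fun z hz h1 h2 s hs t ht hst => ?_, fun s hs => ?_⟩
      · have hcz := hcQ z ⟨⟨hz, mem_closedBall_zero_iff.2 h2.le⟩, h1⟩
        rw [mem_ball_zero_iff, Real.norm_eq_abs, lt_min_iff] at hs ht
        have hs1 := abs_lt.1 hs.1
        have ht1 := abs_lt.1 ht.1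
        rcases abs_cases (h z) with ⟨h3, h4⟩ | ⟨h3, h4⟩ <;> linarith
      · refine (contDiffOn_superlevelIntegral hT hh.continuous hK' (hf' n)).contDiffAt
          (Metric.isOpen_ball.mem_nhds (Metric.ball_subset_ball (min_le_right _ _) hs))
    · rintro rfl
      exact ⟨density_gaugeSymbol_order_zero h Δ ω a b, density_gaugeSymbol_order_zero h Δ ω' a b⟩
    · have hc : ContinuousAt (iteratedDeriv n
          (superlevelIntegral volume h ((gaugeSymbol h Δ ω').density n a b 1))) 0 := by
        refine (continuousAt_superlevelIntegral hT hh.continuous hK'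
          ((hf' n).iterate hT.test n) h0).congr ?_
        filter_upwards [Metric.ball_mem_nhds (0 : ℝ) hε] with s hs
        exact (iteratedDeriv_superlevelIntegral hT hh.continuous hK' (hf' n) n
          (by simpa [Real.dist_eq] using hs)).symm
      exact hc
  -- At `s = 0` the prefactor `-s` kills the right side.
  · have := variation_identity hh hΔ hω's hω'K hK' hT a b h0
    simpa using this.symm

/-! ## Quadratic Hamiltonians -/

section Quadratic

variable {D : (Fin d → ℝ) → ℝ} {g : (Fin d → ℝ) → Matrix (Fin d) (Fin d) ℝ}
  {A : (Fin d → ℝ) → Fin d → ℝ}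

/-- The quadratic form of the metric. -/
def metricForm (g : (Fin d → ℝ) → Matrix (Fin d) (Fin d) ℝ) (x q : Fin d → ℝ) : ℝ :=
  ∑ m, ∑ n, g x m n * q m * q n

theorem quadraticHamiltonian_eq (z : Phase d) :
    quadraticHamiltonian D g A z = D z.1 - metricForm g z.1 (z.2 - A z.1) := rfl

variable (bg : IsEuclideanBackground D g A)
include bg

theorem contDiff_quadraticHamiltonian : ContDiff ℝ (⊤ : ℕ∞) (quadraticHamiltonian D g A) := by
  have hA : ∀ m, ContDiff ℝ (⊤ : ℕ∞) (fun z : Phase d => z.2 m - A z.1 m) := fun m =>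
    ((contDiff_apply ℝ ℝ m).comp contDiff_snd).sub ((bg.smooth_A m).comp contDiff_fst)
  exact (bg.smooth_D.comp contDiff_fst).sub (ContDiff.sum fun m _ => ContDiff.sum fun n _ =>
    ((((bg.smooth_g m n).comp contDiff_fst).mul (hA m)).mul (hA n)))

theorem metricForm_pos (x : Fin d → ℝ) {q : Fin d → ℝ} (hq : q ≠ 0) : 0 < metricForm g x q := by
  have h := (bg.posDef x).dotProduct_mulVec_pos hq
  have e : star q ⬝ᵥ (g x).mulVec q = metricForm g x q := by
    simp only [dotProduct, Matrix.mulVec, metricForm, star_trivial, Finset.mul_sum]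
    exact Finset.sum_congr rfl fun m _ => Finset.sum_congr rfl fun n _ => by ring
  rwa [e] at h

theorem metric_symm (x : Fin d → ℝ) (m n : Fin d) : g x m n = g x n m := by
  have := (bg.posDef x).isHermitian.apply n m
  simpa using this

/-- The minimum over `K` times the unit sphere, extended by homogeneity of degree two. -/
theorem exists_metricForm_bound {K : Set (Fin d → ℝ)} (hK : IsCompact K) :
    ∃ c > 0, ∀ x ∈ K, ∀ q, c * ‖q‖ ^ 2 ≤ metricForm g x q := by
  have hc : Continuous fun y : Phase d => metricForm g y.1 y.2 :=
    continuous_finsetSum _ fun m _ => continuous_finsetSum _ fun n _ =>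
      ((((bg.smooth_g m n).continuous.comp continuous_fst).mul
        ((continuous_apply m).comp continuous_snd)).mul ((continuous_apply n).comp continuous_snd))
  obtain ⟨c, hc0, hcK⟩ := (hK.prod (isCompact_sphere (0 : Fin d → ℝ) 1)).exists_forall_le'
    (a := 0) hc.continuousOn fun y hy => metricForm_pos bg y.1 fun h0 => by
      have := hy.2
      rw [h0] at this
      simp at this
  refine ⟨c, hc0, fun x hx q => ?_⟩
  by_cases hq : q = 0
  · simp [hq, metricForm]
  · have hq' : ‖q‖ ≠ 0 := norm_ne_zero_iff.2 hq
    have h1 := hcK (x, ‖q‖⁻¹ • q) ⟨hx, by simp [norm_smul, hq']⟩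
    have h2 : metricForm g x (‖q‖⁻¹ • q) = ‖q‖⁻¹ ^ 2 * metricForm g x q := by
      simp only [metricForm, Pi.smul_apply, smul_eq_mul, Finset.mul_sum]
      exact Finset.sum_congr rfl fun m _ => Finset.sum_congr rfl fun n _ => by ring
    simp only [h2] at h1
    have h3 : 0 < ‖q‖ ^ 2 := by positivity
    calc c * ‖q‖ ^ 2 ≤ ‖q‖⁻¹ ^ 2 * metricForm g x q * ‖q‖ ^ 2 := by gcongr
      _ = metricForm g x q := by field_simp

/-- The slack `1` handles all superlevel sets `h + s > 0` with `0 < s < 1` at once, as the one-sided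
limit requires. -/
theorem exists_momentum_bound {K : Set (Fin d → ℝ)} (hK : IsCompact K) :
    ∃ R ≥ 0, ∀ z : Phase d, z.1 ∈ K → 0 ≤ quadraticHamiltonian D g A z + 1 → ‖z.2‖ ≤ R := by
  obtain ⟨c, hc, hcK⟩ := exists_metricForm_bound bg hK
  obtain ⟨M, hM⟩ := hK.exists_bound_of_continuousOn bg.smooth_D.continuous.continuousOn
  have hAc : Continuous A := continuous_pi fun m => (bg.smooth_A m).continuous
  obtain ⟨N, hN⟩ := hK.exists_bound_of_continuousOn hAc.continuousOn
  refine ⟨|N| + √((|M| + 1) / c), by positivity, fun z hz h0 => ?_⟩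
  have h1 := hcK z.1 hz (z.2 - A z.1)
  rw [quadraticHamiltonian_eq] at h0
  have h2 : ‖z.2 - A z.1‖ ^ 2 ≤ (|M| + 1) / c := by
    rw [le_div_iff₀ hc]
    have := (le_abs_self _).trans ((hM z.1 hz).trans (le_abs_self M))
    linarith
  have h3 := Real.le_sqrt_of_sq_le h2
  calc ‖z.2‖ = ‖A z.1 + (z.2 - A z.1)‖ := by rw [add_sub_cancel]
    _ ≤ ‖A z.1‖ + ‖z.2 - A z.1‖ := norm_add_le _ _
    _ ≤ _ := add_le_add ((hN z.1 hz).trans (le_abs_self N)) h3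

theorem isCompact_quadratic_zero {K : Set (Fin d → ℝ)} (hK : IsCompact K) :
    IsCompact {z : Phase d | z.1 ∈ K ∧ quadraticHamiltonian D g A z = 0} := by
  obtain ⟨R, -, hR⟩ := exists_momentum_bound bg hK
  refine (hK.prod (isCompact_closedBall (0 : Fin d → ℝ) R)).of_isClosed_subset ?_ ?_
  · exact (hK.isClosed.preimage continuous_fst).inter
      (isClosed_eq (contDiff_quadraticHamiltonian bg).continuous continuous_const)
  · rintro z ⟨hz, h0⟩
    exact ⟨hz, mem_closedBall_zero_iff.2 (hR z hz (by rw [h0]; norm_num))⟩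

theorem fderiv_quadraticHamiltonian (z : Phase d) (v : Fin d → ℝ) :
    fderiv ℝ (quadraticHamiltonian D g A) z (0, v) =
      -(2 * ∑ m, ∑ n, g z.1 m n * (z.2 m - A z.1 m) * v n) := by
  have hd := (contDiff_quadraticHamiltonian bg).differentiable (by simp) z
  have h1 := hd.hasFDerivAt.hasLineDerivAt ((0, v) : Phase d)
  have h2 : HasDerivAt (fun t : ℝ => quadraticHamiltonian D g A (z + t • ((0, v) : Phase d)))
      (0 - ∑ m, ∑ n, (g z.1 m n * v m * (z.2 n - A z.1 n) +
        g z.1 m n * (z.2 m - A z.1 m) * v n)) 0 := by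
    have e : (fun t : ℝ => quadraticHamiltonian D g A (z + t • ((0, v) : Phase d))) = fun t =>
        D z.1 - ∑ m, ∑ n, g z.1 m n * (z.2 m + t * v m - A z.1 m) * (z.2 n + t * v n - A z.1 n) := by
      funext t
      simp [quadraticHamiltonian]
    rw [e]
    have hl : ∀ m, HasDerivAt (fun t : ℝ => z.2 m + t * v m - A z.1 m) (v m) 0 := fun m => by
      simpa using (((hasDerivAt_id (0 : ℝ)).mul_const (v m)).const_add (z.2 m)).sub_const (A z.1 m)
    refine (hasDerivAt_const _ _).sub (HasDerivAt.fun_sum fun m _ => HasDerivAt.fun_sum fun n _ => ?_)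
    have := ((hl m).const_mul (g z.1 m n)).fun_mul (hl n)
    simpa using this
  rw [h1.unique h2, zero_sub, neg_inj]
  simp only [Finset.sum_add_distrib]
  have h3 : ∑ m, ∑ n, g z.1 m n * v m * (z.2 n - A z.1 n) =
      ∑ m, ∑ n, g z.1 m n * (z.2 m - A z.1 m) * v n := by
    rw [Finset.sum_comm]
    refine Finset.sum_congr rfl fun m _ => Finset.sum_congr rfl fun n _ => ?_
    rw [metric_symm bg z.1 n m]
    ring
  rw [h3, two_mul]

/-- Euler's identity in momenta around `A`. -/
theorem fderiv_quadraticHamiltonian_radial (z : Phase d) :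
    fderiv ℝ (quadraticHamiltonian D g A) z (0, z.2 - A z.1) =
      2 * (quadraticHamiltonian D g A z - D z.1) := by
  rw [fderiv_quadraticHamiltonian bg, quadraticHamiltonian]
  simp only [Pi.sub_apply]
  ring

/-- On this level the radial derivative in momenta around `A` equals `-2 (D + s)`, which is nonzero.
-/
theorem quadratic_regular {z : Phase d} {s : ℝ} (hs : 0 < D z.1 + s)
    (h0 : quadraticHamiltonian D g A z + s = 0) : fderiv ℝ (quadraticHamiltonian D g A) z ≠ 0 := by
  intro h
  have := fderiv_quadraticHamiltonian_radial bg z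
  rw [h, zero_apply] at this
  linarith

/-- Cramer's rule: determinants are polynomial in the entries, and `det g > 0`. -/
theorem contDiff_metric_inv (m n : Fin d) : ContDiff ℝ (⊤ : ℕ∞) (fun x => (g x)⁻¹ m n) := by
  have hdet : ∀ M : (Fin d → ℝ) → Matrix (Fin d) (Fin d) ℝ,
      (∀ i j, ContDiff ℝ (⊤ : ℕ∞) (fun x => M x i j)) →
      ContDiff ℝ (⊤ : ℕ∞) (fun x => (M x).det) := fun M hM => by
    simp only [Matrix.det_apply]
    exact ContDiff.sum fun σ _ => (contDiff_prod fun i _ => hM _ _).const_smul _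
  have e : ∀ x, (g x)⁻¹ m n = ((g x).det)⁻¹ * ((g x).updateRow n (Pi.single m 1)).det := fun x => by
    rw [Matrix.inv_def, Matrix.smul_apply, Ring.inverse_eq_inv', Matrix.adjugate_apply, smul_eq_mul]
  simp only [e]
  refine ContDiff.mul ((hdet g bg.smooth_g).inv fun x => (bg.posDef x).det_pos.ne') (hdet _ ?_)
  intro i j
  by_cases h : i = n
  · subst h
    simpa [Matrix.updateRow_self] using contDiff_const
  · simpa [Matrix.updateRow_ne h] using bg.smooth_g i j

/-- Inverts `∂h/∂p = -2 g (p - A)`. A factor `p - A` beside a function of `h` can thus be read as a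
momentum derivative. -/
theorem momentum_eq (z : Phase d) (m : Fin d) : z.2 m - A z.1 m =
    -(1 / 2) * ∑ n, (g z.1)⁻¹ m n *
      fderiv ℝ (quadraticHamiltonian D g A) z (0, Pi.single n 1) := by
  have e1 : ∀ n, fderiv ℝ (quadraticHamiltonian D g A) z (0, Pi.single n 1) =
      -2 * (g z.1).mulVec (z.2 - A z.1) n := fun n => by
    rw [fderiv_quadraticHamiltonian bg]
    simp only [Pi.single_apply, mul_ite, mul_one, mul_zero, Finset.sum_ite_eq', Finset.mem_univ,
      if_true, Matrix.mulVec, dotProduct, Pi.sub_apply]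
    rw [neg_mul]
    congr 2
    exact Finset.sum_congr rfl fun k _ => by rw [metric_symm bg z.1 k n]
  have hu : IsUnit (g z.1).det := (bg.posDef z.1).det_pos.ne'.isUnit
  have e2 : (g z.1)⁻¹.mulVec ((g z.1).mulVec (z.2 - A z.1)) = z.2 - A z.1 := by
    rw [Matrix.mulVec_mulVec, Matrix.nonsing_inv_mul _ hu, Matrix.one_mulVec]
  have e3 := congrFun e2 m
  simp only [Pi.sub_apply] at e3
  rw [← e3, Matrix.mulVec, dotProduct, Finset.mul_sum]
  refine Finset.sum_congr rfl fun n _ => ?_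
  rw [e1]
  ring

end Quadratic

/-! ## Powers of the positive part -/

/-- `u₊ ^ k`. -/
def posPow (k : ℕ) (u : ℝ) : ℝ := max u 0 ^ k

theorem continuous_posPow (k : ℕ) : Continuous (posPow k) :=
  (continuous_id.max continuous_const).pow k

theorem posPow_nonneg (k : ℕ) (u : ℝ) : 0 ≤ posPow k u := pow_nonneg (le_max_right _ _) k

theorem mul_posPow (k : ℕ) (u : ℝ) : u * posPow (k + 1) u = posPow (k + 2) u := by
  rcases le_total u 0 with h | h
  · simp [posPow, h]
  · simp only [posPow, max_eq_left h]; ring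

/-- The exponent `k + 2` leaves a continuous derivative, so the value at the kink follows from the
derivatives at nearby points. -/
theorem hasDerivAt_posPow (k : ℕ) (u : ℝ) :
    HasDerivAt (posPow (k + 2)) ((k + 2) * posPow (k + 1) u) u := by
  have h0 : ∀ y : ℝ, y ≠ 0 → HasDerivAt (posPow (k + 2)) ((k + 2) * posPow (k + 1) y) y :=
    fun y hy => by
      rcases lt_or_gt_of_ne hy with h | h
      · have e : posPow (k + 2) =ᶠ[𝓝 y] fun _ => 0 := by
          filter_upwards [gt_mem_nhds h] with t ht
          simp [posPow, ht.le]
        simpa [posPow, h.le] using (hasDerivAt_const y (0 : ℝ)).congr_of_eventuallyEq e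
      · have e : posPow (k + 2) =ᶠ[𝓝 y] fun t => t ^ (k + 2) := by
          filter_upwards [lt_mem_nhds h] with t ht
          simp [posPow, le_of_lt ht]
        have := (hasDerivAt_pow (k + 2) y).congr_of_eventuallyEq e
        simpa [posPow, h.le] using this
  by_cases hu : u = 0
  · subst hu
    exact hasDerivAt_of_hasDerivAt_of_ne h0 (continuous_posPow _).continuousAt
      (continuous_const.mul (continuous_posPow _)).continuousAt
  · exact h0 u hu

theorem contDiff_posPow (k : ℕ) : ContDiff ℝ 1 (posPow (k + 2)) := by
  rw [contDiff_one_iff_deriv]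
  refine ⟨fun u => (hasDerivAt_posPow k u).differentiableAt, ?_⟩
  have : deriv (posPow (k + 2)) = fun u => (k + 2) * posPow (k + 1) u :=
    funext fun u => (hasDerivAt_posPow k u).deriv
  rw [this]
  exact continuous_const.mul (continuous_posPow _)

/-! ## Functions with bounded derivatives -/

/-- A bounded derivative makes `F` Lipschitz on `(0, 1)`, so it carries the Cauchy filter `𝓝[>] 0`
to a Cauchy filter. -/
theorem exists_tendsto_of_deriv_bound {F : ℝ → ℂ} {C : ℝ}
    (hF : ∀ s ∈ Set.Ioo (0 : ℝ) 1, DifferentiableAt ℝ F s)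
    (hC : ∀ s ∈ Set.Ioo (0 : ℝ) 1, ‖deriv F s‖ ≤ C) : ∃ v, Tendsto F (𝓝[>] 0) (𝓝 v) := by
  have hL := (convex_Ioo (0 : ℝ) 1).lipschitzOnWith_of_nnnorm_deriv_le (C := C.toNNReal) hF
    fun s hs => by
      rw [← NNReal.coe_le_coe, coe_nnnorm]
      exact (hC s hs).trans (Real.le_coe_toNNReal C)
  have hc : Cauchy (𝓝[>] (0 : ℝ)) := (cauchy_nhds (a := (0 : ℝ))).mono inf_le_left
  have hm : Cauchy (map F (𝓝[>] 0)) := hc.map_of_le hL.uniformContinuousOn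
    (le_principal_iff.2 (Ioo_mem_nhdsGT one_pos))
  exact CompleteSpace.complete hm

/-- A family of functions on an open set that is closed under differentiation, up to linear
combinations, and consists of bounded functions, has bounded derivatives of all orders. -/
theorem contDiffOn_and_bound_of_closed_family {ι : Type*} {F : ι → ℝ → ℂ} {U : Set ℝ}
    (hU : IsOpen U) (hF : ∀ i, ∃ C, ∀ s ∈ U, ‖F i s‖ ≤ C)
    (hd : ∀ i, ∃ a b : ℂ, ∃ j k, ∀ s ∈ U, HasDerivAt (F i) (a * F j s + b * F k s) s) (n : ℕ) :
    ∀ i, ContDiffOn ℝ n (F i) U ∧ ∃ C, ∀ s ∈ U, ‖iteratedDeriv n (F i) s‖ ≤ C := by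
  induction n with
  | zero =>
    refine fun i => ⟨?_, by simpa using hF i⟩
    obtain ⟨a, b, j, k, h⟩ := hd i
    rw [Nat.cast_zero, contDiffOn_zero]
    exact fun s hs => (h s hs).continuousAt.continuousWithinAt
  | succ n ih =>
    intro i
    obtain ⟨a, b, j, k, h⟩ := hd i
    have hde : Set.EqOn (deriv (F i)) (fun s => a * F j s + b * F k s) U := fun s hs => (h s hs).deriv
    have hcd : ContDiffOn ℝ n (fun s => a * F j s + b * F k s) U :=
      (contDiffOn_const.mul (ih j).1).add (contDiffOn_const.mul (ih k).1)
    refine ⟨?_, ?_⟩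
    · push_cast
      rw [contDiffOn_succ_iff_deriv_of_isOpen hU]
      exact ⟨fun s hs => (h s hs).differentiableAt.differentiableWithinAt, by simp, hcd.congr hde⟩
    · obtain ⟨C₁, h₁⟩ := (ih j).2
      obtain ⟨C₂, h₂⟩ := (ih k).2
      refine ⟨‖a‖ * C₁ + ‖b‖ * C₂, fun s hs => ?_⟩
      have e : deriv (F i) =ᶠ[𝓝 s] fun s => a * F j s + b * F k s := by
        filter_upwards [hU.mem_nhds hs] with t ht using hde ht
      have cj : ContDiffAt ℝ n (F j) s := (ih j).1.contDiffAt (hU.mem_nhds hs)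
      have ck : ContDiffAt ℝ n (F k) s := (ih k).1.contDiffAt (hU.mem_nhds hs)
      rw [iteratedDeriv_succ', e.iteratedDeriv_eq,
        iteratedDeriv_fun_add (contDiffAt_const.mul cj) (contDiffAt_const.mul ck),
        iteratedDeriv_const_mul_field, iteratedDeriv_const_mul_field]
      refine (norm_add_le _ _).trans ?_
      rw [norm_mul, norm_mul]
      gcongr
      exacts [h₁ s hs, h₂ s hs]

/-! ## Differentiation under the integral sign -/

section Generic

variable {E : Type*} [NormedAddCommGroup E] [NormedSpace ℝ E] [MeasurableSpace E] [BorelSpace E]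
  (μ : Measure E) [IsFiniteMeasureOnCompacts μ] {K : Set E}

theorem hasDerivAt_integral_mul_test (hK : IsCompact K) {f : E → ℂ} (hf : IsTestOn K f)
    {G G' : ℝ → E → ℝ} {U : Set ℝ} (hU : IsOpen U) (hG : ∀ s ∈ U, Continuous (G s))
    (hG' : ContinuousOn (Function.uncurry G') (U ×ˢ Set.univ))
    (hd : ∀ s ∈ U, ∀ z, HasDerivAt (fun s => G s z) (G' s z) s) {s : ℝ} (hs : s ∈ U) :
    HasDerivAt (fun s => ∫ z, (G s z : ℂ) * f z ∂μ) (∫ z, (G' s z : ℂ) * f z ∂μ) s := by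
  obtain ⟨ρ, hρ, hρU⟩ := Metric.nhds_basis_closedBall.mem_iff.1 (hU.mem_nhds hs)
  obtain ⟨M, hM⟩ := ((isCompact_closedBall s ρ).prod hK).exists_bound_of_continuousOn
    (hG'.mono (Set.prod_mono hρU (Set.subset_univ _)))
  have hfi := hf.integrable μ hK
  have hm : ∀ s ∈ U, AEStronglyMeasurable (fun z => (G s z : ℂ) * f z) μ := fun s hs =>
    ((Complex.continuous_ofReal.comp (hG s hs)).mul hf.contDiff.continuous).aestronglyMeasurable
  have hc' : Continuous (G' s) := by
    rw [← continuousOn_univ]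
    exact hG'.comp (f := fun z => (s, z)) (by fun_prop) fun z hz => ⟨hs, hz⟩
  refine (hasDerivAt_integral_of_dominated_loc_of_deriv_le (s := Metric.closedBall s ρ)
    (F := fun s z => (G s z : ℂ) * f z) (F' := fun s z => (G' s z : ℂ) * f z)
    (bound := fun z => M * ‖f z‖) (Metric.closedBall_mem_nhds s hρ) ?_ ?_ ?_ ?_
    (hfi.norm.const_mul _) ?_).2
  · filter_upwards [hU.mem_nhds hs] with t ht using hm t ht
  · exact ((Complex.continuous_ofReal.comp (hG s hs)).mul
      hf.contDiff.continuous).integrable_of_hasCompactSupport (hf.hasCompactSupport hK).mul_left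
  · exact ((Complex.continuous_ofReal.comp hc').mul
      hf.contDiff.continuous).aestronglyMeasurable
  · refine Eventually.of_forall fun z t ht => ?_
    by_cases hz : z ∈ K
    · rw [norm_mul, Complex.norm_real]
      gcongr
      exact hM (t, z) ⟨ht, hz⟩
    · simp [hf.eq_zero hz]
  · exact Eventually.of_forall fun z t ht => (hd t (hρU ht) z).ofReal_comp.mul_const (f z)

theorem integral_indicator_pos (u a b : ℝ) :
    ∫ s in a..b, (if 0 < u + s then 1 else 0 : ℝ) = posPow 1 (u + b) - posPow 1 (u + a) := by
  refine MeasureTheory.integral_eq_of_hasDerivAt_off_countable (fun s => posPow 1 (u + s)) _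
    (Set.countable_singleton (-u))
    ((continuous_posPow 1).comp (continuous_const.add continuous_id)).continuousOn
    (fun s hs => ?_) ?_
  · have hne : u + s ≠ 0 := fun h => hs.2 (by simp; linarith)
    have hc : Tendsto (fun t => u + t) (𝓝 s) (𝓝 (u + s)) :=
      (continuous_const.add continuous_id).tendsto s
    rcases lt_or_gt_of_ne hne with h | h
    · have e : (fun t => posPow 1 (u + t)) =ᶠ[𝓝 s] fun _ => 0 := by
        filter_upwards [hc.eventually (gt_mem_nhds h)] with t ht
        simp [posPow, le_of_lt ht]
      rw [if_neg h.not_gt]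
      exact (hasDerivAt_const s (0 : ℝ)).congr_of_eventuallyEq e
    · have e : (fun t => posPow 1 (u + t)) =ᶠ[𝓝 s] fun t => u + t := by
        filter_upwards [hc.eventually (lt_mem_nhds h)] with t ht
        simp [posPow, le_of_lt ht]
      rw [if_pos h]
      exact ((hasDerivAt_id s).const_add u).congr_of_eventuallyEq e
  · rw [intervalIntegrable_iff]
    refine Measure.integrableOn_of_bounded (M := 1) (by simp [Set.uIoc]) ?_
      (Eventually.of_forall fun s => by split_ifs <;> simp)
    exact (Measurable.ite (measurableSet_lt measurable_const (by fun_prop)) measurable_const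
      measurable_const).aestronglyMeasurable

variable [SFinite μ]

omit [NormedSpace ℝ E] [IsFiniteMeasureOnCompacts μ] in
-- Fubini, since `(u + s)₊` is a primitive of `θ(u + s)` in `s`.
theorem integral_superlevelIntegral {h : E → ℝ} (hh : Continuous h) {f : E → ℂ}
    (hf : Integrable f μ) (hfm : Measurable f) (a b : ℝ) :
    ∫ s in a..b, superlevelIntegral μ h f s =
      ∫ z, ((posPow 1 (h z + b) - posPow 1 (h z + a) : ℝ) : ℂ) * f z ∂μ := by
  wlog hab : a ≤ b generalizing a b
  · rw [intervalIntegral.integral_symm, this b a (le_of_not_ge hab), ← integral_neg]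
    congr 1
    funext z
    push_cast
    ring
  have e1 : ∀ s, superlevelIntegral μ h f s =
      ∫ z, ((if 0 < h z + s then 1 else 0 : ℝ) : ℂ) * f z ∂μ := fun s => by
    have hm : MeasurableSet {z | 0 < h z + s} :=
      (isOpen_lt continuous_const (hh.add continuous_const)).measurableSet
    rw [superlevelIntegral, ← integral_indicator hm]
    congr 1
    funext z
    by_cases h0 : 0 < h z + s <;> simp [h0]
  simp only [e1]
  have hmeas : Measurable fun q : ℝ × E =>
      ((if 0 < h q.2 + q.1 then 1 else 0 : ℝ) : ℂ) * f q.2 := by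
    refine Measurable.mul (Complex.measurable_ofReal.comp (Measurable.ite ?_ measurable_const
      measurable_const)) (hfm.comp measurable_snd)
    exact measurableSet_lt measurable_const
      ((hh.measurable.comp measurable_snd).add measurable_fst)
  have hint : Integrable (fun q : ℝ × E =>
      ((if 0 < h q.2 + q.1 then 1 else 0 : ℝ) : ℂ) * f q.2)
      ((volume.restrict (Set.Ioc a b)).prod μ) := by
    refine (hf.comp_snd (volume.restrict (Set.Ioc a b))).mono hmeas.aestronglyMeasurable
      (Eventually.of_forall fun q => ?_)
    by_cases h0 : 0 < h q.2 + q.1 <;> simp [h0]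
  rw [intervalIntegral.integral_of_le hab, integral_integral_swap hint]
  congr 1
  funext z
  rw [integral_mul_const, ← integral_indicator_pos, intervalIntegral.integral_of_le hab,
    ← integral_complex_ofReal]

/-- The positive part has a kink, so the derivative is not taken under the integral. The left side
is a primitive of the superlevel integral, whose continuity on `U` is assumed. -/
theorem hasDerivAt_integral_posPart {h : E → ℝ} (hh : Continuous h) (hK : IsCompact K) {f : E → ℂ}
    (hf : IsTestOn K f) {U : Set ℝ} (hU : IsOpen U)
    (hc : ContinuousOn (superlevelIntegral μ h f) U) {s : ℝ} (hs : s ∈ U) :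
    HasDerivAt (fun s => ∫ z, (posPow 1 (h z + s) : ℂ) * f z ∂μ) (superlevelIntegral μ h f s) s := by
  have hi : ∀ t, Integrable (fun z => (posPow 1 (h z + t) : ℂ) * f z) μ := fun t =>
    ((Complex.continuous_ofReal.comp ((continuous_posPow 1).comp (hh.add continuous_const))).mul
      hf.contDiff.continuous).integrable_of_hasCompactSupport (hf.hasCompactSupport hK).mul_left
  have e : (fun t => ∫ z, (posPow 1 (h z + t) : ℂ) * f z ∂μ) = fun t =>
      (∫ z, (posPow 1 (h z + s) : ℂ) * f z ∂μ) + ∫ u in s..t, superlevelIntegral μ h f u := by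
    funext t
    rw [integral_superlevelIntegral μ hh (hf.integrable μ hK) hf.contDiff.continuous.measurable,
      ← integral_add (hi s)]
    · congr 1
      funext z
      push_cast
      ring
    · refine ((hi t).sub (hi s)).congr (Eventually.of_forall fun z => ?_)
      simp only [Pi.sub_apply]
      push_cast
      ring
  rw [e]
  exact (intervalIntegral.integral_hasDerivAt_right IntervalIntegrable.refl
    (hc.stronglyMeasurableAtFilter hU s hs) (hc.continuousAt (hU.mem_nhds hs))).const_add _

end Generic

/-! ## Moments of quadratic Hamiltonians -/

theorem IsTestOn.integrable_mul {K : Set (Phase d)} (hK : IsCompact K) {f : Phase d → ℂ}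
    (hf : IsTestOn K f) {φ : Phase d → ℂ} (hφ : Continuous φ) :
    Integrable (fun z => φ z * f z) :=
  (hφ.mul hf.contDiff.continuous).integrable_of_hasCompactSupport
    (hf.hasCompactSupport hK).mul_left

theorem fderiv_fst_mul {c : (Fin d → ℝ) → ℂ} (hc : Differentiable ℝ c) {f : Phase d → ℂ}
    (hf : Differentiable ℝ f) (z : Phase d) (v : Fin d → ℝ) :
    fderiv ℝ (fun z => c z.1 * f z) z (0, v) = c z.1 * fderiv ℝ f z (0, v) := by
  have h1 : HasFDerivAt (fun z : Phase d => c z.1)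
      ((fderiv ℝ c z.1).comp (ContinuousLinearMap.fst ℝ _ _)) z :=
    (hc z.1).hasFDerivAt.comp z hasFDerivAt_fst
  rw [(h1.fun_mul (hf z).hasFDerivAt).fderiv]
  simp

section Quadratic

variable {D : (Fin d → ℝ) → ℝ} {g : (Fin d → ℝ) → Matrix (Fin d) (Fin d) ℝ}
  {A : (Fin d → ℝ) → Fin d → ℝ}

/-- The Laplacian `∂_{p_n} g_{nm} ∂_{p_m}` in momenta of the inverse metric. -/
def momentumLaplacian (g : (Fin d → ℝ) → Matrix (Fin d) (Fin d) ℝ) (f : Phase d → ℂ)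
    (z : Phase d) : ℂ :=
  ∑ m, ∑ n, fderiv ℝ (fun z => (((g z.1)⁻¹ m n : ℝ) : ℂ) * fderiv ℝ f z (0, Pi.single m 1)) z
    (0, Pi.single n 1)

/-- `∫ (D + s)^{-j} (h + s)₊ ^ (k + 2) f`. -/
def radialMoment (D : (Fin d → ℝ) → ℝ) (h : Phase d → ℝ) (j k : ℕ) (f : Phase d → ℂ) (s : ℝ) : ℂ :=
  ∫ z, (((D z.1 + s)⁻¹ ^ j * posPow (k + 2) (h z + s) : ℝ) : ℂ) * f z

theorem fderiv_posPow_comp {h : Phase d → ℝ} (hh : ContDiff ℝ (⊤ : ℕ∞) h) (k : ℕ) (s : ℝ)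
    (z v : Phase d) : fderiv ℝ (fun z => (posPow (k + 2) (h z + s) : ℂ)) z v =
      (((k + 2) * posPow (k + 1) (h z + s) * fderiv ℝ h z v : ℝ) : ℂ) := by
  have h1 : HasFDerivAt (fun z => h z + s) (fderiv ℝ h z) z :=
    (hh.differentiable (by simp) z).hasFDerivAt.add_const s
  have h2 := Complex.ofRealCLM.hasFDerivAt.comp z
    ((hasDerivAt_posPow k (h z + s)).comp_hasFDerivAt z h1)
  have h3 : fderiv ℝ (fun z => (posPow (k + 2) (h z + s) : ℂ)) z = _ := h2.fderiv
  rw [h3]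
  simp

theorem contDiff_posPow_comp {h : Phase d → ℝ} (hh : ContDiff ℝ (⊤ : ℕ∞) h) (k : ℕ) (s : ℝ) :
    ContDiff ℝ 1 (fun z => (posPow (k + 2) (h z + s) : ℂ)) :=
  Complex.ofRealCLM.contDiff.comp ((contDiff_posPow k).comp
    ((hh.of_le (by exact_mod_cast le_top)).add contDiff_const))

variable (bg : IsEuclideanBackground D g A)
include bg

theorem contDiff_metric_inv_ofReal (m n : Fin d) :
    ContDiff ℝ (⊤ : ℕ∞) (fun x => (((g x)⁻¹ m n : ℝ) : ℂ)) :=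
  Complex.ofRealCLM.contDiff.comp (contDiff_metric_inv bg m n)

theorem isTestOn_metric_inv_mul {K : Set (Phase d)} {f : Phase d → ℂ} (hf : IsTestOn K f)
    (m n : Fin d) :
    IsTestOn K (fun z => (((g z.1)⁻¹ m n : ℝ) : ℂ) * fderiv ℝ f z (0, Pi.single m 1)) :=
  (hf.fderiv_apply _).mul_left ((contDiff_metric_inv_ofReal bg m n).comp contDiff_fst)

theorem isTestOn_momentumLaplacian {K : Set (Phase d)} {f : Phase d → ℂ} (hf : IsTestOn K f) :
    IsTestOn K (momentumLaplacian g f) :=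
  IsTestOn.sum _ fun m _ => IsTestOn.sum _ fun n _ =>
    (isTestOn_metric_inv_mul bg hf m n).fderiv_apply _

theorem momentumLaplacian_fst_mul {c : (Fin d → ℝ) → ℂ} (hc : ContDiff ℝ (⊤ : ℕ∞) c)
    {f : Phase d → ℂ} (hf : ContDiff ℝ (⊤ : ℕ∞) f) (z : Phase d) :
    momentumLaplacian g (fun z => c z.1 * f z) z = c z.1 * momentumLaplacian g f z := by
  have hcd := hc.differentiable (by simp)
  simp only [momentumLaplacian, fderiv_fst_mul hcd (hf.differentiable (by simp)), Finset.mul_sum]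
  refine Finset.sum_congr rfl fun m _ => Finset.sum_congr rfl fun n _ => ?_
  rw [← fderiv_fst_mul hcd]
  · congr 2
    funext y
    ring
  · exact ((((contDiff_metric_inv_ofReal bg m n).comp contDiff_fst).mul
      (contDiff_fderiv_apply hf _)).differentiable (by simp))

/-- A single integration by parts in `p_n` produces `g⁻¹ ∂h/∂p`, which `momentum_eq` turns into `-2
(p - A)`; what remains is the radial derivative of `f`. -/
theorem integral_posPow_mul_momentumLaplacian {K : Set (Phase d)} (hK : IsCompact K)
    {f : Phase d → ℂ} (hf : IsTestOn K f) (k : ℕ) (s : ℝ) :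
    ∫ z, (posPow (k + 3) (quadraticHamiltonian D g A z + s) : ℂ) * momentumLaplacian g f z =
      2 * (k + 3) * ∑ m, ∫ z, (posPow (k + 2) (quadraticHamiltonian D g A z + s) : ℂ) *
        (((z.2 m - A z.1 m : ℝ) : ℂ) * fderiv ℝ f z (0, Pi.single m 1)) := by
  have hh := contDiff_quadraticHamiltonian bg
  have hW := contDiff_posPow_comp hh (k + 1) s
  have hF := fun m n => isTestOn_metric_inv_mul bg hf m n
  simp only [momentumLaplacian, Finset.mul_sum]
  rw [integral_finsetSum _ fun m _ => integrable_finsetSum _ fun n _ =>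
    ((hF m n).fderiv_apply _).integrable_mul hK hW.continuous]
  refine Finset.sum_congr rfl fun m _ => ?_
  rw [integral_finsetSum _ fun n _ =>
    ((hF m n).fderiv_apply _).integrable_mul hK hW.continuous]
  have hc : ∀ n : Fin d, Continuous (fun z => fderiv ℝ
      (fun z => (posPow (k + 1 + 2) (quadraticHamiltonian D g A z + s) : ℂ)) z
        (0, Pi.single n 1)) := fun n =>
    (hW.continuous_fderiv one_ne_zero).clm_apply continuous_const
  have e : ∀ n : Fin d, ∫ z, (posPow (k + 1 + 2) (quadraticHamiltonian D g A z + s) : ℂ) *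
      fderiv ℝ (fun z => (((g z.1)⁻¹ m n : ℝ) : ℂ) * fderiv ℝ f z (0, Pi.single m 1)) z
        (0, Pi.single n 1) = _ := fun n =>
    integral_mul_fderiv_eq_neg volume hK hW (hF m n) (0, Pi.single n 1)
  rw [Finset.sum_congr rfl fun n _ => e n, Finset.sum_neg_distrib,
    ← integral_finsetSum _ fun n _ => (hF m n).integrable_mul hK (hc n), ← integral_neg,
    ← integral_const_mul]
  congr 1
  funext z
  rw [momentum_eq bg z m, Complex.ofReal_mul, Complex.ofReal_sum]
  simp only [Finset.sum_mul, Finset.mul_sum, ← Finset.sum_neg_distrib]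
  refine Finset.sum_congr rfl fun n _ => ?_
  rw [fderiv_posPow_comp hh]
  push_cast
  ring

/-- Integration by parts along the momentum directions. -/
theorem moment_identity {K : Set (Phase d)} (hK : IsCompact K) {f : Phase d → ℂ}
    (hf : IsTestOn K f) (k : ℕ) (s : ℝ) :
    (k + 2) * ∫ z, (((D z.1 + s) * posPow (k + 1) (quadraticHamiltonian D g A z + s) : ℝ) : ℂ) *
        f z =
      (k + 2 + d / 2) * (∫ z, (posPow (k + 2) (quadraticHamiltonian D g A z + s) : ℂ) * f z) +
      1 / (4 * (k + 3)) * ∫ z, (posPow (k + 3) (quadraticHamiltonian D g A z + s) : ℂ) *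
        momentumLaplacian g f z := by
  have hh := contDiff_quadraticHamiltonian bg
  have hW := contDiff_posPow_comp hh k s
  have hq : ∀ m, ContDiff ℝ (⊤ : ℕ∞) (fun z : Phase d => ((z.2 m - A z.1 m : ℝ) : ℂ)) := fun m =>
    Complex.ofRealCLM.contDiff.comp (((contDiff_apply ℝ ℝ m).comp contDiff_snd).sub
      ((bg.smooth_A m).comp contDiff_fst))
  have hqf : ∀ m, IsTestOn K (fun z => ((z.2 m - A z.1 m : ℝ) : ℂ) * f z) := fun m =>
    hf.mul_left (hq m)
  have hqf' : ∀ m : Fin d, IsTestOn K (fun z => ((z.2 m - A z.1 m : ℝ) : ℂ) *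
      fderiv ℝ f z (0, Pi.single m 1)) := fun m => (hf.fderiv_apply _).mul_left (hq m)
  have e1 : ∀ (m : Fin d) (z : Phase d),
      fderiv ℝ (fun z => ((z.2 m - A z.1 m : ℝ) : ℂ) * f z) z (0, Pi.single m 1) =
        f z + ((z.2 m - A z.1 m : ℝ) : ℂ) * fderiv ℝ f z (0, Pi.single m 1) := fun m z => by
    have h1 : HasFDerivAt (fun z : Phase d => A z.1 m)
        ((fderiv ℝ (fun x => A x m) z.1).comp (ContinuousLinearMap.fst ℝ _ _)) z :=
      (((bg.smooth_A m).differentiable (by simp)) z.1).hasFDerivAt.comp z hasFDerivAt_fst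
    have h2 : HasFDerivAt (fun z : Phase d => z.2 m)
        ((ContinuousLinearMap.proj m).comp (ContinuousLinearMap.snd ℝ (Fin d → ℝ) (Fin d → ℝ))) z :=
      ((ContinuousLinearMap.proj (R := ℝ) (φ := fun _ : Fin d => ℝ) m).comp
        (ContinuousLinearMap.snd ℝ (Fin d → ℝ) (Fin d → ℝ))).hasFDerivAt
    have h3 := Complex.ofRealCLM.hasFDerivAt.comp z (h2.sub h1)
    have h4 := h3.mul (hf.contDiff.differentiable (by simp) z).hasFDerivAt
    have h5 : fderiv ℝ (fun z => ((z.2 m - A z.1 m : ℝ) : ℂ) * f z) z = _ := h4.fderiv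
    rw [h5]
    simp
    ring
  -- Integration by parts of `(p - A)_m f` along `p_m`. Summing over `m` counts `f` exactly `d`
  -- times, the source of `d / 2` in the result.
  have e2 : ∀ m : Fin d, ∫ z, (posPow (k + 2) (quadraticHamiltonian D g A z + s) : ℂ) * f z +
      (posPow (k + 2) (quadraticHamiltonian D g A z + s) : ℂ) *
        (((z.2 m - A z.1 m : ℝ) : ℂ) * fderiv ℝ f z (0, Pi.single m 1)) =
      -∫ z, fderiv ℝ (fun z => (posPow (k + 2) (quadraticHamiltonian D g A z + s) : ℂ)) z
        (0, Pi.single m 1) * (((z.2 m - A z.1 m : ℝ) : ℂ) * f z) := fun m => by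
    rw [← integral_mul_fderiv_eq_neg volume hK hW (hqf m) (0, Pi.single m 1)]
    congr 1
    funext z
    rw [e1]
    ring
  have i0 := hf.integrable_mul hK hW.continuous
  have i1 := fun m => (hqf' m).integrable_mul hK hW.continuous
  have hc : ∀ m : Fin d, Continuous (fun z => fderiv ℝ
      (fun z => (posPow (k + 2) (quadraticHamiltonian D g A z + s) : ℂ)) z
        (0, Pi.single m 1)) := fun m =>
    (hW.continuous_fderiv one_ne_zero).clm_apply continuous_const
  -- Euler's identity gives the radial derivative `2 (h - D) = 2 (h + s) - 2 (D + s)`; the first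
  -- part raises the power of `(h + s)₊` by one.
  have e3 : ∀ z : Phase d, ∑ m : Fin d, fderiv ℝ
      (fun z => (posPow (k + 2) (quadraticHamiltonian D g A z + s) : ℂ)) z (0, Pi.single m 1) *
        (((z.2 m - A z.1 m : ℝ) : ℂ) * f z) =
      (2 * (k + 2)) * ((posPow (k + 2) (quadraticHamiltonian D g A z + s) : ℂ) * f z) -
      (2 * (k + 2)) * ((((D z.1 + s) * posPow (k + 1) (quadraticHamiltonian D g A z + s) : ℝ) : ℂ) *
        f z) := fun z => by
    have h1 : ∑ m : Fin d, fderiv ℝ (quadraticHamiltonian D g A) z (0, Pi.single m 1) *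
        (z.2 m - A z.1 m) = 2 * (quadraticHamiltonian D g A z - D z.1) := by
      rw [← fderiv_quadraticHamiltonian_radial bg z]
      have : ((0, z.2 - A z.1) : Phase d) =
          ∑ m : Fin d, (z.2 m - A z.1 m) • ((0, Pi.single m 1) : Phase d) := by
        refine Prod.ext (by simp [Prod.fst_sum]) ?_
        ext i
        simp [Prod.snd_sum, Finset.sum_apply, Pi.single_apply]
      rw [this, map_sum]
      refine Finset.sum_congr rfl fun m _ => ?_
      rw [map_smul, smul_eq_mul, mul_comm]
    have h2 := mul_posPow k (quadraticHamiltonian D g A z + s)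
    calc _ = ((k + 2) * posPow (k + 1) (quadraticHamiltonian D g A z + s) : ℝ) *
          ((∑ m : Fin d, fderiv ℝ (quadraticHamiltonian D g A) z (0, Pi.single m 1) *
            (z.2 m - A z.1 m) : ℝ) : ℂ) * f z := by
          rw [Complex.ofReal_sum, Finset.mul_sum, Finset.sum_mul]
          refine Finset.sum_congr rfl fun m _ => ?_
          rw [fderiv_posPow_comp hh]
          push_cast
          ring
      _ = _ := by
          rw [h1, ← h2]
          push_cast
          ring
  have iD := hf.integrable_mul hK (φ := fun z => (((D z.1 + s) *
      posPow (k + 1) (quadraticHamiltonian D g A z + s) : ℝ) : ℂ))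
    (Complex.continuous_ofReal.comp (((bg.smooth_D.continuous.comp continuous_fst).add
      continuous_const).mul ((continuous_posPow _).comp (hh.continuous.add continuous_const))))
  have e4 := Finset.sum_congr (rfl : (Finset.univ : Finset (Fin d)) = _) fun m _ => e2 m
  rw [Finset.sum_neg_distrib, ← integral_finsetSum _ fun m _ => (hqf m).integrable_mul hK (hc m),
    Finset.sum_congr rfl fun m _ => integral_add i0 (i1 m), Finset.sum_add_distrib,
    Finset.sum_const, Finset.card_univ, Fintype.card_fin, nsmul_eq_mul] at e4
  simp only [e3] at e4
  rw [integral_sub (i0.const_mul _) (iD.const_mul _), integral_const_mul, integral_const_mul] at e4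
  -- The leftover radial derivative of `f` is traded for the Laplacian with a higher power of `(h +
  -- s)₊`.
  rw [integral_posPow_mul_momentumLaplacian bg hK hf k s]
  have hk : (k + 3 : ℂ) ≠ 0 := by exact_mod_cast (by omega : k + 3 ≠ 0)
  have e5 : ∀ S : ℂ, 1 / (4 * (k + 3)) * (2 * (k + 3) * S) = S / 2 := fun S => by
    field_simp
    ring
  rw [e5]
  linear_combination -e4 / 2

end Quadratic

/-! ### Recursion for the moments and boundary values as `s → 0⁺` -/

section Quadratic

variable {D : (Fin d → ℝ) → ℝ} {g : (Fin d → ℝ) → Matrix (Fin d) (Fin d) ℝ}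
  {A : (Fin d → ℝ) → Fin d → ℝ} (bg : IsEuclideanBackground D g A)
include bg

/-- Differentiation lowers the power of `(h + s)₊` in one term. `moment_identity`, applied to `(D +
s)^(-j-1) f`, restores it; the weight does not depend on momenta and passes through the Laplacian.
So the recursion can be iterated without ever reaching the kink. -/
theorem hasDerivAt_radialMoment {K : Set (Phase d)} (hK : IsCompact K) {f : Phase d → ℂ}
    (hf : IsTestOn K f) (j k : ℕ) {s : ℝ} (hs : 0 < s) :
    HasDerivAt (radialMoment D (quadraticHamiltonian D g A) j k f)
      ((k + 2 + d / 2 - j) * radialMoment D (quadraticHamiltonian D g A) (j + 1) k f s +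
        1 / (4 * (k + 3)) *
          radialMoment D (quadraticHamiltonian D g A) (j + 1) (k + 1) (momentumLaplacian g f) s) s := by
  have hh := contDiff_quadraticHamiltonian bg
  set h := quadraticHamiltonian D g A with hhdef
  have hpos : ∀ t ∈ Set.Ioi (0 : ℝ), ∀ z : Phase d, D z.1 + t ≠ 0 := fun t ht z =>
    (add_pos_of_nonneg_of_pos (bg.nonneg z.1) ht).ne'
  have hDc : Continuous fun z : Phase d => D z.1 := bg.smooth_D.continuous.comp continuous_fst
  have hDu : Continuous fun q : ℝ × Phase d => D q.2.1 + q.1 :=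
    (hDc.comp continuous_snd).add continuous_fst
  have hinv : ContinuousOn (fun q : ℝ × Phase d => (D q.2.1 + q.1)⁻¹) (Set.Ioi 0 ×ˢ Set.univ) :=
    hDu.continuousOn.inv₀ fun q hq => hpos q.1 hq.1 q.2
  have hpow : ∀ k, Continuous fun q : ℝ × Phase d => posPow k (h q.2 + q.1) := fun k =>
    (continuous_posPow k).comp ((hh.continuous.comp continuous_snd).add continuous_fst)
  have hG : ∀ (j k : ℕ), ∀ t ∈ Set.Ioi (0 : ℝ),
      Continuous fun z : Phase d => (D z.1 + t)⁻¹ ^ j * posPow k (h z + t) := fun j k t ht =>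
    (((hDc.add continuous_const).inv₀ (hpos t ht)).pow j).mul
      ((continuous_posPow k).comp (hh.continuous.add continuous_const))
  have key := hasDerivAt_integral_mul_test volume hK hf (U := Set.Ioi 0) isOpen_Ioi
    (G := fun t z => (D z.1 + t)⁻¹ ^ j * posPow (k + 2) (h z + t))
    (G' := fun t z => -j * ((D z.1 + t)⁻¹ ^ (j + 1) * posPow (k + 2) (h z + t)) +
      (k + 2) * ((D z.1 + t)⁻¹ ^ j * posPow (k + 1) (h z + t)))
    (hG j (k + 2))
    ((continuousOn_const.mul ((hinv.pow _).mul (hpow _).continuousOn)).add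
      (continuousOn_const.mul ((hinv.pow _).mul (hpow _).continuousOn)))
    (fun t ht z => by
      have h1 : HasDerivAt (fun t => D z.1 + t) 1 t := (hasDerivAt_id t).const_add _
      have h2 := (h1.inv (hpos t ht z)).pow j
      have h3 := (hasDerivAt_posPow k (h z + t)).comp t ((hasDerivAt_id t).const_add (h z))
      refine (h2.mul h3).congr_deriv ?_
      rcases j with _ | j
      · simp
      · have := hpos t ht z
        simp
        field_simp
        ring) hs
  refine key.congr_deriv ?_
  set c : (Fin d → ℝ) → ℂ := fun x => (((D x + s)⁻¹ ^ (j + 1) : ℝ) : ℂ) with hc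
  have hcs : ContDiff ℝ (⊤ : ℕ∞) c := Complex.ofRealCLM.contDiff.comp
    (((bg.smooth_D.add contDiff_const).inv fun x =>
      (add_pos_of_nonneg_of_pos (bg.nonneg x) hs).ne').pow _)
  have hcf : IsTestOn K (fun z => c z.1 * f z) := hf.mul_left (hcs.comp contDiff_fst)
  have mi := moment_identity bg hK hcf k s
  rw [← hhdef] at mi
  have m1 : radialMoment D h (j + 1) k f s =
      ∫ z, (posPow (k + 2) (h z + s) : ℂ) * (c z.1 * f z) := by
    rw [radialMoment]; congr 1; funext z; simp only [hc]; push_cast; ring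
  have m2 : radialMoment D h (j + 1) (k + 1) (momentumLaplacian g f) s =
      ∫ z, (posPow (k + 3) (h z + s) : ℂ) * momentumLaplacian g (fun z => c z.1 * f z) z := by
    rw [radialMoment]; congr 1; funext z
    rw [momentumLaplacian_fst_mul bg hcs hf.contDiff]
    simp only [hc]; push_cast; ring
  rw [← m1, ← m2] at mi
  have hi : ∀ j k, Integrable fun z => (((D z.1 + s)⁻¹ ^ j * posPow k (h z + s) : ℝ) : ℂ) * f z :=
    fun j k => hf.integrable_mul hK (Complex.continuous_ofReal.comp (hG j k s hs))
  have e : ∀ z, ((-j * ((D z.1 + s)⁻¹ ^ (j + 1) * posPow (k + 2) (h z + s)) +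
      (k + 2) * ((D z.1 + s)⁻¹ ^ j * posPow (k + 1) (h z + s)) : ℝ) : ℂ) * f z =
      -j * ((((D z.1 + s)⁻¹ ^ (j + 1) * posPow (k + 2) (h z + s) : ℝ) : ℂ) * f z) +
      (k + 2) * ((((D z.1 + s)⁻¹ ^ j * posPow (k + 1) (h z + s) : ℝ) : ℂ) * f z) := fun z => by
    push_cast
    ring
  simp only [e]
  rw [integral_add ((hi _ _).const_mul _) ((hi _ _).const_mul _), integral_const_mul, integral_const_mul]
  have m3 : ∫ z, (((D z.1 + s)⁻¹ ^ j * posPow (k + 1) (h z + s) : ℝ) : ℂ) * f z =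
      ∫ z, (((D z.1 + s) * posPow (k + 1) (h z + s) : ℝ) : ℂ) * (c z.1 * f z) := by
    congr 1; funext z
    rw [← mul_assoc, hc, ← Complex.ofReal_mul]
    congr 2
    rw [pow_succ]
    linear_combination -(D z.1 + s)⁻¹ ^ j * posPow (k + 1) (h z + s) * mul_inv_cancel₀ (hpos s hs z)
  rw [m3, mi, radialMoment]
  ring

/-- For fixed `x` the integrand lives on a momentum ball of radius `√((D + s)/c)`, where `(h + s)₊ ≤
D + s`. The momentum integral is thus of size `(D + s)^(k + 2 + d/2 - j)`, bounded for a nonnegative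
exponent. -/
theorem exists_radialMoment_bound {K : Set (Fin d → ℝ)} (hK : IsCompact K) {R : ℝ}
    {f : Phase d → ℂ} (hf : IsTestOn (K ×ˢ Metric.closedBall 0 R) f) {e : ℕ} (hd : d = e + e)
    {j k : ℕ} (hj : j ≤ k + 2 + e) :
    ∃ C, ∀ s ∈ Set.Ioo (0 : ℝ) 1,
      ‖radialMoment D (quadraticHamiltonian D g A) j k f s‖ ≤ C := by
  have hh := contDiff_quadraticHamiltonian bg
  have hKp : IsCompact (K ×ˢ Metric.closedBall (0 : Fin d → ℝ) R) :=
    hK.prod (isCompact_closedBall _ _)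
  obtain ⟨c, hc, hcK⟩ := exists_metricForm_bound bg hK
  obtain ⟨B, hB⟩ := hK.exists_bound_of_continuousOn bg.smooth_D.continuous.continuousOn
  obtain ⟨M, hM⟩ := hKp.exists_bound_of_continuousOn hf.contDiff.continuous.continuousOn
  have hM' : ∀ z, ‖f z‖ ≤ |M| := fun z => by
    by_cases hz : z ∈ K ×ˢ Metric.closedBall (0 : Fin d → ℝ) R
    · exact (hM z hz).trans (le_abs_self M)
    · simp [hf.eq_zero hz]
  set C : ℝ := |M| * (4 / c) ^ e * (|B| + 1) ^ (k + 2 + e - j)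
  refine ⟨(ENNReal.ofReal C * volume K).toReal, fun s hs => ?_⟩
  have hDpos : ∀ x, 0 < D x + s := fun x => add_pos_of_nonneg_of_pos (bg.nonneg x) hs.1
  set F : Phase d → ℂ := fun z =>
    (((D z.1 + s)⁻¹ ^ j * posPow (k + 2) (quadraticHamiltonian D g A z + s) : ℝ) : ℂ) * f z with hF
  have hFc : Continuous F := by
    refine (Complex.continuous_ofReal.comp (((((bg.smooth_D.continuous.comp
      continuous_fst).add continuous_const).inv₀ fun z => (hDpos z.1).ne').pow j).mul
      ((continuous_posPow _).comp (hh.continuous.add continuous_const)))).mul hf.contDiff.continuous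
  have hin : ∀ x, ∫⁻ p, ‖F (x, p)‖ₑ ≤ K.indicator (fun _ => ENNReal.ofReal C) x := fun x => by
    by_cases hx : x ∈ K
    · rw [Set.indicator_of_mem hx]
      set t := D x + s with ht
      have ht0 : 0 < t := hDpos x
      set r := √(t / c)
      have hr0 : 0 ≤ r := Real.sqrt_nonneg _
      have hr2 : r ^ 2 = t / c := Real.sq_sqrt (div_pos ht0 hc).le
      have hFx : ∀ p, ‖F (x, p)‖ₑ ≤ (Metric.closedBall (A x) r).indicator
          (fun _ => ENNReal.ofReal (t⁻¹ ^ j * t ^ (k + 2) * |M|)) p := fun p => by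
        have hq := hcK x hx (p - A x)
        have hle : quadraticHamiltonian D g A (x, p) + s ≤ t - c * ‖p - A x‖ ^ 2 := by
          rw [quadraticHamiltonian_eq]
          simp only [ht]
          linarith
        by_cases hp : p ∈ Metric.closedBall (A x) r
        · rw [Set.indicator_of_mem hp, ← ofReal_norm]
          refine ENNReal.ofReal_le_ofReal ?_
          rw [hF, norm_mul, Complex.norm_real, norm_mul, Real.norm_eq_abs, Real.norm_eq_abs,
            abs_of_nonneg (posPow_nonneg _ _), abs_of_nonneg (pow_nonneg (inv_nonneg.2 ht0.le) j)]
          gcongr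
          · refine pow_le_pow_left₀ (le_max_right _ _) (max_le (hle.trans ?_) ht0.le) _
            have := mul_nonneg hc.le (sq_nonneg ‖p - A x‖)
            linarith
          · exact hM' _
        · have h1 : r < ‖p - A x‖ := by
            rw [Metric.mem_closedBall, not_le, dist_eq_norm] at hp
            exact hp
          have h2 : t < c * ‖p - A x‖ ^ 2 := by
            have := pow_lt_pow_left₀ h1 hr0 two_ne_zero
            rw [hr2, div_lt_iff₀ hc] at this
            linarith
          have h3 : posPow (k + 2) (quadraticHamiltonian D g A (x, p) + s) = 0 := by
            rw [posPow, max_eq_right (by linarith), zero_pow (by omega)]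
          simp [hF, h3]
      refine (lintegral_mono hFx).trans ?_
      rw [lintegral_indicator_const Metric.isClosed_closedBall.measurableSet,
        Real.volume_pi_closedBall _ hr0, Fintype.card_fin, ← ENNReal.ofReal_mul (by positivity)]
      refine ENNReal.ofReal_le_ofReal ?_
      -- The norm is the sup norm, so the ball is a cube of side `2r`; evenness of `d` removes the
      -- square root.
      have e1 : (2 * r) ^ d = (4 / c) ^ e * t ^ e := by
        rw [hd, ← two_mul, pow_mul, mul_pow, hr2, ← mul_pow]
        congr 1
        ring
      have e2 : t⁻¹ ^ j * t ^ (k + 2) * t ^ e = t ^ (k + 2 + e - j) := by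
        rw [inv_pow, mul_assoc, ← pow_add, pow_sub₀ _ ht0.ne' hj, mul_comm]
      calc t⁻¹ ^ j * t ^ (k + 2) * |M| * (2 * r) ^ d =
          |M| * (4 / c) ^ e * (t⁻¹ ^ j * t ^ (k + 2) * t ^ e) := by rw [e1]; ring
        _ = |M| * (4 / c) ^ e * t ^ (k + 2 + e - j) := by rw [e2]
        _ ≤ C := by
          have : t ≤ |B| + 1 := add_le_add
            ((le_abs_self _).trans ((hB x hx).trans (le_abs_self B))) hs.2.le
          simp only [C]
          gcongr
    · rw [Set.indicator_of_notMem hx]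
      have : ∀ p, F (x, p) = 0 := fun p => by
        simp [hF, hf.eq_zero (fun h : (x, p) ∈ _ => hx h.1)]
      simp [this]
  have hfin : ENNReal.ofReal C * volume K ≠ ⊤ :=
    ENNReal.mul_ne_top ENNReal.ofReal_ne_top hK.measure_lt_top.ne
  have hle : ‖∫ z, F z‖ₑ ≤ ENNReal.ofReal C * volume K :=
    calc ‖∫ z, F z‖ₑ ≤ ∫⁻ z, ‖F z‖ₑ := enorm_integral_le_lintegral_enorm _
      _ = ∫⁻ x, ∫⁻ p, ‖F (x, p)‖ₑ := by
        rw [Measure.volume_eq_prod, lintegral_prod _ hFc.enorm.measurable.aemeasurable]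
      _ ≤ ∫⁻ x, K.indicator (fun _ => ENNReal.ofReal C) x := lintegral_mono hin
      _ = _ := lintegral_indicator_const hK.measurableSet _
  have := ENNReal.toReal_mono hfin hle
  rwa [toReal_enorm] at this

/-- The indices with `j ≤ k + 2 + e` form a family of bounded moments closed under differentiation,
and this is where parity matters: the coefficient of the term that would leave the family is `k + 2
+ d/2 - j`, zero exactly on its edge. -/
theorem radialMoment_bounded_derivatives {K : Set (Fin d → ℝ)} (hK : IsCompact K) {R : ℝ}
    {f : Phase d → ℂ} (hf : IsTestOn (K ×ˢ Metric.closedBall 0 R) f) (hd : Even d) (n : ℕ) :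
    ∃ C, ∀ s ∈ Set.Ioo (0 : ℝ) 1,
      ‖iteratedDeriv n (radialMoment D (quadraticHamiltonian D g A) 0 0 f) s‖ ≤ C := by
  obtain ⟨e, he⟩ := hd
  have hKp : IsCompact (K ×ˢ Metric.closedBall (0 : Fin d → ℝ) R) :=
    hK.prod (isCompact_closedBall _ _)
  let ι := {i : ℕ × ℕ × (Phase d → ℂ) // i.1 ≤ i.2.1 + 2 + e ∧
    IsTestOn (K ×ˢ Metric.closedBall 0 R) i.2.2}
  refine (contDiffOn_and_bound_of_closed_family (ι := ι) (U := Set.Ioo 0 1)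
    (F := fun i => radialMoment D (quadraticHamiltonian D g A) i.1.1 i.1.2.1 i.1.2.2)
    isOpen_Ioo (fun i => exists_radialMoment_bound bg hK i.2.2 he i.2.1) ?_ n
    ⟨(0, 0, f), by simp, hf⟩).2
  rintro ⟨⟨j, k, f⟩, hj, hf⟩
  simp only at hj hf
  have hL := isTestOn_momentumLaplacian bg hf
  have hde : ((d : ℂ) / 2) = e := by rw [he]; push_cast; ring
  have hD := fun s (hs : s ∈ Set.Ioo (0 : ℝ) 1) => hasDerivAt_radialMoment bg hKp hf j k hs.1
  simp only [hde] at hD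
  have hL' : j + 1 ≤ k + 1 + 2 + e := by omega
  rcases hj.lt_or_eq with h | h
  · exact ⟨_, _, ⟨(j + 1, k, f), by simp; omega, hf⟩,
      ⟨(j + 1, k + 1, momentumLaplacian g f), hL', hL⟩, hD⟩
  · refine ⟨0, 1 / (4 * (k + 3)), ⟨(j, k, f), hj, hf⟩,
      ⟨(j + 1, k + 1, momentumLaplacian g f), hL', hL⟩, fun s hs => (hD s hs).congr_deriv ?_⟩
    have h0 : (k : ℂ) + 2 + e - j = 0 := by rw [h]; push_cast; ring
    rw [h0, zero_mul, zero_mul]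

theorem exists_transport_quadratic {K : Set (Phase d)} (hK : IsCompact K) {s : ℝ} (hs : 0 < s) :
    ∃ ε > 0, ∃ T, IsTransport volume (quadraticHamiltonian D g A) K s ε T := by
  obtain ⟨ε, hε, T, hT1, hT2⟩ := exists_transport volume (contDiff_quadraticHamiltonian bg) hK
    (s₀ := s) (fun z _ h0 =>
      quadratic_regular bg (add_pos_of_nonneg_of_pos (bg.nonneg z.1) hs) h0)
  exact ⟨ε, hε, T, hT1, hT2⟩

theorem contDiffAt_superlevelIntegral_quadratic {K : Set (Phase d)} (hK : IsCompact K)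
    {f : Phase d → ℂ} (hf : IsTestOn K f) {s : ℝ} (hs : 0 < s) :
    ContDiffAt ℝ (⊤ : ℕ∞) (superlevelIntegral volume (quadraticHamiltonian D g A) f) s := by
  obtain ⟨ε, hε, T, hT⟩ := exists_transport_quadratic bg hK hs
  exact (contDiffOn_superlevelIntegral hT (contDiff_quadraticHamiltonian bg).continuous hK
    hf).contDiffAt (Metric.ball_mem_nhds s hε)

/-- The second derivative of `(u + s)₊²` is `2 θ(u + s)`; the first is taken under the integral, the
second through the continuity of the superlevel integral for `s > 0`. -/
theorem deriv_deriv_radialMoment {K : Set (Phase d)} (hK : IsCompact K) {f : Phase d → ℂ}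
    (hf : IsTestOn K f) {s : ℝ} (hs : 0 < s) :
    deriv (deriv (radialMoment D (quadraticHamiltonian D g A) 0 0 f)) s =
      2 * superlevelIntegral volume (quadraticHamiltonian D g A) f s := by
  have hh := (contDiff_quadraticHamiltonian bg).continuous
  have e1 : deriv (radialMoment D (quadraticHamiltonian D g A) 0 0 f) =
      fun s => 2 * ∫ z, (posPow 1 (quadraticHamiltonian D g A z + s) : ℂ) * f z := by
    funext s
    have hpow : ∀ k, Continuous fun q : ℝ × Phase d =>
        posPow k (quadraticHamiltonian D g A q.2 + q.1) := fun k =>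
      (continuous_posPow k).comp ((hh.comp continuous_snd).add continuous_fst)
    have key := hasDerivAt_integral_mul_test volume hK hf (U := Set.univ) isOpen_univ
      (G := fun t z => posPow 2 (quadraticHamiltonian D g A z + t))
      (G' := fun t z => 2 * posPow 1 (quadraticHamiltonian D g A z + t))
      (fun t _ => (continuous_posPow 2).comp (hh.add continuous_const))
      (Continuous.continuousOn (continuous_const.mul (hpow 1) : Continuous fun q : ℝ × Phase d =>
        2 * posPow 1 (quadraticHamiltonian D g A q.2 + q.1)))
      (fun t _ z => ((hasDerivAt_posPow 0 _).comp t
        ((hasDerivAt_id t).const_add _)).congr_deriv (by simp)) (Set.mem_univ s)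
    have e : radialMoment D (quadraticHamiltonian D g A) 0 0 f =
        fun s => ∫ z, (posPow 2 (quadraticHamiltonian D g A z + s) : ℂ) * f z := by
      funext s
      simp [radialMoment]
    rw [e, key.deriv, ← integral_const_mul]
    congr 1
    funext z
    push_cast
    ring
  have hc : ContinuousOn (superlevelIntegral volume (quadraticHamiltonian D g A) f) (Set.Ioi 0) :=
    fun t ht => (contDiffAt_superlevelIntegral_quadratic bg hK hf
      ht).continuousAt.continuousWithinAt
  rw [e1]
  exact ((hasDerivAt_integral_posPart volume hh hK hf isOpen_Ioi hc hs).const_mul 2).deriv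

theorem exists_tendsto_superlevelIntegral_quadratic {K : Set (Fin d → ℝ)} (hK : IsCompact K)
    {R : ℝ} {f : Phase d → ℂ} (hf : IsTestOn (K ×ˢ Metric.closedBall 0 R) f) (hd : Even d)
    (n : ℕ) : ∃ v, Tendsto (iteratedDeriv n
      (superlevelIntegral volume (quadraticHamiltonian D g A) f)) (𝓝[>] 0) (𝓝 v) := by
  have hKp : IsCompact (K ×ˢ Metric.closedBall (0 : Fin d → ℝ) R) :=
    hK.prod (isCompact_closedBall _ _)
  -- Two derivatives lead from the moment to the superlevel integral, and one beyond `n` gives the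
  -- Lipschitz bound for its `n`-th derivative.
  obtain ⟨C, hC⟩ := radialMoment_bounded_derivatives bg hK hf hd (n + 1 + 2)
  refine exists_tendsto_of_deriv_bound (C := C) (fun s hs => ?_) fun s hs => ?_
  · have h1 := (contDiffAt_superlevelIntegral_quadratic bg hKp hf
      hs.1).contDiffWithinAt.differentiableWithinAt_iteratedDerivWithin (m := n) (s := Set.univ)
      (by exact_mod_cast ENat.natCast_lt_top n) (by simp)
    rwa [iteratedDerivWithin_univ, differentiableWithinAt_univ] at h1
  · have e : deriv (deriv (radialMoment D (quadraticHamiltonian D g A) 0 0 f)) =ᶠ[𝓝 s]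
        fun s => 2 * superlevelIntegral volume (quadraticHamiltonian D g A) f s := by
      filter_upwards [lt_mem_nhds hs.1] with t ht using deriv_deriv_radialMoment bg hKp hf ht
    have h1 := hC s hs
    rw [iteratedDeriv_succ', iteratedDeriv_succ', e.iteratedDeriv_eq,
      iteratedDeriv_const_mul_field, norm_mul, Complex.norm_two] at h1
    rw [← iteratedDeriv_succ]
    linarith [norm_nonneg (iteratedDeriv (n + 1)
      (superlevelIntegral volume (quadraticHamiltonian D g A) f) s)]

/-- For every `s > 0` the level is regular and the variation is `-s` times a sum of derivatives.
These have finite limits as `s → 0⁺`, so the product tends to zero. -/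
theorem invariantAtOrder_quadratic_of_even (hd : Even d) {Δ : Phase d → ℝ}
    (hΔ : ContDiff ℝ (⊤ : ℕ∞) Δ) {ω : Phase d → ℂ} (hω : IsGaugeParameter ω) (a b : ℕ) :
    InvariantAtOrder (𝓝[>] 0) (quadraticHamiltonian D g A) Δ ω a b := by
  have hh := contDiff_quadraticHamiltonian bg
  set h := quadraticHamiltonian D g A
  obtain ⟨K, hK, hωK⟩ := hω.exists_support
  have hωs := hω.contDiff
  obtain ⟨R₀, hR₀, hR⟩ := exists_momentum_bound bg hK
  obtain ⟨ω', hω's, hω'K, hωω'⟩ := exists_cutoff hωs hK hωK hR₀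
  have hK' : IsCompact (K ×ˢ Metric.closedBall (0 : Fin d → ℝ) (R₀ + 2)) :=
    hK.prod (isCompact_closedBall _ _)
  have hf' := fun n => isTestOn_density_gaugeSymbol hh hΔ hω's hω'K n a b
  have hg' := fun n => isTestOn_gaugeWeight hh hΔ hω's hω'K n a b
  choose I hI using fun n => exists_tendsto_superlevelIntegral_quadratic bg hK (hf' n) hd n
  choose J hJ using fun n => exists_tendsto_superlevelIntegral_quadratic bg hK (hg' n) hd (n + 1)
  refine ⟨I, fun n _ => ?_, ?_⟩
  · refine hasThetaIntegral_of_cutoff (f' := (gaugeSymbol h Δ ω').density n a b 1)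
      (R₀ := R₀) hh.continuous hK
      (contDiff_density_gaugeSymbol hh hΔ hωs n a b 1).continuous (fun z hz => ?_)
      (hf' n) (fun z hz => ?_) (fun R => ?_) ?_ (hI n)
    · refine density_gaugeSymbol_eq_zero hh hΔ ?_ n a b
      rw [notMem_tsupport_iff_eventuallyEq]
      have ho : IsOpen {z : Phase d | z.1 ∉ K} := hK.isClosed.isOpen_compl.preimage continuous_fst
      filter_upwards [ho.mem_nhds hz] with y hy using hωK y hy
    · exact (gaugeSymbol_germEq h Δ (hωω' z hz)).density_eq n a b 1
    · refine ⟨Set.Ioo 0 1, Ioo_mem_nhdsGT one_pos, isOpen_Ioo,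
        fun z hz h1 _ s hs t _ h0 => ?_, fun s hs => ?_⟩
      · have := hR z hz (by linarith [hs.2])
        linarith
      · exact contDiffAt_superlevelIntegral_quadratic bg hK' (hf' n) hs.1
    · rintro rfl
      exact ⟨density_gaugeSymbol_order_zero h Δ ω a b, density_gaugeSymbol_order_zero h Δ ω' a b⟩
  · have h1 := tendsto_finsetSum (Finset.range (2 * a + b + 1 + 1)) fun n _ => hI n
    have h2 : Tendsto (fun s : ℝ => -(s : ℂ) * ∑ n ∈ Finset.range (2 * a + b + 1),
        iteratedDeriv (n + 1) (superlevelIntegral volume h (gaugeWeight h Δ ω' a b n)) s)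
        (𝓝[>] 0) (𝓝 (-((0 : ℝ) : ℂ) * ∑ n ∈ Finset.range (2 * a + b + 1), J n)) :=
      (((Complex.continuous_ofReal.tendsto 0).mono_left nhdsWithin_le_nhds).neg).mul
        (tendsto_finsetSum _ fun n _ => hJ n)
    rw [Complex.ofReal_zero, neg_zero, zero_mul] at h2
    refine tendsto_nhds_unique h2 (h1.congr' ?_)
    filter_upwards [self_mem_nhdsWithin] with s hs
    obtain ⟨ε, hε, T, hT⟩ := exists_transport_quadratic bg hK' hs
    exact variation_identity hh hΔ hω's hω'K hK' hT a b (by simpa using hε)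

end Quadratic

theorem IsHigherRank.contDiff {Δ : Phase d → ℝ} (hΔ : IsHigherRank Δ) :
    ContDiff ℝ (⊤ : ℕ∞) Δ := by
  obtain ⟨c, hc, -⟩ := hΔ
  exact hc.smooth

end QuantizedVolume

end

/-! ### The classes of Hamiltonians in the theorem -/

theorem mainTheorem5 (d : ℕ) :
    -- gauge invariance for Hamiltonians of the class `C_p`, order by order in `ħ`
    (∀ H : QuantizedVolume.Phase d → ℝ, QuantizedVolume.ClassCp H →
      ∀ ω : QuantizedVolume.Phase d → ℂ, QuantizedVolume.IsGaugeParameter ω →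
        ∀ a : ℕ, QuantizedVolume.InvariantAtOrder (nhds 0) H 0 ω a 0) ∧
    (∀ (D : (Fin d → ℝ) → ℝ) (g : (Fin d → ℝ) → Matrix (Fin d) (Fin d) ℝ)
      (A : (Fin d → ℝ) → Fin d → ℝ) (Δ : QuantizedVolume.Phase d → ℝ),
      QuantizedVolume.IsEuclideanBackground D g A → QuantizedVolume.IsHigherRank Δ →
      ∀ ω : QuantizedVolume.Phase d → ℂ, QuantizedVolume.IsGaugeParameter ω →
        -- `H = H₂ + ΔH` with compact constraint surface, order by order in `ħ`
        ((∀ K : Set (Fin d → ℝ), IsCompact K → IsCompact {z : QuantizedVolume.Phase d |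
              z.1 ∈ K ∧ QuantizedVolume.quadraticHamiltonian D g A z + Δ z = 0}) →
          QuantizedVolume.IsRegularSurface
            (fun z => QuantizedVolume.quadraticHamiltonian D g A z + Δ z) →
          ∀ a : ℕ, QuantizedVolume.InvariantAtOrder (nhds 0)
            (fun z => QuantizedVolume.quadraticHamiltonian D g A z + Δ z) 0 ω a 0) ∧
        -- `H = H₂ + w ΔH`, order by order in `ħ` and `w`
        ((∀ x, 0 < D x) → ∀ a b : ℕ, QuantizedVolume.InvariantAtOrder (nhds 0)
            (QuantizedVolume.quadraticHamiltonian D g A) Δ ω a b) ∧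
        (Even d → ∀ a b : ℕ, QuantizedVolume.InvariantAtOrder (nhdsWithin 0 (Set.Ioi 0))
            (QuantizedVolume.quadraticHamiltonian D g A) Δ ω a b)) := by
  refine ⟨fun H hH ω hω a => ?_, fun D g A Δ bg hΔ ω hω => ⟨fun hcomp hreg a => ?_,
    fun hD a b => ?_, fun hd a b => ?_⟩⟩
  · refine QuantizedVolume.invariantAtOrder_of_regular hH.smooth contDiff_const hH.regular
      (fun K hK => (hH.compact_inside K hK).of_isClosed_subset ?_ ?_) hω a 0
    · exact (hK.isClosed.preimage continuous_fst).inter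
        (isClosed_eq hH.smooth.continuous continuous_const)
    · exact fun z hz => ⟨hz.1, hz.2.ge⟩
  · exact QuantizedVolume.invariantAtOrder_of_regular
      ((QuantizedVolume.contDiff_quadraticHamiltonian bg).add hΔ.contDiff) contDiff_const hreg
      hcomp hω a 0
  · exact QuantizedVolume.invariantAtOrder_of_regular
      (QuantizedVolume.contDiff_quadraticHamiltonian bg) hΔ.contDiff
      -- With `D > 0` the zero level itself is regular, so no boundary value is needed and the
      -- parity of `d` plays no role.
      (fun z h0 => QuantizedVolume.quadratic_regular bg (s := 0) (by simpa using hD z.1)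
        (by simpa using h0))
      (fun K hK => QuantizedVolume.isCompact_quadratic_zero bg hK) hω a b
  · exact QuantizedVolume.invariantAtOrder_quadratic_of_even bg hd hΔ.contDiff hω a b
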